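/- A relation over a nonempty finite set $U$ of attributes with values in a domain $D$ is a finite set of tuples $t:U\to D$. Its arity is $m=|U|$ and its size is $n$, the number of its tuples. A relation $Q$ over $U'$, $\emptyset\ne U'\subseteq U$, is a factor of $R$ if $R=Q$, or $R=Q\times R'$ for some relation $R'$ over $U\setminus U'$. A relation is prime if it has no factor other than itself. A prime factorization of $R$ is a set of prime factors of $R$ whose product is $R$ (their schemata then partition $U$). Machine model. A unit-cost random access machine with a fixed finite program has the input in storage as an array of $n$ rows and $m$ columns (the tuples in arbitrary order, the attributes in arbitrary order, no repetitions). Domain elements are atomic: two stored values can be compared in a linear order of $D$ in one step, and a value or an attribute name can be copied to a write-only output, but they cannot be manipulated otherwise. The working memory consists of words holding natural numbers at most $(m+n)^{C}$ for a constant $C$ (that is, of $O(\log(m+n))$ bits), with unit-cost arithmetic $+,-,\cdot,\mathrm{div},\mathrm{mod}$ and comparison. Time is the number of steps. Space is the number of words of working memory; storage and output are not counted. The machine is called read-only if it never modifies the storage, and permuting if it may exchange two rows of the stored table, at a cost of $m+1$ steps, but cannot modify the storage otherwise. The machine computes the prime factorization of $R$ if, for every table listing $R$, it outputs a list of tables that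 represent the members of the prime factorization of $R$, each exactly once. Theorem. Every nonempty relation has exactly one prime factorization. Moreover, uniformly in all sets of attributes, all linearly ordered domains and all nonempty relations $R$ of arity $m$ and size $n$, with absolute constants in the $O(\cdot)$ and with $\lambda(n)=\lfloor\log_2(n+1)\rfloor$: 1. There is a read-only machine that computes the prime factorization of $R$ in time $O(m\cdot n\cdot \lambda(n))$ and space $O(n+m\cdot\lambda(n))$. 2. There is a permuting machine that computes the prime factorization of $R$ in time $O(m\cdot n\cdot\lambda(n)^2)$ and space $O(m\cdot\lambda(n))$. (For $n\ge 2$, $\lambda(n)$ can be replaced by $\log n$.) -/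

import Mathlib

universe u v

namespace PrimeFact

/-! ## Relations, products, factors and prime factorizations (named perspective) -/

/-- A relation over a nonempty finite set `sch` of attributes from `A`: a finite set of tuples,
a tuple assigning a value of the domain `D` to every attribute of the schema. -/
structure Reln (A : Type u) (D : Type v) where
  sch : Finset A
  sch_nonempty : sch.Nonempty
  tuples : Finset (sch → D)

namespace Reln

variable {A : Type u} {D : Type v}

/-- The number of attributes. -/
def arity (R : Reln A D) : ℕ := R.sch.card

/-- The number of tuples. -/
def size (R : Reln A D) : ℕ := R.tuples.card

/-- The restriction of `t` to the schema of `R` is a tuple of `R`. -/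
def Has (R : Reln A D) (t : A → D) : Prop := (fun a : R.sch => t a) ∈ R.tuples

/-- `R = Q × Q₁`: the schemata of `Q` and `Q₁` partition that of `R`, and a tuple is in `R` if and
only if its two restrictions are in `Q` and in `Q₁`. -/
def IsProd (R Q Q₁ : Reln A D) : Prop :=
  Disjoint Q.sch Q₁.sch ∧ (∀ a, a ∈ R.sch ↔ a ∈ Q.sch ∨ a ∈ Q₁.sch) ∧
    ∀ t : A → D, R.Has t ↔ Q.Has t ∧ Q₁.Has t

/-- `R` is the product of the relations in `Fs`. -/
def IsProdOf (R : Reln A D) (Fs : Set (Reln A D)) : Prop :=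
  (∀ F ∈ Fs, ∀ G ∈ Fs, F ≠ G → Disjoint F.sch G.sch) ∧
    (∀ a, a ∈ R.sch ↔ ∃ F ∈ Fs, a ∈ F.sch) ∧
    ∀ t : A → D, R.Has t ↔ ∀ F ∈ Fs, F.Has t

/-- `Q` is a factor of `R`. Relations have nonempty schemata here, so that the case of an empty
cofactor, in which the factor is `R` itself, is listed separately. -/
def IsFactor (Q R : Reln A D) : Prop := Q = R ∨ ∃ Q₁, R.IsProd Q Q₁

/-- `Q` is prime: it has no factor other than itself. -/
def IsPrime (Q : Reln A D) : Prop := ∀ P : Reln A D, P.IsFactor Q → P = Q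

/-- `Fs` is a set of factors of `R` whose product is `R`. -/
def IsFactorization (R : Reln A D) (Fs : Set (Reln A D)) : Prop :=
  (∀ F ∈ Fs, F.IsFactor R) ∧ R.IsProdOf Fs

/-- A factorization all of whose factors are prime. -/
def IsPrimeFactorization (R : Reln A D) (Fs : Set (Reln A D)) : Prop :=
  R.IsFactorization Fs ∧ ∀ F ∈ Fs, F.IsPrime

end Reln

/-- A table: the way a relation is written down. Attributes are listed in some order without
repetition, and so are the tuples. -/
structure Table (A : Type u) (D : Type v) where
  arity : ℕ
  size : ℕ
  attr : Fin arity → A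
  attr_injective : Function.Injective attr
  rows : Fin size → Fin arity → D
  rows_injective : Function.Injective rows

/-- The table `T` lists exactly the attributes and the tuples of the relation `R`. -/
def Table.Represents {A : Type u} {D : Type v} (T : Table A D) (R : Reln A D) : Prop :=
  (∀ a, a ∈ R.sch ↔ ∃ j, T.attr j = a) ∧
    ∀ t : A → D, R.Has t ↔ ∃ i, ∀ j, t (T.attr j) = T.rows i j

/-! ## The output format -/

/-- Symbols of the write-only output. -/
inductive Token (A : Type u) (D : Type v) where
  | table : Token A D
  | attr (a : A) : Token A D
  | row : Token A D
  | value (d : D) : Token A D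

/-- A table is written as its list of attributes followed by its rows. -/
def Table.encode {A : Type u} {D : Type v} (T : Table A D) : List (Token A D) :=
  Token.table :: (List.ofFn fun j => Token.attr (T.attr j)) ++
    (List.ofFn fun i => Token.row :: List.ofFn fun j => Token.value (T.rows i j)).flatten

/-- A list of tables is written one table after the other. -/
def encodeTables {A : Type u} {D : Type v} (Ts : List (Table A D)) : List (Token A D) :=
  (Ts.map Table.encode).flatten

/-! ## The machine model

A random access machine. The input relation lies in storage as an array of rows, which can be
read at arbitrary positions, and whose rows can be exchanged but not altered. Atomic values can
only be compared in the order of the domain and be copied to the output. The working memory is an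
array of machine words, natural numbers up to a bound. The programs are those of a while
language with indirect addressing; they are finite, and the same program runs on all inputs. -/

/-- Expressions. `load a` is the content of the memory cell with address `a`; `valLT i₁ j₁ i₂ j₂`
compares the value in row `i₁`, column `j₁` with the value in row `i₂`, column `j₂`. -/
inductive Expr where
  | lit (k : ℕ) : Expr
  | arity : Expr
  | size : Expr
  | load (a : Expr) : Expr
  | add (a b : Expr) : Expr
  | sub (a b : Expr) : Expr
  | mul (a b : Expr) : Expr
  | div (a b : Expr) : Expr
  | mod (a b : Expr) : Expr
  | lt (a b : Expr) : Expr
  | eq (a b : Expr) : Expr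
  | valLT (i₁ j₁ i₂ j₂ : Expr) : Expr

/-- Programs. -/
inductive Stmt where
  | skip : Stmt
  /-- write the word `e` to the memory cell with address `a` -/
  | store (a e : Expr) : Stmt
  /-- exchange two rows of the relation in storage -/
  | swap (i₁ i₂ : Expr) : Stmt
  /-- output the symbol that starts a table -/
  | outTable : Stmt
  /-- output the name of the attribute in column `j` -/
  | outAttr (j : Expr) : Stmt
  /-- output the symbol that starts a row -/
  | outRow : Stmt
  /-- output the value in row `i`, column `j` -/
  | outValue (i j : Expr) : Stmt
  | seq (s₁ s₂ : Stmt) : Stmt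
  | ite (c : Expr) (s₁ s₂ : Stmt) : Stmt
  | loop (c : Expr) (s : Stmt) : Stmt

/-- The program contains no exchange of rows: the relation in storage is read-only. -/
def Stmt.ReadOnly : Stmt → Prop
  | .swap _ _ => False
  | .seq s₁ s₂ => s₁.ReadOnly ∧ s₂.ReadOnly
  | .ite _ s₁ s₂ => s₁.ReadOnly ∧ s₂.ReadOnly
  | .loop _ s => s.ReadOnly
  | _ => True

/-- The state of the machine on an input with `m` columns and `n` rows. -/
structure State (A : Type u) (D : Type v) (m n : ℕ) where
  mem : ℕ → ℕ
  rows : Fin n → Fin m → D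
  out : List (Token A D)

/-- The resources of the machine: the memory cells are those with an address below `cells`, and
all words are at most `maxWord`. -/
structure Limits where
  cells : ℕ
  maxWord : ℕ

section Semantics

variable {A : Type u} {D : Type v} [LinearOrder D] {m n : ℕ}

open scoped Classical in
/-- The value of an expression; truth values are `1` and `0`. -/
noncomputable def Expr.val (st : State A D m n) : Expr → ℕ
  | .lit k => k
  | .arity => m
  | .size => n
  | .load a => st.mem (a.val st)
  | .add a b => a.val st + b.val st
  | .sub a b => a.val st - b.val st
  | .mul a b => a.val st * b.val st
  | .div a b => a.val st / b.val st
  | .mod a b => a.val st % b.val st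
  | .lt a b => if a.val st < b.val st then 1 else 0
  | .eq a b => if a.val st = b.val st then 1 else 0
  | .valLT i₁ j₁ i₂ j₂ =>
      if ∃ (h₁ : i₁.val st < n) (k₁ : j₁.val st < m) (h₂ : i₂.val st < n) (k₂ : j₂.val st < m),
          st.rows ⟨i₁.val st, h₁⟩ ⟨j₁.val st, k₁⟩ < st.rows ⟨i₂.val st, h₂⟩ ⟨j₂.val st, k₂⟩
      then 1 else 0

/-- The evaluation of an expression respects the limits: every address is that of a memory cell,
every position in storage exists, and every intermediate result fits into a word. -/
def Expr.Safe (L : Limits) (st : State A D m n) : Expr → Prop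
  | .lit k => k ≤ L.maxWord
  | .arity => m ≤ L.maxWord
  | .size => n ≤ L.maxWord
  | .load a => a.Safe L st ∧ a.val st < L.cells
  | .add a b => a.Safe L st ∧ b.Safe L st ∧ a.val st + b.val st ≤ L.maxWord
  | .sub a b => a.Safe L st ∧ b.Safe L st
  | .mul a b => a.Safe L st ∧ b.Safe L st ∧ a.val st * b.val st ≤ L.maxWord
  | .div a b => a.Safe L st ∧ b.Safe L st
  | .mod a b => a.Safe L st ∧ b.Safe L st
  | .lt a b => a.Safe L st ∧ b.Safe L st
  | .eq a b => a.Safe L st ∧ b.Safe L st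
  | .valLT i₁ j₁ i₂ j₂ =>
      i₁.Safe L st ∧ j₁.Safe L st ∧ i₂.Safe L st ∧ j₂.Safe L st ∧
        i₁.val st < n ∧ j₁.val st < m ∧ i₂.val st < n ∧ j₂.val st < m

/-- `Exec attr L s st t st₁`: from the state `st`, the program `s` terminates in the state `st₁`
after `t` steps without exceeding the limits `L`. Every elementary statement and every evaluation
of a condition is one step, except that exchanging two rows takes as many steps as there are
columns, plus one. -/
inductive Exec (attr : Fin m → A) (L : Limits) :
    Stmt → State A D m n → ℕ → State A D m n → Prop where
  | skip (st : State A D m n) : Exec attr L .skip st 1 st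
  | store (st : State A D m n) (a e : Expr) (ha : a.Safe L st) (hc : a.val st < L.cells)
      (he : e.Safe L st) :
      Exec attr L (.store a e) st 1
        { st with mem := Function.update st.mem (a.val st) (e.val st) }
  | swap (st : State A D m n) (e₁ e₂ : Expr) (i₁ i₂ : Fin n) (hs₁ : e₁.Safe L st)
      (hs₂ : e₂.Safe L st) (h₁ : e₁.val st = i₁) (h₂ : e₂.val st = i₂) :
      Exec attr L (.swap e₁ e₂) st (m + 1) { st with rows := st.rows ∘ Equiv.swap i₁ i₂ }
  | outTable (st : State A D m n) :
      Exec attr L .outTable st 1 { st with out := st.out ++ [Token.table] }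
  | outAttr (st : State A D m n) (e : Expr) (j : Fin m) (hs : e.Safe L st) (h : e.val st = j) :
      Exec attr L (.outAttr e) st 1 { st with out := st.out ++ [Token.attr (attr j)] }
  | outRow (st : State A D m n) :
      Exec attr L .outRow st 1 { st with out := st.out ++ [Token.row] }
  | outValue (st : State A D m n) (e₁ e₂ : Expr) (i : Fin n) (j : Fin m) (hs₁ : e₁.Safe L st)
      (hs₂ : e₂.Safe L st) (h₁ : e₁.val st = i) (h₂ : e₂.val st = j) :
      Exec attr L (.outValue e₁ e₂) st 1 { st with out := st.out ++ [Token.value (st.rows i j)] }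
  | seq (st st₁ st₂ : State A D m n) (s₁ s₂ : Stmt) (t₁ t₂ : ℕ) (h₁ : Exec attr L s₁ st t₁ st₁)
      (h₂ : Exec attr L s₂ st₁ t₂ st₂) : Exec attr L (.seq s₁ s₂) st (t₁ + t₂) st₂
  | iteTrue (st st₁ : State A D m n) (c : Expr) (s₁ s₂ : Stmt) (t : ℕ) (hs : c.Safe L st)
      (hc : c.val st ≠ 0) (h : Exec attr L s₁ st t st₁) :
      Exec attr L (.ite c s₁ s₂) st (t + 1) st₁
  | iteFalse (st st₁ : State A D m n) (c : Expr) (s₁ s₂ : Stmt) (t : ℕ) (hs : c.Safe L st)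
      (hc : c.val st = 0) (h : Exec attr L s₂ st t st₁) :
      Exec attr L (.ite c s₁ s₂) st (t + 1) st₁
  | loopDone (st : State A D m n) (c : Expr) (s : Stmt) (hs : c.Safe L st)
      (hc : c.val st = 0) : Exec attr L (.loop c s) st 1 st
  | loopStep (st st₁ st₂ : State A D m n) (c : Expr) (s : Stmt) (t₁ t₂ : ℕ) (hs : c.Safe L st)
      (hc : c.val st ≠ 0) (h₁ : Exec attr L s st t₁ st₁)
      (h₂ : Exec attr L (.loop c s) st₁ t₂ st₂) :
      Exec attr L (.loop c s) st (t₁ + t₂ + 1) st₂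

/-- The initial state: the table in storage, the memory cleared, the output empty. -/
def Table.start (T : Table A D) : State A D T.arity T.size where
  mem := fun _ => 0
  rows := T.rows
  out := []

/-- On the input table `T`, the program `P` terminates within `time` steps, using at most `cells`
memory cells holding words of size at most `maxWord`, and outputs `Ts`. -/
def Stmt.Outputs (P : Stmt) (T : Table A D) (time cells maxWord : ℕ) (Ts : List (Table A D)) :
    Prop :=
  ∃ t ≤ time, ∃ st, Exec T.attr ⟨cells, maxWord⟩ P T.start t st ∧ st.out = encodeTables Ts

/-- Whichever table represents the relation `R`, the program `P` outputs, within the given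
resources, a list of tables that represent, each exactly once, the members of a prime
factorization of `R`. -/
def Stmt.Factorizes (P : Stmt) (R : Reln A D) (time cells maxWord : ℕ) : Prop :=
  ∀ T : Table A D, T.Represents R →
    ∃ (Ts : List (Table A D)) (Fs : List (Reln A D)),
      P.Outputs T time cells maxWord Ts ∧ List.Forall₂ Table.Represents Ts Fs ∧ Fs.Nodup ∧
        R.IsPrimeFactorization {F | F ∈ Fs}

end Semantics

end PrimeFact

-- A set `X` of attributes splits a set `S` of tuples if `S` is closed under mixing two of its
-- tuples, one taken on `X` and the other elsewhere (`Split`). Splits are closed under complement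
-- and intersection, so the attributes that no split separates form classes (`Insep`), and over a
-- finite schema each class is itself a split (`split_class`). The factors of a nonempty relation
-- are exactly its projections to the schemata at which it splits (`Reln.isFactor_iff`). Hence the
-- projections to the classes are the only prime factorization (`Reln.isPrimeFactorization_iff`),
-- and a machine has to find the classes.
--
-- The classes come from recursion on selections. Let `S'` consist of the tuples of `S` with an
-- occurring value `v` in a nonconstant column `A`. Splits of `S` split `S'`; conversely, a split of
-- `S'` that lies inside a split of `S` avoiding `A` also splits `S` (`Split.of_select`). So the
-- class of `A` in `S` consists of the columns that the selection made constant and of those classes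
-- of `S'` that do not split `S`; the other classes of nonconstant columns stay as they are
-- (`insep_iff_of_select`). A column constant in `S` is a class by itself. If `v` occurs in at most
-- half of the rows, there are `L ≤ λ(n)` selections, on at most `2n` rows altogether
-- (`Chain.le_log`, `Chain.sum_le`). Every class of nonconstant columns is labelled by a selected
-- column, so at most `L` classes are tested on each level.
--
-- To test a class, the rows are sorted by its columns, ties being broken by the lexicographic order
-- of whole rows. The rows split at the class if and only if the sorted list is a grid of equal
-- groups (`GridTest.split`, `gridTest_of_split`). A comparison costs the size of the class plus one
-- tie-break, and the sizes of the classes on a level add up to at most `m`. With `c` the cost of a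
-- tie-break and an exchange, the total is `O(n λ(n) (m + L c))`. Sorting an array of row indices
-- with precomputed ranks makes `c` constant, and `L ≤ m` gives the first bound; exchanging rows in
-- storage makes `c = O(m)`, and `L ≤ λ(n)` gives the second.
--
-- The algorithm is verified once, on a structured machine with named arrays (`St`, `Runs`),
-- relative to an implementation of row access (`Layer`). `idxLayer` and `permLayer` are the two
-- implementations.

universe w

set_option linter.unusedSectionVars false

namespace PrimeFact

/-! ### Splits, inseparable attributes, and their behaviour under selection -/

section SplitTheory

variable {ι : Type*} {D : Type*}

open scoped Classical in
/-- The tuple that agrees with `s` on `X` and with `t` elsewhere. -/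
noncomputable def mix (X : Set ι) (s t : ι → D) : ι → D := fun a => if a ∈ X then s a else t a

theorem mix_of_mem {X : Set ι} {a : ι} (h : a ∈ X) (s t : ι → D) : mix X s t a = s a := by
  simp [mix, h]

theorem mix_of_notMem {X : Set ι} {a : ι} (h : a ∉ X) (s t : ι → D) : mix X s t a = t a := by
  simp [mix, h]

/-- `S` is the product of its projections to `X` and to the complement of `X`. -/
def Split (S : Set (ι → D)) (X : Set ι) : Prop := ∀ s ∈ S, ∀ t ∈ S, mix X s t ∈ S

/-- The attributes `a` and `b` cannot be separated by splitting `S`. -/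
def Insep (S : Set (ι → D)) (a b : ι) : Prop := ∀ X, Split S X → (a ∈ X ↔ b ∈ X)

/-- All tuples of `S` have the same value at `a`. -/
def ConstAt (S : Set (ι → D)) (a : ι) : Prop := ∀ s ∈ S, ∀ t ∈ S, s a = t a

theorem Split.compl {S : Set (ι → D)} {X : Set ι} (h : Split S X) : Split S Xᶜ := by
  intro s hs t ht
  have : mix Xᶜ s t = mix X t s := by
    funext a; by_cases ha : a ∈ X <;> simp [mix, ha]
  exact this ▸ h t ht s hs

theorem Split.inter {S : Set (ι → D)} {X Y : Set ι} (hX : Split S X) (hY : Split S Y) :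
    Split S (X ∩ Y) := by
  intro s hs t ht
  have : mix (X ∩ Y) s t = mix X (mix Y s t) t := by
    funext a; by_cases ha : a ∈ X <;> by_cases hb : a ∈ Y <;> simp [mix, ha, hb]
  exact this ▸ hX _ (hY s hs t ht) t ht

theorem Insep.refl (S : Set (ι → D)) (a : ι) : Insep S a a := fun _ _ => Iff.rfl

theorem Insep.symm {S : Set (ι → D)} {a b : ι} (h : Insep S a b) : Insep S b a :=
  fun X hX => (h X hX).symm

theorem Insep.trans {S : Set (ι → D)} {a b c : ι} (h : Insep S a b) (h' : Insep S b c) :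
    Insep S a c := fun X hX => (h X hX).trans (h' X hX)

/-- One implication suffices, because the complement of a split is a split. -/
theorem insep_of_forall {S : Set (ι → D)} {a b : ι}
    (h : ∀ Z, Split S Z → a ∈ Z → b ∈ Z) : Insep S a b := fun X hX =>
  ⟨h X hX, fun hb => by_contra fun ha => h Xᶜ hX.compl ha hb⟩

/-- Intersect one split for each attribute of `F` separable from `a`: one that contains `a` but not
that attribute. Only finite intersections are available, whence the finite set `F`. -/
theorem exists_split_class (S : Set (ι → D)) (F : Finset ι) (a : ι) :
    ∃ Y, Split S Y ∧ a ∈ Y ∧ ∀ b ∈ F, b ∈ Y → Insep S a b := by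
  classical
  induction F using Finset.induction_on with
  | empty => exact ⟨Set.univ, fun s hs t _ => by
      rw [show mix Set.univ s t = s by funext; simp [mix]]; exact hs, trivial, by simp⟩
  | insert c F _ ih =>
    obtain ⟨Y, hY, haY, h⟩ := ih
    by_cases hc : Insep S a c
    · refine ⟨Y, hY, haY, fun b hb hbY => ?_⟩
      rcases Finset.mem_insert.1 hb with rfl | hb
      exacts [hc, h b hb hbY]
    · obtain ⟨X, hX, haX, hcX⟩ : ∃ X, Split S X ∧ a ∈ X ∧ c ∉ X := by
        by_contra hn
        push Not at hn
        exact hc (insep_of_forall hn)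
      refine ⟨Y ∩ X, hY.inter hX, ⟨haY, haX⟩, fun b hb hbY => ?_⟩
      rcases Finset.mem_insert.1 hb with rfl | hb
      exacts [absurd hbY.2 hcX, h b hb hbY.1]

/-- Whether `S` splits at a set of attributes depends only on the attributes in `F`. -/
def SupportedOn (S : Set (ι → D)) (F : Finset ι) : Prop :=
  ∀ X Y : Set ι, (∀ a ∈ F, a ∈ X ↔ a ∈ Y) → Split S X → Split S Y

/-- The split given by `exists_split_class` agrees on `F` with the class of `a`: its members in `F`
are inseparable from `a`, and no split containing `a` can miss an attribute inseparable from `a`. -/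
theorem split_class {S : Set (ι → D)} {F : Finset ι} (hF : SupportedOn S F) (a : ι) {X : Set ι}
    (hX : ∀ b ∈ F, b ∈ X ↔ Insep S a b) : Split S X := by
  obtain ⟨Y, hY, haY, h⟩ := exists_split_class S F a
  exact hF Y X (fun b hb => ⟨fun hbY => (hX b hb).2 (h b hb hbY),
    fun hbX => ((hX b hb).1 hbX Y hY).1 haY⟩) hY

theorem supportedOn_of_constAt {S : Set (ι → D)} {F : Finset ι} (h : ∀ a ∉ F, ConstAt S a) :
    SupportedOn S F := by
  intro X Y hXY hX s hs t ht
  have : mix Y s t = mix X s t := by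
    funext a
    by_cases ha : a ∈ F
    · have := hXY a ha
      by_cases hb : a ∈ X <;> simp_all [mix]
    · have := h a ha s hs t ht
      simp [mix, this]
  exact this ▸ hX s hs t ht

section Select

variable {S : Set (ι → D)} {A : ι} {v : D}

theorem Split.select {X : Set ι} (h : Split S X) : Split {s ∈ S | s A = v} X := by
  rintro s ⟨hs, hs'⟩ t ⟨ht, ht'⟩
  refine ⟨h s hs t ht, ?_⟩
  by_cases hA : A ∈ X <;> simp [mix, hA, hs', ht']

theorem Insep.of_select {a b : ι} (h : Insep {s ∈ S | s A = v} a b) : Insep S a b :=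
  fun X hX => h X hX.select

/-- Outside a split that avoids `A`, a tuple can be replaced by one with value `v` at `A`. So the
selection and `S` have the same projection to `Z`. -/
theorem Split.exists_select {Z : Set ι} (hZ : Split S Z) (hA : A ∉ Z)
    (hne : ∃ r ∈ S, r A = v) {s : ι → D} (hs : s ∈ S) :
    ∃ s' ∈ S, s' A = v ∧ ∀ a ∈ Z, s' a = s a := by
  obtain ⟨r, hr, hrv⟩ := hne
  exact ⟨mix Z s r, hZ s hs r hr, by simp [mix, hA, hrv], fun a ha => mix_of_mem ha s r⟩

/-- By `Split.exists_select` everything that happens inside `Z` is already visible in the selection,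
and the part outside `Z` can be chosen freely. -/
theorem Split.of_select {X Z : Set ι} (hX : Split {s ∈ S | s A = v} X) (hZ : Split S Z)
    (hA : A ∉ Z) (hXZ : X ⊆ Z) (hne : ∃ r ∈ S, r A = v) : Split S X := by
  intro s hs t ht
  obtain ⟨s', hs', hsv, hs''⟩ := hZ.exists_select hA hne hs
  obtain ⟨t', ht', htv, ht''⟩ := hZ.exists_select hA hne ht
  -- The mixture formed in the selection is right on `Z`; a second mixing along `Z` restores the
  -- values of `t` outside.
  have h := hZ _ (hX s' ⟨hs', hsv⟩ t' ⟨ht', htv⟩).1 t ht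
  convert h using 1
  funext a
  by_cases ha : a ∈ X
  · simp [mix, ha, hXZ ha, hs'' a (hXZ ha)]
  · by_cases hb : a ∈ Z
    · simp [mix, ha, hb, ht'' a hb]
    · simp [mix, ha, hb]

/-- A split containing `b` but not `A` would make the selection take all the values of `S` at `b`,
so that `b` would be constant in `S` as well. -/
theorem insep_of_constAt_select (hne : ∃ r ∈ S, r A = v) {b : ι} (hb : ¬ ConstAt S b)
    (hb' : ConstAt {s ∈ S | s A = v} b) : Insep S b A := by
  refine insep_of_forall fun Z hZ hbZ => by_contra fun hA => hb fun s hs t ht => ?_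
  obtain ⟨s', hs', hsv, hs''⟩ := hZ.exists_select hA hne hs
  obtain ⟨t', ht', htv, ht''⟩ := hZ.exists_select hA hne ht
  rw [← hs'' b hbZ, ← ht'' b hbZ]
  exact hb' s' ⟨hs', hsv⟩ t' ⟨ht', htv⟩

/-- How the classes of inseparable attributes of `S` arise from those of the selection. -/
theorem insep_iff_of_select {F : Finset ι} (hF : SupportedOn {s ∈ S | s A = v} F)
    (hne : ∃ r ∈ S, r A = v) {β : Type*} (lab lab' : ι → β) (c : β)
    (h₁ : ∀ a ∈ F, ∀ b ∈ F, ¬ ConstAt {s ∈ S | s A = v} b →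
      (lab a = lab b ↔ Insep {s ∈ S | s A = v} a b))
    (h₂ : ∀ b ∈ F, ¬ ConstAt S b → ConstAt {s ∈ S | s A = v} b → lab' b = c)
    (h₃ : ∀ b ∈ F, ¬ ConstAt {s ∈ S | s A = v} b → ¬ Split S {x | x ∈ F ∧ lab x = lab b} →
      lab' b = c)
    (h₄ : ∀ b ∈ F, ¬ ConstAt {s ∈ S | s A = v} b → Split S {x | x ∈ F ∧ lab x = lab b} →
      lab' b = lab b ∧ lab b ≠ c)
    {a b : ι} (ha : a ∈ F) (hb : b ∈ F) (hac : ¬ ConstAt S a) (hbc : ¬ ConstAt S b) :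
    lab' a = lab' b ↔ Insep S a b := by
  have hA : ConstAt {s ∈ S | s A = v} A := fun s hs t ht => hs.2.trans ht.2.symm
  -- A nonconstant attribute either belongs to the class of `A` and is labelled `c`, or lies in a
  -- class of the selection that survives unchanged and is separated from `A`.
  have hbad : ∀ b ∈ F, ¬ ConstAt S b → (lab' b = c ∧ Insep S b A) ∨
      (¬ ConstAt {s ∈ S | s A = v} b ∧ Split S {x | x ∈ F ∧ lab x = lab b} ∧ lab' b = lab b ∧
        lab b ≠ c ∧ ¬ Insep S b A) := by
    intro b hb hbc
    by_cases hb' : ConstAt {s ∈ S | s A = v} b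
    · exact Or.inl ⟨h₂ b hb hbc hb', insep_of_constAt_select hne hbc hb'⟩
    have hcl : Split {s ∈ S | s A = v} {x | x ∈ F ∧ lab x = lab b} :=
      split_class hF b fun x hx => ⟨fun h => ((h₁ x hx b hb hb').1 h.2).symm,
        fun h => ⟨hx, (h₁ x hx b hb hb').2 h.symm⟩⟩
    by_cases hs : Split S {x | x ∈ F ∧ lab x = lab b}
    · refine Or.inr ⟨hb', hs, (h₄ b hb hb' hs).1, (h₄ b hb hb' hs).2, fun hi => ?_⟩
      have h5 := (hi _ hs).1 ⟨hb, rfl⟩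
      have h6 : Insep {s ∈ S | s A = v} A b := (h₁ A h5.1 b hb hb').1 h5.2
      -- A surviving class cannot contain `A`: in the selection `A` is constant, hence splits off
      -- alone, while `b` is not constant there.
      have h7 : Split {s ∈ S | s A = v} {A} := by
        intro s hs t ht
        have : mix {A} s t = t := by
          funext x
          by_cases hx : x = A
          · subst hx; simp [mix, hA s hs t ht]
          · simp [mix, hx]
        rw [this]; exact ht
      exact hb' (((h6 _ h7).1 rfl : b = A) ▸ hA)
    · refine Or.inl ⟨h₃ b hb hb' hs, insep_of_forall fun Z hZ hbZ => by_contra fun hAZ => hs ?_⟩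
      -- A split `Z` of `S` around `b` also splits the selection, so it contains the whole class of
      -- `b` there.
      exact hcl.of_select hZ hAZ (fun x hx =>
        (((h₁ x hx.1 b hb hb').1 hx.2) Z hZ.select).2 hbZ) hne
  have hgood : ∀ a ∈ F, ∀ b ∈ F, ¬ ConstAt {s ∈ S | s A = v} b →
      Split S {x | x ∈ F ∧ lab x = lab b} → (lab a = lab b ↔ Insep S a b) :=
    fun a ha b hb hb' hs => ⟨fun h => ((h₁ a ha b hb hb').1 h).of_select,
      fun h => ((h _ hs).2 ⟨hb, rfl⟩).2⟩
  rcases hbad a ha hac with ⟨ha1, ha2⟩ | ⟨ha1, ha2, ha3, ha4, ha5⟩ <;>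
    rcases hbad b hb hbc with ⟨hb1, hb2⟩ | ⟨hb1, hb2, hb3, hb4, hb5⟩
  · exact ⟨fun _ => ha2.trans hb2.symm, fun _ => ha1.trans hb1.symm⟩
  · refine ⟨fun h => absurd ?_ hb4, fun h => absurd (h.symm.trans ha2) hb5⟩
    rw [← hb3, ← h, ha1]
  · refine ⟨fun h => absurd ?_ ha4, fun h => absurd (h.trans hb2) ha5⟩
    rw [← ha3, h, hb1]
  · rw [ha3, hb3]; exact hgood a ha b hb hb1 hb2

end Select

end SplitTheory

end PrimeFact

/-! ### Factors as projections to splits; existence and uniqueness of the prime factorization -/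

namespace PrimeFact

namespace Reln

variable {A : Type u} {D : Type v}

theorem has_congr (R : Reln A D) {s t : A → D} (h : ∀ a ∈ R.sch, s a = t a) :
    R.Has s ↔ R.Has t := by
  have : (fun a : R.sch => s a) = fun a : R.sch => t a := funext fun a => h a a.2
  simp [Has, this]

theorem exists_extend (R : Reln A D) (u : R.sch → D) :
    ∃ t : A → D, (fun a : R.sch => t a) = u := by
  classical
  -- The nonempty schema provides a default value; `D` is not assumed to be inhabited.
  obtain ⟨a₀, h₀⟩ := R.sch_nonempty
  exact ⟨fun a => if h : a ∈ R.sch then u ⟨a, h⟩ else u ⟨a₀, h₀⟩, funext fun a => by simp⟩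

theorem eq_of_has {Q P : Reln A D} (h : Q.sch = P.sch) (h' : ∀ t, Q.Has t ↔ P.Has t) : Q = P := by
  obtain ⟨X, hX, U⟩ := Q
  obtain ⟨Y, hY, V⟩ := P
  obtain rfl : X = Y := h
  congr
  ext u
  obtain ⟨t, rfl⟩ := exists_extend ⟨X, hX, U⟩ u
  exact h' t

theorem exists_has {R : Reln A D} (h : R.tuples.Nonempty) : ∃ t, R.Has t := by
  obtain ⟨u, hu⟩ := h
  obtain ⟨t, rfl⟩ := R.exists_extend u
  exact ⟨t, hu⟩

open scoped Classical in
/-- The projection of a relation. -/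
noncomputable def proj (R : Reln A D) (X : Finset A) (hX : X.Nonempty) (h : X ⊆ R.sch) :
    Reln A D where
  sch := X
  sch_nonempty := hX
  tuples := R.tuples.image fun u a => u ⟨a, h a.2⟩

theorem proj_has (R : Reln A D) (X : Finset A) (hX : X.Nonempty) (h : X ⊆ R.sch) (t : A → D) :
    (R.proj X hX h).Has t ↔ ∃ s, R.Has s ∧ ∀ a ∈ X, s a = t a := by
  classical
  constructor
  · intro ht
    obtain ⟨u, hu, hut⟩ := Finset.mem_image.1 ht
    obtain ⟨s, rfl⟩ := R.exists_extend u
    exact ⟨s, hu, fun a ha => congrFun hut ⟨a, ha⟩⟩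
  · rintro ⟨s, hs, hst⟩
    exact Finset.mem_image.2 ⟨_, hs, funext fun a => hst a a.2⟩

theorem has_of_eq_proj {Q R : Reln A D} {h : Q.sch ⊆ R.sch}
    (hQ : Q = R.proj Q.sch Q.sch_nonempty h) (t : A → D) :
    Q.Has t ↔ ∃ s, R.Has s ∧ ∀ a ∈ Q.sch, s a = t a :=
  (iff_of_eq (congrArg (·.Has t) hQ)).trans (proj_has ..)

theorem proj_self (R : Reln A D) : R.proj R.sch R.sch_nonempty (Finset.Subset.refl _) = R :=
  eq_of_has rfl fun t => by
    rw [proj_has]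
    exact ⟨fun ⟨s, hs, h⟩ => (R.has_congr h).1 hs, fun h => ⟨t, h, fun _ _ => rfl⟩⟩

theorem proj_of_eq {R : Reln A D} {X : Finset A} (hX : X.Nonempty) (h : X ⊆ R.sch)
    (he : X = R.sch) : R.proj X hX h = R := by
  subst he
  exact R.proj_self

/-- The tuples over all attributes whose restriction is in `R`. -/
def cyl (R : Reln A D) : Set (A → D) := {t | R.Has t}

theorem supportedOn_cyl (R : Reln A D) : SupportedOn R.cyl R.sch := fun X Y h hX s hs t ht =>
  by
  classical
  refine (R.has_congr fun a ha => ?_).1 (hX s hs t ht)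
  by_cases haX : a ∈ X
  · rw [mix_of_mem haX, mix_of_mem ((h a ha).1 haX)]
  · rw [mix_of_notMem haX, mix_of_notMem fun h' => haX ((h a ha).2 h')]

theorem IsProd.split {R Q Q₁ : Reln A D} (h : R.IsProd Q Q₁) : Split R.cyl Q.sch := by
  obtain ⟨hd, -, hh⟩ := h
  intro s hs t ht
  refine (hh _).2 ⟨(Q.has_congr fun a ha => ?_).1 ((hh s).1 hs).1,
    (Q₁.has_congr fun a ha => ?_).1 ((hh t).1 ht).2⟩
  · exact (mix_of_mem ha s t).symm
  · exact (mix_of_notMem (fun h => (Finset.disjoint_left.1 hd h ha)) s t).symm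

/-- A tuple of `R` is needed to supply the values on the cofactor that complete a tuple of `Q`; in
an empty product the factors are not determined. -/
theorem IsProd.eq_proj {R Q Q₁ : Reln A D} (h : R.IsProd Q Q₁) (hne : ∃ s, R.Has s)
    (hs : Q.sch ⊆ R.sch) : Q = R.proj Q.sch Q.sch_nonempty hs := by
  obtain ⟨hd, -, hh⟩ := h
  refine eq_of_has rfl fun t => ?_
  rw [proj_has]
  refine ⟨fun ht => ?_, fun ⟨s, hs, hst⟩ => (Q.has_congr hst).1 ((hh s).1 hs).1⟩
  obtain ⟨r, hr⟩ := hne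
  refine ⟨mix Q.sch t r, (hh _).2 ⟨(Q.has_congr fun a ha => ?_).1 ht,
    (Q₁.has_congr fun a ha => ?_).1 ((hh r).1 hr).2⟩, fun a ha => mix_of_mem ha t r⟩
  · exact (mix_of_mem ha t r).symm
  · exact (mix_of_notMem (fun h => (Finset.disjoint_left.1 hd h ha)) t r).symm

/-- The translation from factors to splits. The cofactor is the projection to the remaining
attributes; if none remain, the factor is `R` itself. -/
theorem isFactor_iff {Q R : Reln A D} (hne : ∃ s, R.Has s) :
    Q.IsFactor R ↔ Split R.cyl Q.sch ∧ ∃ h, Q = R.proj Q.sch Q.sch_nonempty h := by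
  classical
  constructor
  · rintro (rfl | ⟨Q₁, h⟩)
    · refine ⟨fun s hs t ht => ?_, Finset.Subset.refl _, (proj_self Q).symm⟩
      exact (Q.has_congr fun a ha => (mix_of_mem ha s t).symm).1 hs
    · have hs : Q.sch ⊆ R.sch := fun a ha => (h.2.1 a).2 (Or.inl ha)
      exact ⟨h.split, hs, h.eq_proj hne hs⟩
  · rintro ⟨hsp, hsub, hQ⟩
    by_cases he : (R.sch \ Q.sch).Nonempty
    · refine Or.inr ⟨R.proj _ he Finset.sdiff_subset, Finset.disjoint_sdiff, fun a => ?_,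
        fun t => ?_⟩
      · change _ ↔ _ ∨ a ∈ R.sch \ Q.sch
        by_cases ha : a ∈ Q.sch
        · simp [ha, hsub ha]
        · simp [ha]
      · rw [has_of_eq_proj hQ, proj_has]
        refine ⟨fun h => ⟨⟨t, h, fun _ _ => rfl⟩, t, h, fun _ _ => rfl⟩, ?_⟩
        rintro ⟨⟨s, hs, hst⟩, r, hr, hrt⟩
        refine (R.has_congr fun a ha => ?_).1 (hsp s hs r hr)
        by_cases haQ : a ∈ Q.sch
        · rw [mix_of_mem (by exact haQ)]; exact hst a haQ
        · rw [mix_of_notMem (by exact haQ)]; exact hrt a (Finset.mem_sdiff.2 ⟨ha, haQ⟩)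
    · have : Q.sch = R.sch := Finset.Subset.antisymm hsub
        (Finset.sdiff_eq_empty_iff_subset.1 (Finset.not_nonempty_iff_eq_empty.1 he))
      exact Or.inl (hQ.trans (proj_of_eq _ _ this))

open scoped Classical in
/-- The attributes of `R` that cannot be separated from `a`. -/
noncomputable def cls (R : Reln A D) (a : A) : Finset A := R.sch.filter (Insep R.cyl a)

theorem mem_cls {R : Reln A D} {a b : A} : b ∈ R.cls a ↔ b ∈ R.sch ∧ Insep R.cyl a b := by
  simp [cls]

theorem cls_subset (R : Reln A D) (a : A) : R.cls a ⊆ R.sch := fun _ h => (mem_cls.1 h).1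

theorem cls_nonempty {R : Reln A D} {a : A} (ha : a ∈ R.sch) : (R.cls a).Nonempty :=
  ⟨a, mem_cls.2 ⟨ha, Insep.refl _ a⟩⟩

theorem split_cls (R : Reln A D) (a : A) : Split R.cyl (R.cls a : Set A) :=
  split_class R.supportedOn_cyl a fun b hb => by
    rw [Finset.mem_coe, mem_cls]; exact and_iff_right hb

/-- Starting from an arbitrary tuple of `R`, the values of `t` are pasted in class by class. Each
class is a split, so the intermediate tuples remain in `R`. -/
theorem exists_glue (R : Reln A D) (hne : ∃ s, R.Has s) (t : A → D)
    (h : ∀ a ∈ R.sch, ∃ s, R.Has s ∧ ∀ b ∈ R.cls a, s b = t b) : R.Has t := by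
  classical
  have key : ∀ W : Finset A, W ⊆ R.sch → ∃ s, R.Has s ∧ ∀ a ∈ W, ∀ b ∈ R.cls a, s b = t b := by
    intro W
    induction W using Finset.induction_on with
    | empty => exact fun _ => ⟨hne.choose, hne.choose_spec, by simp⟩
    | insert c W _ ih =>
      intro hW
      obtain ⟨s, hs, hst⟩ := ih ((Finset.subset_insert _ _).trans hW)
      obtain ⟨r, hr, hrt⟩ := h c (hW (Finset.mem_insert_self _ _))
      refine ⟨mix (R.cls c) r s, R.split_cls c r hr s hs, fun a ha b hb => ?_⟩
      by_cases hbc : b ∈ R.cls c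
      · rw [mix_of_mem (by exact hbc)]; exact hrt b hbc
      · rw [mix_of_notMem (by exact hbc)]
        rcases Finset.mem_insert.1 ha with rfl | ha
        exacts [absurd hb hbc, hst a ha b hb]
  obtain ⟨s, hs, hst⟩ := key R.sch (Finset.Subset.refl _)
  exact (R.has_congr fun a ha => hst a ha a (mem_cls.2 ⟨ha, Insep.refl _ a⟩)).1 hs

/-- The projections to the classes of inseparable attributes. -/
def primeFactors (R : Reln A D) : Set (Reln A D) :=
  {F | ∃ a, ∃ ha : a ∈ R.sch, F = R.proj (R.cls a) (cls_nonempty ha) (R.cls_subset a)}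

theorem cls_eq {R : Reln A D} {a b : A} (h : Insep R.cyl a b) : R.cls a = R.cls b := by
  ext x
  simp only [mem_cls]
  exact and_congr_right fun _ => ⟨fun h' => h.symm.trans h', fun h' => h.trans h'⟩

/-- Mixing along `Y` is possible in the projection to `X`; the result lifts to a tuple of `R`, and
mixing along `X` corrects its values outside `X`. -/
theorem split_of_split_proj {R : Reln A D} {X : Finset A} (hX : X.Nonempty) (h : X ⊆ R.sch)
    (hs : Split R.cyl (X : Set A)) {Y : Set A} (hY : Split (R.proj X hX h).cyl Y) (hYX : Y ⊆ X) :
    Split R.cyl Y := by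
  intro s hs' t ht
  obtain ⟨r, hr, hrm⟩ := (R.proj_has X hX h _).1 (hY s ((R.proj_has X hX h _).2
    ⟨s, hs', fun _ _ => rfl⟩) t ((R.proj_has X hX h _).2 ⟨t, ht, fun _ _ => rfl⟩))
  have := hs r hr t ht
  convert this using 1
  funext a
  by_cases ha : a ∈ X
  · rw [mix_of_mem (X := (X : Set A)) ha, hrm a ha]
  · rw [mix_of_notMem (fun h => ha (hYX h)), mix_of_notMem (by exact ha)]

/-- A proper factor would yield a split of `R` that cuts through a class. -/
theorem isPrime_proj_cls {R : Reln A D} (hne : ∃ s, R.Has s) {a : A} (ha : a ∈ R.sch) :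
    (R.proj (R.cls a) (cls_nonempty ha) (R.cls_subset a)).IsPrime := by
  intro P hP
  set F := R.proj (R.cls a) (cls_nonempty ha) (R.cls_subset a) with hF
  have hFne : ∃ s, F.Has s := hne.imp fun s hs => (R.proj_has _ _ _ _).2 ⟨s, hs, fun _ _ => rfl⟩
  obtain ⟨hsp, hsub, hPF⟩ := (isFactor_iff hFne).1 hP
  have hR := split_of_split_proj (cls_nonempty ha) (R.cls_subset a) (R.split_cls a) hsp hsub
  obtain ⟨b, hb⟩ := P.sch_nonempty
  have heq : P.sch = F.sch := by
    refine Finset.Subset.antisymm hsub fun c hc => ?_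
    have hbc : Insep R.cyl b c := (mem_cls.1 (hsub hb)).2.symm.trans (mem_cls.1 hc).2
    exact (hbc _ hR).1 hb
  exact hPF.trans (proj_of_eq _ _ heq)

/-- A prime factor with `a` in its schema is determined by `a`. Its schema is a split, so it
contains the class of `a`. Conversely, every split of `R` containing `a` cuts out a factor of this
factor, which by primality is everything, so no attribute of the schema is separable from `a`. -/
theorem isPrimeFactorization_iff {R : Reln A D} (hne : ∃ s, R.Has s) (Fs : Set (Reln A D)) :
    R.IsPrimeFactorization Fs ↔ Fs = R.primeFactors := by
  classical
  constructor
  · rintro ⟨⟨hfac, hdisj, hcov, -⟩, hprime⟩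
    have key : ∀ F ∈ Fs, ∀ a (ha : a ∈ R.sch), a ∈ F.sch →
        F = R.proj (R.cls a) (cls_nonempty ha) (R.cls_subset a) := by
      intro F hF a haR ha
      obtain ⟨hsp, hsub, hFR⟩ := (isFactor_iff hne).1 (hfac F hF)
      have hFne : ∃ s, F.Has s := hne.imp fun s hs => by
        rw [has_of_eq_proj hFR]; exact ⟨s, hs, fun _ _ => rfl⟩
      have heq : F.sch = R.cls a := by
        ext b
        refine ⟨fun hb => mem_cls.2 ⟨hsub hb, insep_of_forall fun X hX haX => ?_⟩, fun hb =>
          ((mem_cls.1 hb).2 _ hsp).1 ha⟩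
        have hfX : ((F.sch.filter (· ∈ X) : Finset A) : Set A) = ↑F.sch ∩ X := by
          ext; simp
        have hsX : Split F.cyl ((F.sch.filter (· ∈ X) : Finset A) : Set A) := by
          rw [hfX]
          intro s hs t ht
          have hs' : F.Has s := hs
          have ht' : F.Has t := ht
          rw [has_of_eq_proj hFR] at hs' ht'
          obtain ⟨s', hs', hss⟩ := hs'
          obtain ⟨t', ht', htt⟩ := ht'
          change F.Has _
          rw [has_of_eq_proj hFR]
          refine ⟨mix X s' t', hX s' hs' t' ht', fun c hc => ?_⟩
          by_cases hcX : c ∈ X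
          · rw [mix_of_mem hcX, mix_of_mem (show c ∈ (↑F.sch ∩ X : Set A) from ⟨hc, hcX⟩),
              hss c hc]
          · rw [mix_of_notMem hcX,
              mix_of_notMem (fun h : c ∈ (↑F.sch ∩ X : Set A) => hcX h.2), htt c hc]
        have hne' : (F.sch.filter (· ∈ X)).Nonempty := ⟨a, by simp [ha, haX]⟩
        have hp := hprime F hF (F.proj _ hne' (Finset.filter_subset _ _))
          ((isFactor_iff hFne).2 ⟨hsX, Finset.filter_subset _ _, rfl⟩)
        have : b ∈ F.sch.filter (· ∈ X) := by
          change b ∈ (F.proj _ hne' (Finset.filter_subset _ _)).sch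
          rw [hp]; exact hb
        exact (Finset.mem_filter.1 this).2
      refine hFR.trans ?_
      congr 1
    ext F
    constructor
    · intro hF
      obtain ⟨a, ha⟩ := F.sch_nonempty
      have haR := (hcov a).2 ⟨F, hF, ha⟩
      exact ⟨a, haR, key F hF a haR ha⟩
    · rintro ⟨a, ha, rfl⟩
      obtain ⟨F, hF, haF⟩ := (hcov a).1 ha
      exact key F hF a ha haF ▸ hF
  · rintro rfl
    refine ⟨⟨?_, ?_, fun a => ⟨fun ha => ?_, ?_⟩, fun t => ⟨?_, fun h => ?_⟩⟩, ?_⟩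
    · rintro F ⟨a, ha, rfl⟩
      exact (isFactor_iff hne).2 ⟨R.split_cls a, R.cls_subset a, rfl⟩
    · rintro F ⟨a, ha, rfl⟩ G ⟨b, hb, rfl⟩ hFG
      refine Finset.disjoint_left.2 fun c (hc : c ∈ R.cls a) (hc' : c ∈ R.cls b) => hFG ?_
      congr 1
      exact cls_eq ((mem_cls.1 hc).2.trans (mem_cls.1 hc').2.symm)
    · exact ⟨_, ⟨a, ha, rfl⟩, mem_cls.2 ⟨ha, Insep.refl _ a⟩⟩
    · rintro ⟨_, ⟨b, hb, rfl⟩, ha⟩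
      exact R.cls_subset b ha
    · rintro ht F ⟨a, ha, rfl⟩
      exact (R.proj_has _ _ _ _).2 ⟨t, ht, fun _ _ => rfl⟩
    · exact R.exists_glue hne t fun a ha => (R.proj_has _ _ _ _).1 (h _ ⟨a, ha, rfl⟩)
    · rintro F ⟨a, ha, rfl⟩
      exact isPrime_proj_cls hne ha

end Reln

end PrimeFact

namespace PrimeFact

/-! ## A structured view of the machine -/

/-- Names of the arrays and registers; a register is an array with one used entry. -/
inductive Nm where
  | lab | buf | stk | nn | c | f | kk | cur | ch | chh | hi | e | sz | b | cl | g | p | q | ok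
  | lv | t | a | v | w
  deriving DecidableEq

/-- The residue modulo 64 of the addresses of an array. -/
def Nm.code : Nm → ℕ
  | lab => 0 | buf => 1 | stk => 2 | nn => 3 | c => 4 | f => 5 | kk => 6 | cur => 7 | ch => 8
  | chh => 9 | hi => 10 | e => 11 | sz => 12 | b => 13 | cl => 14 | g => 15 | p => 16 | q => 17
  | ok => 18 | lv => 19 | t => 20 | a => 21 | v => 22 | w => 23

/-- The residues 60 to 63 remain free for the implementations of row access. -/
theorem Nm.code_lt (x : Nm) : x.code < 60 := by cases x <;> simp [code]

theorem Nm.code_injective : Function.Injective Nm.code := by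
  intro x y h
  cases x <;> cases y <;> first | rfl | simp [code] at h

/-- Arrays are interleaved with period 64, so they never overlap, whatever their lengths. -/
theorem Nm.addr_eq_iff {x y : Nm} {i j : ℕ} :
    64 * i + x.code = 64 * j + y.code ↔ x = y ∧ i = j := by
  have := x.code_lt
  have := y.code_lt
  refine ⟨fun h => ⟨Nm.code_injective (by omega), by omega⟩, ?_⟩
  rintro ⟨rfl, rfl⟩
  rfl

/-- Word expressions over the named arrays. -/
inductive Ex where
  | lit (k : ℕ) : Ex
  | arity : Ex
  | size : Ex
  | get (x : Nm) (i : Ex) : Ex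
  | add (a b : Ex) : Ex
  | sub (a b : Ex) : Ex
  | mod (a b : Ex) : Ex

instance : Add Ex := ⟨Ex.add⟩
instance : Sub Ex := ⟨Ex.sub⟩
instance : Mod Ex := ⟨Ex.mod⟩
instance (k : ℕ) : OfNat Ex k := ⟨Ex.lit k⟩

/-- The content of a register. -/
abbrev Ex.reg (x : Nm) : Ex := .get x 0

instance : Coe Nm Ex := ⟨Ex.reg⟩

/-- Conditions. -/
inductive Cd where
  | lt (a b : Ex) : Cd
  | eq (a b : Ex) : Cd
  | vlt (p c q d : Ex) : Cd
  | and (a b : Cd) : Cd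
  | not (a : Cd) : Cd

/-- The state of the structured machine: the arrays, the rows by position, and the output. -/
structure St (A : Type u) (D : Type v) (m n : ℕ) where
  M : Nm → ℕ → ℕ
  g : ℕ → ℕ → D
  out : List (Token A D)

variable {A : Type u} {D : Type v} {m n : ℕ}

namespace St

/-- Assignment to an array entry. -/
def set (σ : St A D m n) (x : Nm) (i k : ℕ) : St A D m n :=
  { σ with M := Function.update σ.M x (Function.update (σ.M x) i k) }

/-- Exchange of two rows. -/
def swap (σ : St A D m n) (p q : ℕ) : St A D m n := { σ with g := σ.g ∘ Equiv.swap p q }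

/-- Output. -/
def emit (σ : St A D m n) (l : List (Token A D)) : St A D m n := { σ with out := σ.out ++ l }

variable (σ : St A D m n) (x y : Nm) (i j k p q : ℕ) (l : List (Token A D))

@[simp] theorem set_M_same : (σ.set x i k).M x j = if j = i then k else σ.M x j := by
  simp [set, Function.update_apply]

@[simp] theorem set_M_ne (h : y ≠ x) : (σ.set x i k).M y = σ.M y := by simp [set, h]

@[simp] theorem set_g : (σ.set x i k).g = σ.g := rfl
@[simp] theorem set_out : (σ.set x i k).out = σ.out := rfl
@[simp] theorem swap_M : (σ.swap p q).M = σ.M := rfl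
@[simp] theorem swap_g : (σ.swap p q).g = σ.g ∘ Equiv.swap p q := rfl
@[simp] theorem swap_out : (σ.swap p q).out = σ.out := rfl
@[simp] theorem emit_M : (σ.emit l).M = σ.M := rfl
@[simp] theorem emit_g : (σ.emit l).g = σ.g := rfl
@[simp] theorem emit_out : (σ.emit l).out = σ.out ++ l := rfl

/-- The two states differ at most in the arrays `ks`. -/
def Fr (ks : List Nm) (σ τ : St A D m n) : Prop := ∀ x, x ∉ ks → τ.M x = σ.M x

theorem Fr.refl (ks : List Nm) (σ : St A D m n) : Fr ks σ σ := fun _ _ => rfl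

theorem Fr.trans {ks : List Nm} {σ τ ρ : St A D m n} (h : Fr ks σ τ) (h' : Fr ks τ ρ) :
    Fr ks σ ρ := fun x hx => (h' x hx).trans (h x hx)

theorem Fr.mono {ks ls : List Nm} {σ τ : St A D m n} (h : Fr ks σ τ) (hs : ks ⊆ ls) :
    Fr ls σ τ := fun x hx => h x fun hk => hx (hs hk)

theorem Fr.set {ks : List Nm} {σ τ : St A D m n} (h : Fr ks σ τ) {x : Nm} (hx : x ∈ ks)
    (i k : ℕ) : Fr ks σ (τ.set x i k) := fun y hy => by
  rw [set_M_ne _ _ _ _ _ (fun h => hy (by rw [h]; exact hx))]; exact h y hy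

end St

namespace Ex

/-- The value of an expression. -/
def val (σ : St A D m n) : Ex → ℕ
  | lit k => k
  | arity => m
  | size => n
  | get x i => σ.M x (i.val σ)
  | add a b => a.val σ + b.val σ
  | sub a b => a.val σ - b.val σ
  | mod a b => a.val σ % b.val σ

/-- Bounds that make the evaluation of the expression safe. -/
def Ok (σ : St A D m n) : Ex → Prop
  | lit k => k ≤ 1000
  | arity => True
  | size => True
  | get _ i => i.Ok σ ∧ i.val σ ≤ m
  | add a b => a.Ok σ ∧ b.Ok σ ∧ a.val σ + b.val σ ≤ 100 * (m + n + 1)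
  | sub a b => a.Ok σ ∧ b.Ok σ
  | mod a b => a.Ok σ ∧ b.Ok σ

variable (σ : St A D m n) (a b i : Ex) (x : Nm) (k : ℕ)

@[simp] theorem val_lit : (lit k).val σ = k := rfl
@[simp] theorem val_ofNat : (ofNat(k) : Ex).val σ = OfNat.ofNat k := rfl
@[simp] theorem val_arity : arity.val σ = m := rfl
@[simp] theorem val_size : size.val σ = n := rfl
@[simp] theorem val_get : (get x i).val σ = σ.M x (i.val σ) := rfl
@[simp] theorem val_add : (a + b).val σ = a.val σ + b.val σ := rfl
@[simp] theorem val_sub : (a - b).val σ = a.val σ - b.val σ := rfl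
@[simp] theorem val_mod : (a % b).val σ = a.val σ % b.val σ := rfl
@[simp] theorem ok_lit : (lit k).Ok σ ↔ k ≤ 1000 := Iff.rfl
@[simp] theorem ok_ofNat : (ofNat(k) : Ex).Ok σ ↔ OfNat.ofNat k ≤ 1000 := Iff.rfl
@[simp] theorem ok_arity : arity.Ok σ := trivial
@[simp] theorem ok_size : size.Ok σ := trivial
@[simp] theorem ok_get : (get x i).Ok σ ↔ i.Ok σ ∧ i.val σ ≤ m := Iff.rfl
@[simp] theorem ok_add :
    (a + b).Ok σ ↔ a.Ok σ ∧ b.Ok σ ∧ a.val σ + b.val σ ≤ 100 * (m + n + 1) := Iff.rfl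
@[simp] theorem ok_sub : (a - b).Ok σ ↔ a.Ok σ ∧ b.Ok σ := Iff.rfl
@[simp] theorem ok_mod : (a % b).Ok σ ↔ a.Ok σ ∧ b.Ok σ := Iff.rfl

/-- The address of an array entry. -/
def addr (x : Nm) (i : Expr) : Expr := .add (.mul (.lit 64) i) (.lit x.code)

/-- The expression of the machine. -/
def comp : Ex → Expr
  | lit k => .lit k
  | arity => .arity
  | size => .size
  | get x i => .load (addr x i.comp)
  | add a b => .add a.comp b.comp
  | sub a b => .sub a.comp b.comp
  | mod a b => .mod a.comp b.comp

end Ex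

/-- The value in position `p` and column `c` equals that in position `q` and column `d`. -/
def Cd.veq (p c q d : Ex) : Cd := .and (.not (.vlt p c q d)) (.not (.vlt q d p c))

section

variable [LinearOrder D]

namespace Cd

/-- The truth of a condition. -/
def Holds (σ : St A D m n) : Cd → Prop
  | lt a b => a.val σ < b.val σ
  | eq a b => a.val σ = b.val σ
  | vlt p c q d => σ.g (p.val σ) (c.val σ) < σ.g (q.val σ) (d.val σ)
  | and a b => a.Holds σ ∧ b.Holds σ
  | not a => ¬ a.Holds σ

/-- Bounds that make the evaluation of the condition safe. -/
def Ok (σ : St A D m n) : Cd → Prop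
  | lt a b => a.Ok σ ∧ b.Ok σ
  | eq a b => a.Ok σ ∧ b.Ok σ
  | vlt p c q d => (p.Ok σ ∧ c.Ok σ ∧ q.Ok σ ∧ d.Ok σ) ∧
      p.val σ < n ∧ c.val σ < m ∧ q.val σ < n ∧ d.val σ < m
  | and a b => a.Ok σ ∧ b.Ok σ
  | not a => a.Ok σ

variable (σ : St A D m n) (a b : Ex) (x y : Cd) (p c q d : Ex)

@[simp] theorem holds_lt : (lt a b).Holds σ ↔ a.val σ < b.val σ := Iff.rfl
@[simp] theorem holds_eq : (eq a b).Holds σ ↔ a.val σ = b.val σ := Iff.rfl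
@[simp] theorem holds_vlt :
    (vlt p c q d).Holds σ ↔ σ.g (p.val σ) (c.val σ) < σ.g (q.val σ) (d.val σ) := Iff.rfl
@[simp] theorem holds_and : (x.and y).Holds σ ↔ x.Holds σ ∧ y.Holds σ := Iff.rfl
@[simp] theorem holds_not : x.not.Holds σ ↔ ¬ x.Holds σ := Iff.rfl
@[simp] theorem holds_veq :
    (veq p c q d).Holds σ ↔ σ.g (p.val σ) (c.val σ) = σ.g (q.val σ) (d.val σ) := by
  simp [veq, le_antisymm_iff, and_comm]
@[simp] theorem ok_lt : (lt a b).Ok σ ↔ a.Ok σ ∧ b.Ok σ := Iff.rfl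
@[simp] theorem ok_eq : (eq a b).Ok σ ↔ a.Ok σ ∧ b.Ok σ := Iff.rfl
@[simp] theorem ok_vlt : (vlt p c q d).Ok σ ↔ (p.Ok σ ∧ c.Ok σ ∧ q.Ok σ ∧ d.Ok σ) ∧
      p.val σ < n ∧ c.val σ < m ∧ q.val σ < n ∧ d.val σ < m := Iff.rfl
@[simp] theorem ok_and : (x.and y).Ok σ ↔ x.Ok σ ∧ y.Ok σ := Iff.rfl
@[simp] theorem ok_not : x.not.Ok σ ↔ x.Ok σ := Iff.rfl
@[simp] theorem ok_veq : (veq p c q d).Ok σ ↔ (p.Ok σ ∧ c.Ok σ ∧ q.Ok σ ∧ d.Ok σ) ∧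
      p.val σ < n ∧ c.val σ < m ∧ q.val σ < n ∧ d.val σ < m := by
  simp only [veq, ok_and, ok_not, ok_vlt]; tauto

/-- The expression of the machine, given the access to rows by position. -/
def comp (row : Expr → Expr) : Cd → Expr
  | lt a b => .lt a.comp b.comp
  | eq a b => .eq a.comp b.comp
  | vlt p c q d => .valLT (row p.comp) c.comp (row q.comp) d.comp
  | and a b => .mul (a.comp row) (b.comp row)
  | not a => .eq (a.comp row) (.lit 0)

end Cd

/-- The parts of programs that depend on how the rows are rearranged: access to a row by position,
exchange of two positions, and a comparison of two positions with the result in a given cell. -/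
structure Acc where
  row : Expr → Expr
  swp : Expr → Expr → Stmt
  tie : Expr → Expr → Expr → Stmt

/-- An implementation of the structured machine on the machine. -/
structure Layer (A : Type u) (D : Type v) [LinearOrder D] (m n : ℕ) (κ : Type w)
    [LinearOrder κ] where
  acc : Acc
  attr : Fin m → A
  lim : Limits
  tk : (ℕ → D) → κ
  ws : ℕ
  wt : ℕ
  Rel : State A D m n → St A D m n → Prop
  word_le : 1000 * (m + n + 1) ≤ lim.maxWord
  cells_le : 64 * (m + 1) ≤ lim.cells
  mem : ∀ {st : State A D m n} {σ : St A D m n}, Rel st σ →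
    ∀ (x : Nm) i, st.mem (64 * i + x.code) = σ.M x i
  row : ∀ {st : State A D m n} {σ : St A D m n} {e : Expr}, Rel st σ → e.Safe lim st →
    e.val st < n → (acc.row e).Safe lim st ∧
      ∃ r : Fin n, (acc.row e).val st = r ∧ ∀ c : Fin m, st.rows r c = σ.g (e.val st) c
  set : ∀ {st : State A D m n} {σ : St A D m n}, Rel st σ → ∀ (x : Nm) i k,
    Rel { st with mem := Function.update st.mem (64 * i + x.code) k } (σ.set x i k)
  emit : ∀ {st : State A D m n} {σ : St A D m n}, Rel st σ → ∀ l,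
    Rel { st with out := st.out ++ l } (σ.emit l)
  swp : ∀ {st : State A D m n} {σ : St A D m n}, Rel st σ → ∀ {p q : Ex}, p.Ok σ → q.Ok σ →
    p.val σ < n → q.val σ < n → ∃ t ≤ ws, ∃ st',
      Exec attr lim (acc.swp p.comp q.comp) st t st' ∧ Rel st' (σ.swap (p.val σ) (q.val σ))
  tie : ∀ {st : State A D m n} {σ : St A D m n}, Rel st σ → ∀ (x : Nm) {p q : Ex}, p.Ok σ →
    q.Ok σ → p.val σ < n → q.val σ < n → ∃ t ≤ wt, ∃ st',
      Exec attr lim (acc.tie (Ex.addr x (.lit 0)) p.comp q.comp) st t st' ∧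
      Rel st' (σ.set x 0 (if tk (σ.g (p.val σ)) < tk (σ.g (q.val σ)) then 1 else 0))

/-! ### Soundness of the translation of expressions and conditions -/

section CompSound

theorem Ex.comp_val {st : State A D m n} {σ : St A D m n}
    (hm : ∀ (x : Nm) i, st.mem (64 * i + x.code) = σ.M x i) (e : Ex) :
    e.comp.val st = e.val σ := by
  induction e with
  | lit k => rfl
  | arity => rfl
  | size => rfl
  | get x i ih => simp [Ex.comp, Ex.addr, Expr.val, ih, hm, Ex.val]
  | add a b iha ihb => simp [Ex.comp, Expr.val, iha, ihb, Ex.val]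
  | sub a b iha ihb => simp [Ex.comp, Expr.val, iha, ihb, Ex.val]
  | mod a b iha ihb => simp [Ex.comp, Expr.val, iha, ihb, Ex.val]

theorem Ex.comp_safe {L : Limits} {st : State A D m n} {σ : St A D m n}
    (hw : 1000 * (m + n + 1) ≤ L.maxWord) (hc : 64 * (m + 1) ≤ L.cells)
    (hm : ∀ (x : Nm) i, st.mem (64 * i + x.code) = σ.M x i) {e : Ex} (he : e.Ok σ) :
    e.comp.Safe L st := by
  induction e with
  | lit k => simp [Ex.Ok] at he; simp [Ex.comp, Expr.Safe]; omega
  | arity => simp [Ex.comp, Expr.Safe]; omega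
  | size => simp [Ex.comp, Expr.Safe]; omega
  | get x i ih =>
    have h2 := ih he.1
    have h3 : i.val σ ≤ m := he.2
    have h5 := x.code_lt
    simp only [Ex.comp, Ex.addr, Expr.Safe, Expr.val, i.comp_val hm, h2]
    refine ⟨⟨⟨by omega, trivial, by omega⟩, by omega, by omega⟩, by omega⟩
  | add a b iha ihb =>
    have h5 : a.val σ + b.val σ ≤ 100 * (m + n + 1) := he.2.2
    exact ⟨iha he.1, ihb he.2.1, by rw [a.comp_val hm, b.comp_val hm]; omega⟩
  | sub a b iha ihb => exact ⟨iha he.1, ihb he.2⟩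
  | mod a b iha ihb => exact ⟨iha he.1, ihb he.2⟩

variable {κ : Type w} [LinearOrder κ] (ly : Layer A D m n κ)
  {st : State A D m n} {σ : St A D m n}

theorem comp_sound (h : ly.Rel st σ) {e : Ex} (he : e.Ok σ) :
    e.comp.val st = e.val σ ∧ e.comp.Safe ly.lim st :=
  ⟨e.comp_val (ly.mem h), e.comp_safe ly.word_le ly.cells_le (ly.mem h) he⟩

open scoped Classical in
theorem comp_sound_cd (h : ly.Rel st σ) {c : Cd} (hc : c.Ok σ) :
    (c.comp ly.acc.row).val st = (if c.Holds σ then 1 else 0) ∧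
      (c.comp ly.acc.row).Safe ly.lim st := by
  have hw := ly.word_le
  induction c with
  | lt a b =>
    obtain ⟨h1, h2⟩ := comp_sound ly h hc.1
    obtain ⟨h3, h4⟩ := comp_sound ly h hc.2
    exact ⟨by simp [Cd.comp, Expr.val, h1, h3], h2, h4⟩
  | eq a b =>
    obtain ⟨h1, h2⟩ := comp_sound ly h hc.1
    obtain ⟨h3, h4⟩ := comp_sound ly h hc.2
    exact ⟨by simp [Cd.comp, Expr.val, h1, h3], h2, h4⟩
  | vlt p c q d =>
    obtain ⟨⟨kp, kc, kq, kd⟩, lp, lc, lq, ld⟩ := hc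
    obtain ⟨p1, p2⟩ := comp_sound ly h kp
    obtain ⟨c1, c2⟩ := comp_sound ly h kc
    obtain ⟨q1, q2⟩ := comp_sound ly h kq
    obtain ⟨d1, d2⟩ := comp_sound ly h kd
    obtain ⟨hp, r, hr, hr'⟩ := ly.row h p2 (p1 ▸ lp)
    obtain ⟨hq, s, hs, hs'⟩ := ly.row h q2 (q1 ▸ lq)
    rw [p1] at hr'
    rw [q1] at hs'
    refine ⟨?_, hp, c2, hq, d2, by omega, by omega, by omega, by omega⟩
    have e1 := hr' ⟨_, lc⟩
    have e2 := hs' ⟨_, ld⟩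
    simp only [Cd.comp, Expr.val, hr, hs, c1, d1, Fin.eta, Fin.is_lt, lc, ld, exists_true_left, e1,
      e2, Cd.holds_vlt]
  | and a b iha ihb =>
    obtain ⟨h1, h2⟩ := iha hc.1
    obtain ⟨h3, h4⟩ := ihb hc.2
    refine ⟨?_, h2, h4, ?_⟩
    · simp only [Cd.comp, Expr.val, h1, h3, Cd.holds_and]
      by_cases ha : a.Holds σ <;> by_cases hb : b.Holds σ <;> simp [ha, hb]
    · rw [h1, h3]; split_ifs <;> omega
  | not a iha =>
    obtain ⟨h1, h2⟩ := iha hc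
    refine ⟨?_, h2, Nat.zero_le _⟩
    simp only [Cd.comp, Expr.val, h1, Cd.holds_not]
    by_cases ha : a.Holds σ <;> simp [ha]

end CompSound

/-! ## Programs and the rules to reason about them -/

/-- Assignment to an array entry. -/
def put (x : Nm) (i e : Ex) : Stmt := .store (Ex.addr x i.comp) e.comp

/-- Assignment to a register. -/
abbrev putr (x : Nm) (e : Ex) : Stmt := put x 0 e

infixr:60 " ;; " => Stmt.seq

namespace Acc

variable (acc : Acc)

/-- Conditional. -/
def ite (c : Cd) (s₁ s₂ : Stmt) : Stmt := .ite (c.comp acc.row) s₁ s₂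

/-- Loop. -/
def loopW (c : Cd) (s : Stmt) : Stmt := .loop (c.comp acc.row) s

/-- Loop with the register `x` running from `lo` to `hi - 1`. -/
def forR (x : Nm) (lo hi : Ex) (s : Stmt) : Stmt :=
  putr x lo ;; acc.loopW (.lt x hi) (s ;; putr x (x + 1))

/-- Exchange of two positions. -/
def exch (p q : Ex) : Stmt := acc.swp p.comp q.comp

/-- Comparison of two positions by the tie-break key. -/
def cmpTie (x : Nm) (p q : Ex) : Stmt := acc.tie (Ex.addr x (.lit 0)) p.comp q.comp

/-- Output of a value. -/
def outVal (p c : Ex) : Stmt := .outValue (acc.row p.comp) c.comp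

end Acc

/-- From `σ` the program terminates within `T` steps in a state satisfying `Q`. -/
def Runs {κ : Type w} [LinearOrder κ] (ly : Layer A D m n κ) (s : Stmt) (σ : St A D m n) (T : ℕ)
    (Q : St A D m n → Prop) : Prop :=
  ∀ st, ly.Rel st σ → ∃ t ≤ T, ∃ st' σ', Exec ly.attr ly.lim s st t st' ∧ ly.Rel st' σ' ∧ Q σ'

namespace Runs

variable {κ : Type w} [LinearOrder κ] {ly : Layer A D m n κ} {σ : St A D m n}
  {T T₁ T₂ : ℕ} {Q Q₁ : St A D m n → Prop} {s s₁ s₂ : Stmt} {c : Cd} {p q i e : Ex} {x : Nm}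

theorem mono (h : Runs ly s σ T₁ Q₁) (hQ : ∀ σ', Q₁ σ' → Q σ') (hT : T₁ ≤ T) :
    Runs ly s σ T Q := fun st hst => by
  obtain ⟨t, ht, st', σ', h1, h2, h3⟩ := h st hst
  exact ⟨t, ht.trans hT, st', σ', h1, h2, hQ _ h3⟩

theorem skip (h : Q σ) (hT : 1 ≤ T) : Runs ly .skip σ T Q := fun st hst =>
  ⟨1, hT, st, σ, .skip st, hst, h⟩

theorem put (hi : i.Ok σ) (him : i.val σ ≤ m) (he : e.Ok σ)
    (h : Q (σ.set x (i.val σ) (e.val σ))) (hT : 1 ≤ T) : Runs ly (put x i e) σ T Q := by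
  intro st hst
  obtain ⟨h1, h2⟩ := comp_sound ly hst hi
  obtain ⟨h3, h4⟩ := comp_sound ly hst he
  have hw := ly.word_le
  have hc := ly.cells_le
  have hx := x.code_lt
  have hs := ly.set hst x (i.val σ) (e.val σ)
  have hv : (Ex.addr x i.comp).val st = 64 * i.val σ + x.code := by simp [Ex.addr, Expr.val, h1]
  rw [← hv, ← h3] at hs
  refine ⟨1, hT, _, _, .store st _ _ ?_ (by rw [hv]; omega) h4, hs, h3 ▸ h⟩
  simp only [Ex.addr, Expr.Safe, Expr.val, h1, h2]
  exact ⟨⟨by omega, trivial, by omega⟩, by omega, by omega⟩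

theorem seq (h : Runs ly s₁ σ T₁ fun σ' => Runs ly s₂ σ' T₂ Q) (hT : T₁ + T₂ ≤ T) :
    Runs ly (s₁ ;; s₂) σ T Q := by
  intro st hst
  obtain ⟨t, ht, st', σ', h1, h2, h3⟩ := h st hst
  obtain ⟨t', ht', st'', σ'', h1', h2', h3'⟩ := h3 st' h2
  exact ⟨t + t', by omega, st'', σ'', .seq _ _ _ _ _ _ _ h1 h1', h2', h3'⟩

theorem ite (hc : c.Ok σ) (h₁ : c.Holds σ → Runs ly s₁ σ T₁ Q)
    (h₂ : ¬ c.Holds σ → Runs ly s₂ σ T₁ Q) (hT : T₁ + 1 ≤ T) :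
    Runs ly (ly.acc.ite c s₁ s₂) σ T Q := by
  intro st hst
  obtain ⟨h1, h2⟩ := comp_sound_cd ly hst hc
  by_cases h : c.Holds σ
  · obtain ⟨t, ht, st', σ', k1, k2, k3⟩ := h₁ h st hst
    exact ⟨t + 1, by omega, st', σ', .iteTrue _ _ _ _ _ _ h2 (by simp [h1, h]) k1, k2, k3⟩
  · obtain ⟨t, ht, st', σ', k1, k2, k3⟩ := h₂ h st hst
    exact ⟨t + 1, by omega, st', σ', .iteFalse _ _ _ _ _ _ h2 (by simp [h1, h]) k1, k2, k3⟩

/-- The index of the invariant counts down: `I k` allows at most `k` further rounds, and `B k`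
bounds the round that leads from `I (k + 1)` to `I k`. The loop may end early. -/
theorem loopW (I : ℕ → St A D m n → Prop) (B : ℕ → ℕ) (hok : ∀ k σ, I k σ → c.Ok σ)
    (h₀ : ∀ σ, I 0 σ → ¬ c.Holds σ)
    (hs : ∀ k σ, I (k + 1) σ → c.Holds σ → Runs ly s σ (B k) (I k)) (k : ℕ) (h : I k σ)
    (hQ : ∀ k σ, I k σ → ¬ c.Holds σ → Q σ) (hT : ∑ i ∈ Finset.range k, (B i + 1) + 1 ≤ T) :
    Runs ly (ly.acc.loopW c s) σ T Q := by
  induction k generalizing σ T with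
  | zero =>
    intro st hst
    obtain ⟨h1, h2⟩ := comp_sound_cd ly hst (hok _ _ h)
    exact ⟨1, by omega, st, σ, .loopDone _ _ _ h2 (by simp [h1, h₀ _ h]), hst, hQ _ _ h (h₀ _ h)⟩
  | succ k ih =>
    intro st hst
    obtain ⟨h1, h2⟩ := comp_sound_cd ly hst (hok _ _ h)
    rw [Finset.sum_range_succ] at hT
    by_cases hc : c.Holds σ
    · obtain ⟨t, ht, st', σ', k1, k2, k3⟩ := hs k σ h hc st hst
      obtain ⟨t', ht', st'', σ'', l1, l2, l3⟩ := ih k3 le_rfl st' k2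
      exact ⟨t + t' + 1, by omega, st'', σ'',
        .loopStep _ _ _ _ _ _ _ h2 (by simp [h1, hc]) k1 l1, l2, l3⟩
    · exact ⟨1, by omega, st, σ, .loopDone _ _ _ h2 (by simp [h1, hc]), hst, hQ _ _ h hc⟩

/-- An upward loop is `loopW` with the counter `N - k`, so the costs are summed in reverse. The
upper limit is evaluated anew in each round, and its value must be part of the invariant. -/
theorem forR {lo hi : Ex} (a N : ℕ) (I : ℕ → St A D m n → Prop) (B : ℕ → ℕ) (hlo : lo.Ok σ)
    (ha : lo.val σ = a) (haN : a ≤ N) (hN : N ≤ m + n) (h : I a (σ.set x 0 a))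
    (hhi : ∀ i σ, I i σ → σ.M x 0 = i → hi.Ok σ ∧ hi.val σ = N)
    (hs : ∀ i σ, a ≤ i → i < N → I i σ → σ.M x 0 = i →
      Runs ly s σ (B i) fun σ' => σ'.M x 0 = i ∧ I (i + 1) (σ'.set x 0 (i + 1)))
    (hQ : ∀ σ, I N σ → σ.M x 0 = N → Q σ) (hT : ∑ i ∈ Finset.Ico a N, (B i + 2) + 2 ≤ T) :
    Runs ly (ly.acc.forR x lo hi s) σ T Q := by
  refine seq (T₁ := 1) (T₂ := T - 1) ?_ (by omega)
  refine put (by simp) (by simp) hlo ?_ le_rfl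
  rw [ha]
  simp only [Ex.val_ofNat]
  refine loopW (fun k σ => k ≤ N - a ∧ σ.M x 0 = N - k ∧ I (N - k) σ) (fun k => B (N - 1 - k) + 1)
    ?_ ?_ ?_ (N - a) ⟨le_rfl, ?_, ?_⟩ ?_ ?_
  · rintro k σ ⟨-, h1, h2⟩
    obtain ⟨h3, h4⟩ := hhi _ σ h2 h1
    simp [h3]
  · rintro σ ⟨-, h1, h2⟩
    obtain ⟨h3, h4⟩ := hhi _ σ h2 h1
    simp [h4, h1]
  · rintro k σ ⟨hk, h1, h2⟩ hc
    refine seq (hs (N - (k + 1)) σ (by omega) (by omega) h2 h1 |>.mono (fun σ' h => ?_) le_rfl)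
      (T₂ := 1) (by rw [show N - (k + 1) = N - 1 - k by omega])
    obtain ⟨h5, h6⟩ := h
    refine put (by simp) (by simp) (by simp [h5]; omega) ?_ le_rfl
    simp only [Ex.val_ofNat, Ex.val_add, Ex.val_get, h5]
    rw [show N - (k + 1) + 1 = N - k by omega] at *
    exact ⟨by omega, by simp, h6⟩
  · simp; omega
  · rwa [show N - (N - a) = a by omega]
  · rintro k σ ⟨hk, h1, h2⟩ hc
    obtain ⟨h3, h4⟩ := hhi _ σ h2 h1
    simp only [Cd.holds_lt, h4, Ex.val_get, Ex.val_ofNat, h1] at hc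
    have : N - k = N := by omega
    rw [this] at h1 h2
    exact hQ σ h2 h1
  · have : ∑ i ∈ Finset.range (N - a), (B (N - 1 - i) + 1 + 1) =
        ∑ i ∈ Finset.Ico a N, (B i + 2) := by
      rw [Finset.sum_Ico_eq_sum_range, ← Finset.sum_range_reflect]
      refine Finset.sum_congr rfl fun i hi => ?_
      have := Finset.mem_range.1 hi
      rw [show N - 1 - (N - a - 1 - i) = a + i by omega]
    omega

theorem exch (hp : p.Ok σ) (hq : q.Ok σ) (hpn : p.val σ < n) (hqn : q.val σ < n)
    (h : Q (σ.swap (p.val σ) (q.val σ))) (hT : ly.ws ≤ T) : Runs ly (ly.acc.exch p q) σ T Q := by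
  intro st hst
  obtain ⟨t, ht, st', h1, h2⟩ := ly.swp hst hp hq hpn hqn
  exact ⟨t, ht.trans hT, st', _, h1, h2, h⟩

theorem cmpTie (hp : p.Ok σ) (hq : q.Ok σ) (hpn : p.val σ < n) (hqn : q.val σ < n)
    (h : Q (σ.set x 0 (if ly.tk (σ.g (p.val σ)) < ly.tk (σ.g (q.val σ)) then 1 else 0)))
    (hT : ly.wt ≤ T) : Runs ly (ly.acc.cmpTie x p q) σ T Q := by
  intro st hst
  obtain ⟨t, ht, st', h1, h2⟩ := ly.tie hst x hp hq hpn hqn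
  exact ⟨t, ht.trans hT, st', _, h1, h2, h⟩

theorem outTable (h : Q (σ.emit [.table])) (hT : 1 ≤ T) : Runs ly .outTable σ T Q :=
  fun st hst => ⟨1, hT, _, _, .outTable st, ly.emit hst _, h⟩

theorem outRow (h : Q (σ.emit [.row])) (hT : 1 ≤ T) : Runs ly .outRow σ T Q :=
  fun st hst => ⟨1, hT, _, _, .outRow st, ly.emit hst _, h⟩

theorem outAttr (he : e.Ok σ) (hm : e.val σ < m)
    (h : Q (σ.emit [.attr (ly.attr ⟨e.val σ, hm⟩)])) (hT : 1 ≤ T) :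
    Runs ly (.outAttr e.comp) σ T Q := by
  intro st hst
  obtain ⟨h1, h2⟩ := comp_sound ly hst he
  exact ⟨1, hT, _, _, .outAttr st _ ⟨e.val σ, hm⟩ h2 h1, ly.emit hst _, h⟩

theorem outVal (hp : p.Ok σ) (he : e.Ok σ) (hn : p.val σ < n) (hm : e.val σ < m)
    (h : Q (σ.emit [.value (σ.g (p.val σ) (e.val σ))])) (hT : 1 ≤ T) :
    Runs ly (ly.acc.outVal p e) σ T Q := by
  intro st hst
  obtain ⟨p1, p2⟩ := comp_sound ly hst hp
  obtain ⟨e1, e2⟩ := comp_sound ly hst he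
  obtain ⟨h3, r, hr, hr'⟩ := ly.row hst p2 (p1 ▸ hn)
  have hk := hr' ⟨_, hm⟩
  rw [p1] at hk
  refine ⟨1, hT, _, _, .outValue st _ _ r ⟨e.val σ, hm⟩ h3 e2 hr e1, ly.emit hst _, ?_⟩
  rw [hk]
  exact h

end Runs

end

end PrimeFact

namespace PrimeFact

/-! ## Heaps -/

section Heap

variable {κ : Type*} [LinearOrder κ] {α : Type*}

/-- No entry of `h` below `hi` exceeds its parent, if the parent is at least `lo`. -/
def HeapOn (h : ℕ → κ) (lo hi : ℕ) : Prop :=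
  ∀ c, 0 < c → c < hi → lo ≤ (c - 1) / 2 → h c ≤ h ((c - 1) / 2)

/-- The heap condition with an exception at the children of `i`, which do not exceed the parent
of `i`. -/
def HeapExcept (h : ℕ → κ) (lo hi i : ℕ) : Prop :=
  (∀ c, 0 < c → c < hi → lo ≤ (c - 1) / 2 → (c - 1) / 2 ≠ i → h c ≤ h ((c - 1) / 2)) ∧
    ∀ c, 0 < c → c < hi → (c - 1) / 2 = i → 0 < i → lo ≤ (i - 1) / 2 → h c ≤ h ((i - 1) / 2)

theorem HeapExcept.heapOn {h : ℕ → κ} {lo hi i : ℕ} (H : HeapExcept h lo hi i)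
    (hc : ∀ c, 0 < c → c < hi → (c - 1) / 2 = i → h c ≤ h i) : HeapOn h lo hi := by
  intro c h0 h1 h2
  by_cases hi : (c - 1) / 2 = i
  · rw [hi]; exact hc c h0 h1 hi
  · exact H.1 c h0 h1 h2 hi

theorem HeapOn.heapExcept {h : ℕ → κ} {lo hi : ℕ} (H : HeapOn h (lo + 1) hi) :
    HeapExcept h lo hi lo :=
  ⟨fun c h0 h1 h2 h3 => H c h0 h1 (by omega), fun c _ _ _ _ _ => by omega⟩

/-- The larger child moves up to `i`, so only the children of `j` can still violate the order. They
were at most the old entry at `j`, which is now their grandparent; this is the second clause for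
`j`. -/
theorem HeapExcept.swap {h : ℕ → κ} {lo hi i j : ℕ} (H : HeapExcept h lo hi i) (hlo : lo ≤ i)
    (hj : j < hi) (hij : (j - 1) / 2 = i) (hj0 : 0 < j)
    (hmax : ∀ c, 0 < c → c < hi → (c - 1) / 2 = i → h c ≤ h j) (hlt : h i < h j) :
    HeapExcept (h ∘ Equiv.swap i j) lo hi j := by
  have hne : i ≠ j := by omega
  constructor
  · intro c h0 h1 h2 h3
    simp only [Function.comp]
    rw [Equiv.swap_apply_def, Equiv.swap_apply_def]
    by_cases c1 : c = i
    · subst c1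
      have : (c - 1) / 2 ≠ c := by omega
      simp only [if_true, this, if_false, h3]
      exact H.2 j hj0 hj hij h0 h2
    · by_cases c2 : c = j
      · subst c2
        simp only [c1, hij, if_true, if_false]
        exact hlt.le
      · simp only [c1, c2, if_false, h3]
        by_cases c3 : (c - 1) / 2 = i
        · simp only [c3, if_true]; exact hmax c h0 h1 c3
        · simp only [c3, if_false]; exact H.1 c h0 h1 h2 c3
  · intro c h0 h1 h2 h3 h4
    simp only [Function.comp]
    rw [hij, Equiv.swap_apply_left, Equiv.swap_apply_of_ne_of_ne (by omega) (by omega)]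
    rw [← h2]
    exact H.1 c h0 h1 (by omega) (by omega)

theorem HeapOn.le_root {h : ℕ → κ} {hi : ℕ} (H : HeapOn h 0 hi) (c : ℕ) (hc : c < hi) :
    h c ≤ h 0 := by
  induction c using Nat.strong_induction_on with
  | _ c ih =>
    by_cases h0 : c = 0
    · rw [h0]
    · exact (H c (by omega) hc (by omega)).trans (ih _ (by omega) (by omega))

/-- `g'` arises from `g` by a permutation of the positions below `N`. -/
def PermBelow (N : ℕ) (g g' : ℕ → α) : Prop :=
  ∃ π : Equiv.Perm ℕ, (∀ p, N ≤ p → π p = p) ∧ g' = g ∘ π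

theorem PermBelow.refl (N : ℕ) (g : ℕ → α) : PermBelow N g g := ⟨1, by simp, rfl⟩

theorem PermBelow.trans {N : ℕ} {g g' g'' : ℕ → α} (h : PermBelow N g g')
    (h' : PermBelow N g' g'') : PermBelow N g g'' := by
  obtain ⟨π, h1, rfl⟩ := h
  obtain ⟨ρ, h2, rfl⟩ := h'
  exact ⟨π * ρ, fun p hp => by simp [h2 p hp, h1 p hp], rfl⟩

theorem PermBelow.mono {N N' : ℕ} {g g' : ℕ → α} (h : PermBelow N g g') (hN : N ≤ N') :
    PermBelow N' g g' := by
  obtain ⟨π, h1, rfl⟩ := h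
  exact ⟨π, fun p hp => h1 p (hN.trans hp), rfl⟩

theorem PermBelow.swap {N i j : ℕ} (g : ℕ → α) (hi : i < N) (hj : j < N) :
    PermBelow N g (g ∘ Equiv.swap i j) :=
  ⟨Equiv.swap i j, fun p hp => Equiv.swap_apply_of_ne_of_ne (by omega) (by omega), rfl⟩

theorem PermBelow.eq_of_le {N p : ℕ} {g g' : ℕ → α} (h : PermBelow N g g') (hp : N ≤ p) :
    g' p = g p := by
  obtain ⟨π, h1, rfl⟩ := h
  simp [h1 p hp]

theorem PermBelow.exists_eq {N p : ℕ} {g g' : ℕ → α} (h : PermBelow N g g') (hp : p < N) :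
    ∃ q < N, g' p = g q := by
  obtain ⟨π, h1, rfl⟩ := h
  refine ⟨π p, ?_, rfl⟩
  by_contra hn
  have := h1 (π p) (by omega)
  have := π.injective this
  omega

theorem PermBelow.symm {N : ℕ} {g g' : ℕ → α} (h : PermBelow N g g') : PermBelow N g' g := by
  obtain ⟨π, h1, rfl⟩ := h
  refine ⟨π⁻¹, fun p hp => ?_, by funext; simp⟩
  rw [Equiv.Perm.inv_eq_iff_eq, h1 p hp]

theorem PermBelow.image_eq {N N' : ℕ} {g g' : ℕ → α} (h : PermBelow N g g') (hN : N ≤ N') :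
    g' '' Set.Iio N' = g '' Set.Iio N' := by
  ext s
  constructor
  · rintro ⟨p, hp, rfl⟩
    obtain ⟨q, hq, h⟩ := (h.mono hN).exists_eq hp
    exact ⟨q, hq, h.symm⟩
  · rintro ⟨p, hp, rfl⟩
    obtain ⟨q, hq, h⟩ := (h.mono hN).symm.exists_eq hp
    exact ⟨q, hq, h.symm⟩

theorem PermBelow.injOn {N : ℕ} {g g' : ℕ → α} (h : PermBelow N g g')
    (hg : Set.InjOn g (Set.Iio N)) : Set.InjOn g' (Set.Iio N) := by
  obtain ⟨π, h1, rfl⟩ := h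
  have key : ∀ p < N, π p < N := by
    intro p hp
    by_contra hn
    have := π.injective (h1 (π p) (by omega))
    omega
  intro p hp q hq hpq
  exact π.injective (hg (key p hp) (key q hq) hpq)

end Heap

/-! ## Comparison of rows -/

section RowKey

variable {D : Type v} [LinearOrder D] {κ : Type w} [LinearOrder κ]

/-- The restriction of a row to the columns `b 0, …, b (K - 1)`, in lexicographic order. -/
def lexKey (b : ℕ → ℕ) (K : ℕ) (s : ℕ → D) : Lex (Fin K → D) := toLex fun i => s (b i)

/-- The rows are ordered by the columns `b 0, …, b (K - 1)`, and then by `tk`. -/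
def rowKey (tk : (ℕ → D) → κ) (b : ℕ → ℕ) (K : ℕ) (s : ℕ → D) : Lex (Lex (Fin K → D) × κ) :=
  toLex (lexKey b K s, tk s)

theorem lexKey_lt {b : ℕ → ℕ} {K : ℕ} {s t : ℕ → D} {i : ℕ} (hi : i < K)
    (he : ∀ j < i, s (b j) = t (b j)) (hlt : s (b i) < t (b i)) : lexKey b K s < lexKey b K t :=
  ⟨⟨i, hi⟩, fun j hj => he j hj, hlt⟩

theorem lexKey_eq_iff {b : ℕ → ℕ} {K : ℕ} {s t : ℕ → D} :
    lexKey b K s = lexKey b K t ↔ ∀ i < K, s (b i) = t (b i) :=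
  ⟨fun h i hi => congrFun h ⟨i, hi⟩, fun h => funext fun i => h i i.2⟩

variable {tk : (ℕ → D) → κ} {b : ℕ → ℕ} {K : ℕ} {s t : ℕ → D}

theorem rowKey_lt_iff : rowKey tk b K s < rowKey tk b K t ↔
    lexKey b K s < lexKey b K t ∨ lexKey b K s = lexKey b K t ∧ tk s < tk t :=
  Prod.Lex.lt_iff

theorem lexKey_le_of_rowKey_le (h : rowKey tk b K s ≤ rowKey tk b K t) :
    lexKey b K s ≤ lexKey b K t := by
  rcases Prod.Lex.le_iff.1 h with h | h
  exacts [le_of_lt h, h.1.le]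

end RowKey

/-! ### Comparison of rows and heapsort, with bounds for the time -/

variable {A : Type u} {D : Type v} [LinearOrder D] {m n : ℕ} {κ : Type w} [LinearOrder κ]

namespace Acc

variable (acc : Acc)

/-- Sets `f` to 1 if the row in position `x` is smaller than that in position `y`. -/
def cmp (x y : Nm) : Stmt :=
  putr Nm.c 0 ;; putr Nm.f 2 ;;
  acc.loopW (.and (.lt Nm.c Nm.kk) (.eq Nm.f 2))
    (acc.ite (.vlt x (.get Nm.buf Nm.c) y (.get Nm.buf Nm.c)) (putr Nm.f 1)
      (acc.ite (.vlt y (.get Nm.buf Nm.c) x (.get Nm.buf Nm.c)) (putr Nm.f 0) .skip) ;;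
      putr Nm.c (.reg Nm.c + 1)) ;;
  acc.ite (.eq Nm.f 2) (acc.cmpTie Nm.f x y) .skip

/-- Moves the row in position `cur` down the heap of the positions below `hi`. -/
def sift : Stmt :=
  putr Nm.ch (.reg Nm.cur + .reg Nm.cur + 1) ;;
  acc.loopW (.lt Nm.ch Nm.hi)
    (putr Nm.chh (.reg Nm.ch + 1) ;;
      acc.ite (.lt Nm.chh Nm.hi) (acc.cmp Nm.ch Nm.chh ;; acc.ite (.eq Nm.f 1) (putr Nm.ch Nm.chh) .skip)
        .skip ;;
      acc.cmp Nm.cur Nm.ch ;;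
      acc.ite (.eq Nm.f 1)
        (acc.exch Nm.cur Nm.ch ;; putr Nm.cur Nm.ch ;; putr Nm.ch (.reg Nm.cur + .reg Nm.cur + 1))
        (putr Nm.ch Nm.hi))

/-- Heapsort of the positions below `sz`. -/
def sort : Stmt :=
  putr Nm.e Nm.sz ;;
  acc.loopW (.lt 0 Nm.e) (putr Nm.e (.reg Nm.e - 1) ;; putr Nm.cur Nm.e ;; putr Nm.hi Nm.sz ;; acc.sift) ;;
  putr Nm.e Nm.sz ;;
  acc.loopW (.lt 1 Nm.e)
    (putr Nm.e (.reg Nm.e - 1) ;; acc.exch 0 Nm.e ;; putr Nm.cur 0 ;; putr Nm.hi Nm.e ;; acc.sift)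

end Acc

namespace Runs

variable {ly : Layer A D m n κ} {σ : St A D m n} {Q : St A D m n → Prop} {T : ℕ}

/-- While the columns seen so far agree, `f` is 2. The first difference sets it to 1 or 0 and ends
the loop; the tie-break is executed only if no difference is found. -/
theorem cmp {x y : Nm} {K : ℕ} (hK : σ.M .kk 0 = K) (hKm : K ≤ m) (hb : ∀ i < K, σ.M .buf i < m)
    (hx : x ≠ .c ∧ x ≠ .f) (hy : y ≠ .c ∧ y ≠ .f) (hxn : σ.M x 0 < n) (hyn : σ.M y 0 < n)
    (hQ : ∀ τ, St.Fr [.c, .f] σ τ → τ.g = σ.g → τ.out = σ.out →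
      τ.M .f 0 = (if rowKey ly.tk (σ.M .buf) K (σ.g (σ.M x 0)) <
        rowKey ly.tk (σ.M .buf) K (σ.g (σ.M y 0)) then 1 else 0) → Q τ)
    (hT : 5 * K + ly.wt + 5 ≤ T) : Runs ly (ly.acc.cmp x y) σ T Q := by
  refine seq (T₁ := 1) (T₂ := 5 * K + ly.wt + 4) (put (by simp) (by simp) (by simp) ?_ le_rfl)
    (by omega)
  refine seq (T₁ := 1) (T₂ := 5 * K + ly.wt + 3) (put (by simp) (by simp) (by simp) ?_ le_rfl)
    (by omega)
  simp only [Ex.val_ofNat]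
  refine seq (T₁ := 5 * K + 1) (T₂ := ly.wt + 2) ?_ (by omega)
  refine loopW (fun k τ => St.Fr [.c, .f] σ τ ∧ τ.g = σ.g ∧ τ.out = σ.out ∧ k ≤ K ∧
    τ.M .c 0 = K - k ∧
    ((τ.M .f 0 = 2 ∧ ∀ i < K - k, σ.g (σ.M x 0) (σ.M .buf i) = σ.g (σ.M y 0) (σ.M .buf i)) ∨
      (τ.M .f 0 = 1 ∧
        lexKey (σ.M .buf) K (σ.g (σ.M x 0)) < lexKey (σ.M .buf) K (σ.g (σ.M y 0))) ∨
      (τ.M .f 0 = 0 ∧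
        lexKey (σ.M .buf) K (σ.g (σ.M y 0)) < lexKey (σ.M .buf) K (σ.g (σ.M x 0)))))
    (fun _ => 4) ?_ ?_ ?_ K ?_ ?_ (by simp; omega)
  · simp
  · rintro τ ⟨h1, h2, h3, h4, h5, h6⟩
    have := h1 .kk (by simp)
    simp [h5, this, hK]
  · rintro k τ ⟨h1, h2, h3, h4, h5, h6⟩ hc
    have hkk := h1 .kk (by simp)
    have hbuf := h1 .buf (by simp)
    have hxx := h1 x (by simp [hx])
    have hyy := h1 y (by simp [hy])
    simp only [Cd.holds_and, Cd.holds_lt, Cd.holds_eq, Ex.val_get, Ex.val_ofNat, hkk, hK, h5] at hc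
    obtain ⟨hc1, hc2⟩ := hc
    have h7 : ∀ i < K - (k + 1),
        σ.g (σ.M x 0) (σ.M .buf i) = σ.g (σ.M y 0) (σ.M .buf i) := by
      rcases h6 with h6 | h6 | h6
      · exact h6.2
      · omega
      · omega
    have hbm := hb (K - (k + 1)) hc1
    have hput : ∀ τ' : St A D m n, St.Fr [.c, .f] σ τ' → τ'.g = σ.g → τ'.out = σ.out →
        τ'.M .c 0 = K - (k + 1) →
        ((τ'.M .f 0 = 2 ∧ ∀ i < K - k, σ.g (σ.M x 0) (σ.M .buf i) = σ.g (σ.M y 0) (σ.M .buf i)) ∨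
        (τ'.M .f 0 = 1 ∧
        lexKey (σ.M .buf) K (σ.g (σ.M x 0)) < lexKey (σ.M .buf) K (σ.g (σ.M y 0))) ∨
        (τ'.M .f 0 = 0 ∧
        lexKey (σ.M .buf) K (σ.g (σ.M y 0)) < lexKey (σ.M .buf) K (σ.g (σ.M x 0)))) →
        Runs ly (putr .c (.reg .c + 1)) τ' 1 fun τ => St.Fr [.c, .f] σ τ ∧ τ.g = σ.g ∧
          τ.out = σ.out ∧ k ≤ K ∧ τ.M .c 0 = K - k ∧
          ((τ.M .f 0 = 2 ∧
            ∀ i < K - k, σ.g (σ.M x 0) (σ.M .buf i) = σ.g (σ.M y 0) (σ.M .buf i)) ∨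
          (τ.M .f 0 = 1 ∧
            lexKey (σ.M .buf) K (σ.g (σ.M x 0)) < lexKey (σ.M .buf) K (σ.g (σ.M y 0))) ∨
          (τ.M .f 0 = 0 ∧
            lexKey (σ.M .buf) K (σ.g (σ.M y 0)) < lexKey (σ.M .buf) K (σ.g (σ.M x 0)))) := by
      intro τ' k1 k2 k3 k4 k5
      refine put (by simp) (by simp) (by simp [k4]; omega) ?_ le_rfl
      refine ⟨k1.set (by simp) _ _, k2, k3, by omega, by simp [k4]; omega, by simpa using k5⟩
    refine seq (T₁ := 3) (T₂ := 1) ?_ (by omega)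
    refine ite (T₁ := 2) ?_ (fun hlt => ?_) (fun hnlt => ?_) (by omega)
    · simp only [Cd.ok_vlt, Ex.ok_get, Ex.ok_ofNat, Ex.val_get, Ex.val_ofNat, h5, hbuf, hxx, hyy]
      omega
    · simp only [Cd.holds_vlt, Ex.val_get, Ex.val_ofNat, h5, hbuf, hxx, hyy, h2] at hlt
      refine put (by simp) (by simp) (by simp) (hput _ (h1.set (by simp) _ _) h2 h3 (by simp [h5])
        (Or.inr (Or.inl ⟨by simp, lexKey_lt hc1 h7 hlt⟩))) (by omega)
    · simp only [Cd.holds_vlt, Ex.val_get, Ex.val_ofNat, h5, hbuf, hxx, hyy, h2] at hnlt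
      refine ite (T₁ := 1) ?_ (fun hgt => ?_) (fun hngt => ?_) (by omega)
      · simp only [Cd.ok_vlt, Ex.ok_get, Ex.ok_ofNat, Ex.val_get, Ex.val_ofNat, h5, hbuf, hxx, hyy]
        omega
      · simp only [Cd.holds_vlt, Ex.val_get, Ex.val_ofNat, h5, hbuf, hxx, hyy, h2] at hgt
        refine put (by simp) (by simp) (by simp) (hput _ (h1.set (by simp) _ _) h2 h3
          (by simp [h5]) (Or.inr (Or.inr ⟨by simp, lexKey_lt hc1 (fun i hi => (h7 i hi).symm)
          hgt⟩))) le_rfl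
      · simp only [Cd.holds_vlt, Ex.val_get, Ex.val_ofNat, h5, hbuf, hxx, hyy, h2] at hngt
        refine skip (hput _ h1 h2 h3 h5 (Or.inl ⟨hc2, fun i hi => ?_⟩)) le_rfl
        rcases Nat.lt_or_ge i (K - (k + 1)) with h | h
        · exact h7 i h
        · obtain rfl : i = K - (k + 1) := by omega
          exact le_antisymm (not_lt.1 hngt) (not_lt.1 hnlt)
  · refine ⟨((St.Fr.refl _ _).set (by simp) _ _).set (by simp) _ _, rfl, rfl, le_rfl, by simp,
      by simp⟩
  · rintro k τ ⟨h1, h2, h3, h4, h5, h6⟩ hc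
    have hkk := h1 .kk (by simp)
    have hbuf := h1 .buf (by simp)
    have hxx := h1 x (by simp [hx])
    have hyy := h1 y (by simp [hy])
    simp only [Cd.holds_and, Cd.holds_lt, Cd.holds_eq, Ex.val_get, Ex.val_ofNat, hkk, hK, h5] at hc
    refine ite (T₁ := ly.wt + 1) (by simp) (fun hf => ?_) (fun hf => ?_) (by omega)
    · simp only [Cd.holds_eq, Ex.val_get, Ex.val_ofNat] at hf
      obtain rfl : k = 0 := by
        by_contra; exact hc ⟨by omega, hf⟩
      have heq : lexKey (σ.M .buf) K (σ.g (σ.M x 0)) = lexKey (σ.M .buf) K (σ.g (σ.M y 0)) := by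
        rw [lexKey_eq_iff]
        rcases h6 with h6 | h6 | h6
        · exact h6.2
        · omega
        · omega
      refine cmpTie (by simp) (by simp) (by simpa [hxx]) (by simpa [hyy]) ?_ (by omega)
      refine hQ _ (h1.set (by simp) _ _) h2 h3 ?_
      have hk : rowKey ly.tk (σ.M .buf) K (σ.g (σ.M x 0)) <
          rowKey ly.tk (σ.M .buf) K (σ.g (σ.M y 0)) ↔
          ly.tk (σ.g (σ.M x 0)) < ly.tk (σ.g (σ.M y 0)) := by
        rw [rowKey_lt_iff, heq]
        exact ⟨fun h => h.elim (fun h => absurd h (lt_irrefl _)) And.right, fun h => Or.inr ⟨rfl, h⟩⟩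
      simp only [hk]
      simp [h2, hxx, hyy]
    · simp only [Cd.holds_eq, Ex.val_get, Ex.val_ofNat] at hf
      refine skip (hQ _ h1 h2 h3 ?_) (by omega)
      rcases h6 with h6 | h6 | h6
      · exact absurd h6.1 hf
      · rw [h6.1, if_pos (rowKey_lt_iff.2 (Or.inl h6.2))]
      · rw [h6.1, if_neg (rowKey_lt_iff.2 (Or.inl h6.2)).not_gt]

/-- The inequality `hi ≤ (i + 1) * 2 ^ k` expresses that at most `k` levels of the heap lie below
`i`, which bounds the number of rounds. Setting `ch` to `hi` leaves the loop early. -/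
theorem sift {K lo hi d : ℕ} (hK : σ.M .kk 0 = K) (hKm : K ≤ m) (hb : ∀ i < K, σ.M .buf i < m)
    (hcur : σ.M .cur 0 = lo) (hlo : lo < hi) (hhi : σ.M .hi 0 = hi) (hn : hi ≤ n)
    (hd : hi ≤ (lo + 1) * 2 ^ d)
    (hH : HeapOn (rowKey ly.tk (σ.M .buf) K ∘ σ.g) (lo + 1) hi)
    (hQ : ∀ τ, St.Fr [.c, .f, .cur, .ch, .chh] σ τ → τ.out = σ.out → PermBelow hi σ.g τ.g →
      HeapOn (rowKey ly.tk (σ.M .buf) K ∘ τ.g) lo hi → Q τ)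
    (hT : d * (10 * K + 2 * ly.wt + ly.ws + 18) + 2 ≤ T) : Runs ly ly.acc.sift σ T Q := by
  set key := rowKey ly.tk (σ.M .buf) K with hkey
  refine seq (T₁ := 1) (T₂ := T - 1) (put (by simp) (by simp)
    (by simp [hcur]; omega) ?_ le_rfl) (by omega)
  simp only [Ex.val_add, Ex.val_get, Ex.val_ofNat, hcur]
  refine loopW (fun k τ => St.Fr [.c, .f, .cur, .ch, .chh] σ τ ∧ τ.out = σ.out ∧
    PermBelow hi σ.g τ.g ∧ ((τ.M .ch 0 = hi ∧ HeapOn (key ∘ τ.g) lo hi) ∨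
      ∃ i, τ.M .cur 0 = i ∧ τ.M .ch 0 = i + i + 1 ∧ lo ≤ i ∧ i < hi ∧ hi ≤ (i + 1) * 2 ^ k ∧
        HeapExcept (key ∘ τ.g) lo hi i))
    (fun _ => 10 * K + 2 * ly.wt + ly.ws + 17) ?_ ?_ ?_ d ?_ ?_
    (by simp only [Finset.sum_const, Finset.card_range, smul_eq_mul, Nat.add_assoc,
          Nat.reduceAdd] at hT ⊢; omega)
  · simp
  · rintro τ ⟨h1, h2, h3, h4⟩
    have hh := h1 .hi (by simp)
    simp only [Cd.holds_lt, Ex.val_get, Ex.val_ofNat, hh, hhi]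
    rcases h4 with ⟨h4, -⟩ | ⟨i, h4, h5, h6, h7, h8, -⟩ <;> omega
  · rintro k τ ⟨h1, h2, h3, h4⟩ hc
    have hh := h1 .hi (by simp)
    have hkk := h1 .kk (by simp)
    have hbuf := h1 .buf (by simp)
    simp only [Cd.holds_lt, Ex.val_get, Ex.val_ofNat, hh, hhi] at hc
    rcases h4 with ⟨h4, -⟩ | ⟨i, h4, h5, h6, h7, h8, h9⟩
    · omega
    rw [h5] at hc
    refine seq (T₁ := 1) (T₂ := 10 * K + 2 * ly.wt + ly.ws + 16) (put (by simp) (by simp)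
      (by simp [h5]; omega) ?_ le_rfl) (by omega)
    simp only [Ex.val_add, Ex.val_get, Ex.val_ofNat, h5]
    -- after the larger child has been chosen
    have hrest : ∀ ρ j, St.Fr [.c, .f, .cur, .ch, .chh] σ ρ → ρ.out = σ.out → ρ.g = τ.g →
        ρ.M .cur 0 = i → ρ.M .ch 0 = j → j < hi → 0 < j → (j - 1) / 2 = i →
        (∀ c, 0 < c → c < hi → (c - 1) / 2 = i → key (τ.g c) ≤ key (τ.g j)) →
        Runs ly (ly.acc.cmp .cur .ch ;; ly.acc.ite (.eq Nm.f 1)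
          (ly.acc.exch Nm.cur Nm.ch ;; putr .cur Nm.ch ;; putr .ch (.reg .cur + .reg .cur + 1))
          (putr .ch Nm.hi)) ρ (5 * K + ly.wt + ly.ws + 8)
          fun τ => St.Fr [.c, .f, .cur, .ch, .chh] σ τ ∧ τ.out = σ.out ∧
            PermBelow hi σ.g τ.g ∧ ((τ.M .ch 0 = hi ∧ HeapOn (key ∘ τ.g) lo hi) ∨
            ∃ i, τ.M .cur 0 = i ∧ τ.M .ch 0 = i + i + 1 ∧ lo ≤ i ∧ i < hi ∧ hi ≤ (i + 1) * 2 ^ k ∧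
              HeapExcept (key ∘ τ.g) lo hi i) := by
      intro ρ j k1 k2 k3 k4 k5 k6 k7 k8 k9
      have hh := k1 .hi (by simp)
      have hkk := k1 .kk (by simp)
      have hbuf := k1 .buf (by simp)
      refine seq (T₁ := 5 * K + ly.wt + 5) (T₂ := ly.ws + 3) ?_ (by omega)
      refine cmp (K := K) (by rw [hkk, hK]) hKm (by rwa [hbuf]) (by simp) (by simp)
        (by omega) (by omega) (fun ρ' l1 l2 l3 l4 => ?_) le_rfl
      rw [hbuf, ← hkey, k4, k5, k3] at l4
      have m1 : St.Fr [.c, .f, .cur, .ch, .chh] σ ρ' := k1.trans (l1.mono (by simp))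
      have m2 := l1 .cur (by simp)
      have m3 := l1 .ch (by simp)
      have m4 := m1 .hi (by simp)
      refine ite (T₁ := ly.ws + 2) (by simp) (fun hlt => ?_) (fun hnlt => ?_) (by omega)
      · simp only [Cd.holds_eq, Ex.val_get, Ex.val_ofNat, l4] at hlt
        have hlt' : key (τ.g i) < key (τ.g j) := by
          by_contra hn
          simp [hn] at hlt
        refine seq (T₁ := ly.ws) (T₂ := 2) (exch (by simp) (by simp) (by simp [m2, k4]; omega)
          (by simp [m3, k5]; omega) ?_ le_rfl) (by omega)
        refine seq (T₁ := 1) (T₂ := 1) (put (by simp) (by simp) (by simp) ?_ le_rfl) (by omega)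
        simp only [Ex.val_get, Ex.val_ofNat, St.swap_M, m3, m2, k4, k5]
        refine put (by simp) (by simp) (by simp; omega) ?_ le_rfl
        have m5 : St.Fr [.c, .f, .cur, .ch, .chh] σ (ρ'.swap i j) := m1
        refine ⟨(m5.set (by simp) _ _).set (by simp) _ _, by simp [l3, k2], ?_, Or.inr
          ⟨j, by simp, by simp, by omega, k6, ?_, ?_⟩⟩
        · simp only [St.set_g, St.swap_g, l2, k3]
          exact h3.trans (PermBelow.swap _ h7 k6)
        -- A child `j` of `i` satisfies `2 * (i + 1) ≤ j + 1`, so one level is used up.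
        · calc hi ≤ (i + 1) * 2 ^ (k + 1) := h8
            _ = (2 * (i + 1)) * 2 ^ k := by ring
            _ ≤ (j + 1) * 2 ^ k := Nat.mul_le_mul_right _ (by omega)
        · simp only [St.set_g, St.swap_g, l2, k3, ← Function.comp_assoc]
          exact h9.swap h6 k6 k8 k7 k9 hlt'
      · simp only [Cd.holds_eq, Ex.val_get, Ex.val_ofNat, l4] at hnlt
        have hle : key (τ.g j) ≤ key (τ.g i) := by
          by_contra hn
          simp [not_le.1 hn] at hnlt
        refine put (by simp) (by simp) (by simp) ?_ (by omega)
        refine ⟨m1.set (by simp) _ _, by simp [l3, k2], by simpa [l2, k3] using h3, Or.inl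
          ⟨by simp [m4, hhi], ?_⟩⟩
        simp only [St.set_g, l2, k3]
        exact h9.heapOn fun c c1 c2 c3 => (k9 c c1 c2 c3).trans hle
    have f1 := h1.set (x := .chh) (by simp) 0 (i + i + 1 + 1)
    refine seq (T₁ := 5 * K + ly.wt + 8) (T₂ := 5 * K + ly.wt + ly.ws + 8) ?_ (by omega)
    refine ite (T₁ := 5 * K + ly.wt + 7) (by simp) (fun hlt => ?_) (fun hnlt => ?_) (by omega)
    · simp only [Cd.holds_lt, Ex.val_get, Ex.val_ofNat, f1 .hi (by simp), hhi] at hlt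
      simp at hlt
      refine seq (T₁ := 5 * K + ly.wt + 5) (T₂ := 2) ?_ (by omega)
      refine cmp (K := K) (by simp [hkk, hK]) hKm (by simpa [hbuf]) (by simp) (by simp)
        (by simp [h5]; omega) (by simp; omega) (fun ρ' l1 l2 l3 l4 => ?_) le_rfl
      simp only [St.set_M_ne, St.set_M_same, hbuf, ← hkey, h5, ne_eq, reduceCtorEq,
        not_false_eq_true, if_true, St.set_g] at l4
      have m1 : St.Fr [.c, .f, .cur, .ch, .chh] σ ρ' := f1.trans (l1.mono (by simp))
      have m2 := l1 .cur (by simp)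
      have m3 := l1 .ch (by simp)
      have m4 := l1 .chh (by simp)
      simp at m2 m3 m4
      refine ite (T₁ := 1) (by simp) (fun hl => ?_) (fun hnl => ?_) (by omega)
      · simp only [Cd.holds_eq, Ex.val_get, Ex.val_ofNat, l4] at hl
        have hl' : key (τ.g (i + i + 1)) < key (τ.g (i + i + 1 + 1)) := by
          by_contra hn
          simp [hn] at hl
        refine put (by simp) (by simp) (by simp) (hrest _ (i + i + 1 + 1) (m1.set (by simp) _ _)
          (by simp [l3, h2]) (by simp [l2]) (by simp [m2, h4]) (by simp [m4]) hlt (by omega)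
          (by omega) (fun c c1 c2 c3 => ?_)) le_rfl
        have : c = i + i + 1 ∨ c = i + i + 1 + 1 := by omega
        rcases this with rfl | rfl
        exacts [hl'.le, le_rfl]
      · simp only [Cd.holds_eq, Ex.val_get, Ex.val_ofNat, l4] at hnl
        have hl' : key (τ.g (i + i + 1 + 1)) ≤ key (τ.g (i + i + 1)) := by
          by_contra hn
          simp [not_le.1 hn] at hnl
        refine skip (hrest _ (i + i + 1) m1
          (by simp [l3, h2]) (by simp [l2]) (by simp [m2, h4]) (by simp [m3, h5]) (by omega)
          (by omega) (by omega) (fun c c1 c2 c3 => ?_)) le_rfl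
        have : c = i + i + 1 ∨ c = i + i + 1 + 1 := by omega
        rcases this with rfl | rfl
        exacts [le_rfl, hl']
    · simp only [Cd.holds_lt, Ex.val_get, Ex.val_ofNat, f1 .hi (by simp), hhi] at hnlt
      simp at hnlt
      refine skip (hrest _ (i + i + 1) f1
          (by simp [h2]) (by simp) (by simp [h4]) (by simp [h5]) (by omega)
          (by omega) (by omega) (fun c c1 c2 c3 => ?_)) (by omega)
      have : c = i + i + 1 := by omega
      rw [this]
  · exact ⟨(St.Fr.refl _ _).set (by simp) _ _, rfl, PermBelow.refl _ _, Or.inr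
      ⟨lo, by simp [hcur], by simp, le_rfl, hlo, hd, hH.heapExcept⟩⟩
  · rintro k τ ⟨h1, h2, h3, h4⟩ hc
    have hh := h1 .hi (by simp)
    simp only [Cd.holds_lt, Ex.val_get, Ex.val_ofNat, hh, hhi] at hc
    refine hQ τ h1 h2 h3 ?_
    rcases h4 with ⟨-, h4⟩ | ⟨i, h4, h5, h6, h7, h8, h9⟩
    · exact h4
    · exact h9.heapOn fun c c1 c2 c3 => by omega

/-- Each phase sifts at most `N` times, through at most `d` levels. In the second phase the
positions from `e` on are final, and no earlier entry exceeds them. -/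
theorem sort {K N d : ℕ} (hK : σ.M .kk 0 = K) (hKm : K ≤ m) (hb : ∀ i < K, σ.M .buf i < m)
    (hN : σ.M .sz 0 = N) (hn : N ≤ n) (hd : N ≤ 2 ^ d)
    (hQ : ∀ τ, St.Fr [.c, .f, .cur, .ch, .chh, .hi, .e] σ τ → τ.out = σ.out →
      PermBelow N σ.g τ.g → (∀ p q, p ≤ q → q < N → rowKey ly.tk (σ.M .buf) K (τ.g p) ≤
        rowKey ly.tk (σ.M .buf) K (τ.g q)) → Q τ)
    (hT : 2 * N * (d * (10 * K + 2 * ly.wt + ly.ws + 18) + ly.ws + 6) + 4 ≤ T) :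
    Runs ly ly.acc.sort σ T Q := by
  set key := rowKey ly.tk (σ.M .buf) K with hkey
  set S := d * (10 * K + 2 * ly.wt + ly.ws + 18) + 2 with hS
  have hpow : ∀ lo, N ≤ (lo + 1) * 2 ^ d := fun lo =>
    hd.trans (Nat.le_mul_of_pos_left _ (Nat.succ_pos lo))
  have hT' : 1 + (N * (S + 4) + 1 + (1 + (N * (S + ly.ws + 4) + 1))) ≤ T := by
    refine le_trans ?_ hT
    rw [hS]
    nlinarith [Nat.zero_le (N * ly.ws)]
  clear_value S
  refine seq (T₁ := 1) (T₂ := N * (S + 4) + 1 + (1 + (N * (S + ly.ws + 4) + 1)))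
    (put (by simp) (by simp) (by simp) ?_ le_rfl) hT'
  simp only [Ex.val_get, Ex.val_ofNat, hN]
  refine seq (T₁ := N * (S + 4) + 1) (T₂ := 1 + (N * (S + ly.ws + 4) + 1)) ?_ le_rfl
  refine loopW (fun k τ => St.Fr [.c, .f, .cur, .ch, .chh, .hi, .e] σ τ ∧ τ.out = σ.out ∧
    PermBelow N σ.g τ.g ∧ τ.M .e 0 = k ∧ k ≤ N ∧ HeapOn (key ∘ τ.g) k N)
    (fun _ => S + 3) ?_ ?_ ?_ N ?_ ?_ (by simp [Nat.add_assoc])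
  · simp
  · rintro τ ⟨-, -, -, h, -⟩; simp [h]
  · rintro k τ ⟨h1, h2, h3, h4, h5, h6⟩ hc
    refine seq (T₁ := 1) (T₂ := S + 2) (put (by simp) (by simp) (by simp) ?_ le_rfl) (by omega)
    refine seq (T₁ := 1) (T₂ := S + 1) (put (by simp) (by simp) (by simp) ?_ le_rfl) (by omega)
    refine seq (T₁ := 1) (T₂ := S) (put (by simp) (by simp) (by simp) ?_ le_rfl) (by omega)
    have k1 := h1 .kk (by simp)
    have k2 := h1 .buf (by simp)
    have k3 := h1 .sz (by simp)
    simp only [Ex.val_sub, Ex.val_get, Ex.val_ofNat, h4, Nat.add_sub_cancel]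
    refine sift (K := K) (lo := k) (hi := N) (d := d) (by simp [k1, hK]) hKm (by simpa [k2])
      (by simp) (by omega) (by simp [k3, hN]) hn (hpow k)
      (by simpa [k2] using h6) (fun τ' l1 l2 l3 l4 => ?_) hS.ge
    simp only [St.set_M_ne, k2, ← hkey, ne_eq, reduceCtorEq, not_false_eq_true, St.set_g] at l3 l4
    refine ⟨((((h1.set (by simp) _ _).set (by simp) _ _).set (by simp) _ _).trans
      (l1.mono (by simp))), by simp [l2, h2], h3.trans l3, ?_, by omega, l4⟩
    rw [l1 .e (by simp)]; simp
  · exact ⟨(St.Fr.refl _ _).set (by simp) _ _, rfl, PermBelow.refl _ _, by simp, le_rfl,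
      fun c _ _ _ => by omega⟩
  rintro k τ ⟨h1, h2, h3, h4, h5, h6⟩ hc
  simp only [Cd.holds_lt, Ex.val_get, Ex.val_ofNat, h4, not_lt, Nat.le_zero] at hc
  subst hc
  refine seq (T₁ := 1) (T₂ := N * (S + ly.ws + 4) + 1) (put (by simp) (by simp) (by simp) ?_ le_rfl)
    le_rfl
  simp only [Ex.val_get, Ex.val_ofNat, h1 .sz (by simp), hN]
  refine loopW (fun k τ => St.Fr [.c, .f, .cur, .ch, .chh, .hi, .e] σ τ ∧ τ.out = σ.out ∧
    PermBelow N σ.g τ.g ∧ ∃ e, τ.M .e 0 = e ∧ e ≤ N ∧ e ≤ k + 1 ∧ HeapOn (key ∘ τ.g) 0 e ∧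
      ∀ p q, p ≤ q → e ≤ q → q < N → key (τ.g p) ≤ key (τ.g q))
    (fun _ => S + ly.ws + 3) ?_ ?_ ?_ N ?_ ?_ (by simp [Nat.add_assoc])
  · simp
  · rintro τ ⟨-, -, -, e, h, h', h'', -⟩; simp [h]; omega
  · rintro k τ ⟨h1, h2, h3, e, h4, h5, h6, h7, h8⟩ hc
    simp only [Cd.holds_lt, Ex.val_get, Ex.val_ofNat, h4] at hc
    obtain ⟨j, rfl⟩ : ∃ j, e = j + 1 := ⟨e - 1, by omega⟩
    refine seq (T₁ := 1) (T₂ := S + ly.ws + 2) (put (by simp) (by simp) (by simp) ?_ le_rfl)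
      (by omega)
    simp only [Ex.val_sub, Ex.val_get, Ex.val_ofNat, h4, Nat.add_sub_cancel]
    refine seq (T₁ := ly.ws) (T₂ := S + 2) (exch (by simp) (by simp) (by simp; omega)
      (by simp; omega) ?_ le_rfl) (by omega)
    refine seq (T₁ := 1) (T₂ := S + 1) (put (by simp) (by simp) (by simp) ?_ le_rfl) (by omega)
    refine seq (T₁ := 1) (T₂ := S) (put (by simp) (by simp) (by simp) ?_ le_rfl) (by omega)
    have k1 := h1 .kk (by simp)
    have k2 := h1 .buf (by simp)
    simp only [Ex.val_get, Ex.val_ofNat, St.set_M_same, if_true]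
    refine sift (K := K) (lo := 0) (hi := j) (d := d) (by simp [k1, hK]) hKm (by simpa [k2])
      (by simp) (by omega) (by simp) (by omega) (by have := hpow 0; omega)
      ?_ (fun τ' l1 l2 l3 l4 => ?_) hS.ge
    · simp [k2, ← hkey]
      intro c c1 c2 c3
      simp only [Function.comp]
      rw [Equiv.swap_apply_of_ne_of_ne (by omega) (by omega),
        Equiv.swap_apply_of_ne_of_ne (by omega) (by omega)]
      exact h7 c c1 (by omega) (by omega)
    · simp [k2, ← hkey] at l3 l4
      -- The entries up to `j` are the old heap rearranged, hence bounded by the old root, which is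
      -- now at `j`.
      have hold : ∀ p ≤ j, ∃ p' ≤ j, τ'.g p = τ.g p' := by
        intro p hp
        rcases Nat.lt_or_ge p j with hpj | hpj
        · obtain ⟨p', hp', h⟩ := l3.exists_eq hpj
          rw [h]
          refine ⟨Equiv.swap 0 j p', ?_, rfl⟩
          rw [Equiv.swap_apply_def]; split_ifs <;> omega
        · refine ⟨0, by omega, ?_⟩
          rw [l3.eq_of_le hpj]
          obtain rfl : p = j := by omega
          simp
      have hnew : ∀ p, j < p → τ'.g p = τ.g p := fun p hp => by
        rw [l3.eq_of_le hp.le]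
        simp only [Function.comp]
        rw [Equiv.swap_apply_of_ne_of_ne (by omega) (by omega)]
      refine ⟨(((St.Fr.set (τ := St.swap _ _ _) (h1.set (by simp) _ _) (by simp) _ _).set
        (by simp) _ _).trans
        (l1.mono (by simp))), by simp [l2, h2], h3.trans ((PermBelow.swap τ.g (i := 0) (j := j)
          (by omega) (by omega)).trans (l3.mono (by omega))), j, ?_, by omega, by omega, l4, ?_⟩
      · rw [l1 .e (by simp)]; simp
      · intro p q hpq hjq hq
        rcases Nat.eq_or_lt_of_le hjq with rfl | hjq
        · obtain ⟨p', hp', h⟩ := hold p hpq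
          have : τ'.g j = τ.g 0 := by rw [l3.eq_of_le le_rfl]; simp
          rw [h, this]
          exact h7.le_root p' (by omega)
        · rw [hnew q hjq]
          rcases Nat.lt_or_ge j p with hpj | hpj
          · rw [hnew p hpj]; exact h8 p q hpq (by omega) hq
          · obtain ⟨p', hp', h⟩ := hold p hpj
            rw [h]; exact h8 p' q (by omega) (by omega) hq
  · refine ⟨h1.set (by simp) _ _, h2, h3, N, by simp, le_rfl, by omega, h6, fun p q _ _ _ => ?_⟩
    omega
  · rintro k τ ⟨h1, h2, h3, e, h4, h5, h6, h7, h8⟩ hc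
    simp only [Cd.holds_lt, Ex.val_get, Ex.val_ofNat, h4] at hc
    refine hQ τ h1 h2 h3 fun p q hpq hq => ?_
    by_cases hqe : e ≤ q
    · exact h8 p q hpq hqe hq
    · obtain rfl : p = q := by omega
      exact le_rfl

end Runs

end PrimeFact

namespace PrimeFact

/-! ## Splitting a sorted list of rows -/

section SortedSplit

variable {D : Type v} [LinearOrder D] {g : ℕ → ℕ → D} {N m K : ℕ} {b : ℕ → ℕ} {X : Set ℕ}

theorem lexKey_id_lt_iff {s t : ℕ → D} :
    lexKey id m s < lexKey id m t ↔ ∃ i < m, (∀ j < i, s j = t j) ∧ s i < t i := by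
  constructor
  · rintro ⟨i, h1, h2⟩
    exact ⟨i, i.2, fun j hj => h1 ⟨j, hj.trans i.2⟩ hj, h2⟩
  · rintro ⟨i, hi, h1, h2⟩
    exact lexKey_lt hi h1 h2

theorem lexKey_id_injOn {s t : ℕ → D} (h : ∀ c, m ≤ c → s c = t c)
    (he : lexKey id m s = lexKey id m t) : s = t := by
  funext c
  rcases Nat.lt_or_ge c m with hc | hc
  exacts [lexKey_eq_iff.1 he c hc, h c hc]

/-- The test whether rows sorted by `X` form a product: `G` is the size of the first group. -/
def GridTest (g : ℕ → ℕ → D) (N m G : ℕ) (X : Set ℕ) : Prop :=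
  N % G = 0 ∧ ∀ p < N, ∀ c < m, (c ∈ X → g p c = g (p - p % G) c) ∧
    (c ∉ X → g p c = g (p % G) c)

/-- The position `p - p % G + q % G` lies in the group of `p` and has the offset of `q`. So the row
there agrees with row `p` on `X` and with row `q` elsewhere. -/
theorem GridTest.split {G : ℕ} (h : GridTest g N m G X) (hG : 0 < G)
    (hm : ∀ p < N, ∀ q < N, ∀ c, m ≤ c → g p c = g q c) : Split (g '' Set.Iio N) X := by
  rintro _ ⟨p, hp, rfl⟩ _ ⟨q, hq, rfl⟩
  obtain ⟨h1, h2⟩ := h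
  have hp' : p < N := hp
  have hq' : q < N := hq
  have hqG := Nat.mod_lt q hG
  have hrN : p - p % G + q % G < N := by
    obtain ⟨k, rfl⟩ := Nat.dvd_of_mod_eq_zero h1
    have e1 : p - p % G = G * (p / G) := by have := Nat.div_add_mod p G; omega
    have e2 : p / G + 1 ≤ k := Nat.div_lt_of_lt_mul hp'
    have e3 : G * (p / G + 1) ≤ G * k := Nat.mul_le_mul_left _ e2
    rw [mul_add, mul_one] at e3
    omega
  have hmod : (p - p % G + q % G) % G = q % G := by
    have e1 : p - p % G = G * (p / G) := by have := Nat.div_add_mod p G; omega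
    rw [e1, Nat.mul_add_mod, Nat.mod_mod]
  refine ⟨p - p % G + q % G, hrN, ?_⟩
  funext c
  rcases Nat.lt_or_ge c m with hc | hc
  · by_cases hX : c ∈ X
    · rw [mix_of_mem hX, (h2 p hp' c hc).1 hX, (h2 _ hrN c hc).1 hX, hmod,
        Nat.add_sub_cancel]
    · rw [mix_of_notMem hX, (h2 q hq' c hc).2 hX, (h2 _ hrN c hc).2 hX, hmod]
  · by_cases hX : c ∈ X
    · rw [mix_of_mem hX]; exact hm _ hrN _ hp' c hc
    · rw [mix_of_notMem hX]; exact hm _ hrN _ hq' c hc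

/-- In a product, the groups of rows that agree on `X` are copies of each other: mixing with a fixed
row carries one group injectively into another. Within a group the tie-break only sees columns
outside `X`, always in the same order, so all copies are sorted alike. The offset of a row in its
group therefore depends only on its part outside `X`, and the number of rows before its group only
on its part in `X`. -/
theorem gridTest_of_split (hs : Split (g '' Set.Iio N) X)
    (hX : ∀ c, c ∈ X ↔ ∃ i < K, b i = c) (hinj : Set.InjOn g (Set.Iio N))
    (hm : ∀ p < N, ∀ q < N, ∀ c, m ≤ c → g p c = g q c)
    (hsort : ∀ p q, p ≤ q → q < N →
      rowKey (lexKey id m) b K (g p) ≤ rowKey (lexKey id m) b K (g q))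
    (hN : 0 < N) :
    GridTest g N m ((Finset.range N).filter fun p => lexKey b K (g p) = lexKey b K (g 0)).card
      X := by
  classical
  have hXeq : ∀ {s t : ℕ → D}, lexKey b K s = lexKey b K t ↔ ∀ c ∈ X, s c = t c := by
    intro s t
    rw [lexKey_eq_iff]
    constructor
    · intro h c hc
      obtain ⟨i, hi, rfl⟩ := (hX c).1 hc
      exact h i hi
    · exact fun h i hi => h _ ((hX _).2 ⟨i, hi, rfl⟩)
  -- positions of mixed rows
  have hmp : ∀ p q, ∃ r, p < N → q < N → r < N ∧ g r = mix X (g p) (g q) := by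
    intro p q
    by_cases h : p < N ∧ q < N
    · obtain ⟨r, hr, h'⟩ := hs _ ⟨p, h.1, rfl⟩ _ ⟨q, h.2, rfl⟩
      exact ⟨r, fun _ _ => ⟨hr, h'⟩⟩
    · exact ⟨0, fun h1 h2 => absurd ⟨h1, h2⟩ h⟩
  choose mp hmp using hmp
  set F : ℕ → Lex (Fin K → D) := fun p => lexKey b K (g p) with hF
  set tk : ℕ → Lex (Fin m → D) := fun p => lexKey id m (g p) with htk
  have hFmp : ∀ p < N, ∀ q < N, F (mp p q) = F p := by
    intro p hp q hq
    refine hXeq.2 fun c hc => ?_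
    rw [(hmp p q hp hq).2, mix_of_mem hc]
  have hkey : ∀ p q, rowKey (lexKey id m) b K (g p) < rowKey (lexKey id m) b K (g q) ↔
      F p < F q ∨ F p = F q ∧ tk p < tk q := fun p q => rowKey_lt_iff
  have hstrict : ∀ p < N, ∀ q < N, (rowKey (lexKey id m) b K (g p) <
      rowKey (lexKey id m) b K (g q) ↔ p < q) := by
    intro p hp q hq
    constructor
    · intro h
      by_contra hn
      exact absurd (hsort q p (by omega) hp) (not_le.2 h)
    · intro h
      refine lt_of_le_of_ne (hsort p q h.le hq) fun he => ?_
      have h2 : tk p = tk q := congrArg Prod.snd (toLex.injective he)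
      have := hinj hp hq (lexKey_id_injOn (fun c hc => hm p hp q hq c hc) h2)
      omega
  -- The position of `p` will be `lo p + r p`: the rows in earlier groups plus those before `p` in
  -- its own group.
  let lo : ℕ → ℕ := fun p => ((Finset.range N).filter fun q => F q < F p).card
  let r : ℕ → ℕ := fun p => ((Finset.range N).filter fun q => F q = F p ∧ tk q < tk p).card
  let G : ℕ := ((Finset.range N).filter fun p => F p = F 0).card
  have hpos : ∀ p < N, p = lo p + r p := by
    intro p hp
    have h1 : (Finset.range N).filter (fun q => F q < F p ∨ F q = F p ∧ tk q < tk p) =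
        Finset.range p := by
      ext q
      simp only [Finset.mem_filter, Finset.mem_range]
      constructor
      · rintro ⟨hq, h⟩
        exact (hstrict q hq p hp).1 ((hkey q p).2 h)
      · intro h
        exact ⟨by omega, (hkey q p).1 ((hstrict q (by omega) p hp).2 h)⟩
    have h2 := congrArg Finset.card h1
    rw [Finset.filter_or, Finset.card_union_of_disjoint, Finset.card_range] at h2
    · exact h2.symm
    · refine Finset.disjoint_filter.2 fun q _ h h' => ?_
      exact absurd h'.1 h.ne
  have hmpinj : ∀ p < N, ∀ p' < N, ∀ q < N, ∀ q' < N, F q = F p → F q' = F p →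
      mp p' q = mp p' q' → q = q' := by
    intro p hp p' hp' q hq q' hq' h h' he
    refine hinj hq hq' (funext fun c => ?_)
    by_cases hc : c ∈ X
    · exact hXeq.1 (h.trans h'.symm) c hc
    · have h1 := congrFun (hmp p' q hp' hq).2 c
      have h2 := congrFun (hmp p' q' hp' hq').2 c
      rw [mix_of_notMem hc] at h1 h2
      rw [← h1, ← h2, he]
  have hfib_le : ∀ p < N, ∀ p' < N, ((Finset.range N).filter fun q => F q = F p).card ≤
      ((Finset.range N).filter fun q => F q = F p').card := by
    intro p hp p' hp'
    refine Finset.card_le_card_of_injOn (mp p') ?_ ?_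
    · intro q hq
      have hq := Finset.mem_filter.1 hq
      have hqN := Finset.mem_range.1 hq.1
      exact Finset.mem_filter.2 ⟨Finset.mem_range.2 (hmp p' q hp' hqN).1, hFmp p' hp' q hqN⟩
    · intro q hq q' hq' he
      have hq := Finset.mem_filter.1 hq
      have hq' := Finset.mem_filter.1 hq'
      exact hmpinj p hp p' hp' q (Finset.mem_range.1 hq.1) q' (Finset.mem_range.1 hq'.1) hq.2
        hq'.2 he
  have hfib : ∀ p < N, ((Finset.range N).filter fun q => F q = F p).card = G := fun p hp =>
    le_antisymm (hfib_le p hp 0 hN) (hfib_le 0 hN p hp)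
  -- The first difference of two rows of the same group lies outside `X`, so it survives when their
  -- parts in `X` are replaced.
  have htkmp : ∀ p < N, ∀ p' < N, ∀ q < N, F q = F p → tk q < tk p →
      tk (mp p' q) < tk (mp p' p) := by
    intro p hp p' hp' q hq hqp hlt
    obtain ⟨i, hi, h1, h2⟩ := lexKey_id_lt_iff.1 hlt
    refine lexKey_id_lt_iff.2 ⟨i, hi, fun j hj => ?_, ?_⟩
    · rw [(hmp p' q hp' hq).2, (hmp p' p hp' hp).2]
      by_cases hc : j ∈ X
      · rw [mix_of_mem hc, mix_of_mem hc]
      · rw [mix_of_notMem hc, mix_of_notMem hc]; exact h1 j hj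
    · rw [(hmp p' q hp' hq).2, (hmp p' p hp' hp).2]
      have hc : i ∉ X := fun hc => absurd (hXeq.1 hqp i hc) h2.ne
      rw [mix_of_notMem hc, mix_of_notMem hc]; exact h2
  have hr_le : ∀ p < N, ∀ p' < N, r p ≤ r (mp p' p) := by
    intro p hp p' hp'
    refine Finset.card_le_card_of_injOn (mp p') ?_ ?_
    · intro q hq
      have hq := Finset.mem_filter.1 hq
      have hqN := Finset.mem_range.1 hq.1
      refine Finset.mem_filter.2 ⟨Finset.mem_range.2 (hmp p' q hp' hqN).1, ?_,
        htkmp p hp p' hp' q hqN hq.2.1 hq.2.2⟩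
      rw [hFmp p' hp' q hqN, hFmp p' hp' p hp]
    · intro q hq q' hq' he
      have hq := Finset.mem_filter.1 hq
      have hq' := Finset.mem_filter.1 hq'
      exact hmpinj p hp p' hp' q (Finset.mem_range.1 hq.1) q' (Finset.mem_range.1 hq'.1) hq.2.1
        hq'.2.1 he
  -- Mixing back with `p` recovers `p`, so the inequality `hr_le` holds in both directions.
  have hr : ∀ p < N, ∀ p' < N, r (mp p' p) = r p := by
    intro p hp p' hp'
    refine le_antisymm ?_ (hr_le p hp p' hp')
    have h1 := (hmp p' p hp' hp)
    have h2 := hmp p (mp p' p) hp h1.1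
    have h3 : mp p (mp p' p) = p := by
      refine hinj h2.1 hp ?_
      rw [h2.2, h1.2]
      funext c
      by_cases hc : c ∈ X
      · rw [mix_of_mem hc]
      · rw [mix_of_notMem hc, mix_of_notMem hc]
    have := hr_le (mp p' p) h1.1 p hp
    rwa [h3] at this
  -- A set of rows defined by their parts in `X` is a union of groups, each of size `G`.
  have hdvd : ∀ P : Lex (Fin K → D) → Prop,
      G ∣ ((Finset.range N).filter fun q => P (F q)).card := by
    intro P
    rw [Finset.card_eq_sum_card_image F]
    refine Finset.dvd_sum fun x hx => ?_
    obtain ⟨q, hq, rfl⟩ := Finset.mem_image.1 hx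
    have hq := Finset.mem_filter.1 hq
    rw [Finset.filter_filter]
    have : (Finset.range N).filter (fun a => P (F a) ∧ F a = F q) =
        (Finset.range N).filter fun a => F a = F q := by
      refine Finset.filter_congr fun a _ => ⟨And.right, fun h => ⟨h ▸ hq.2, h⟩⟩
    rw [this, hfib q (Finset.mem_range.1 hq.1)]
  have hlt : ∀ p < N, r p < G := by
    intro p hp
    rw [← hfib p hp]
    refine Finset.card_lt_card ⟨fun q hq => ?_, fun h => ?_⟩
    · have hq := Finset.mem_filter.1 hq
      exact Finset.mem_filter.2 ⟨hq.1, hq.2.1⟩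
    · have := h (Finset.mem_filter.2 ⟨Finset.mem_range.2 hp, rfl⟩)
      exact absurd (Finset.mem_filter.1 this).2.2 (lt_irrefl _)
  have hmod : ∀ p < N, p % G = r p ∧ p - p % G = lo p := by
    intro p hp
    obtain ⟨k, hk⟩ := hdvd (fun x => x < F p)
    have h1 := hpos p hp
    have h2 : lo p = G * k := hk
    have h3 : p % G = r p := by
      conv_lhs => rw [h1, h2]
      rw [Nat.mul_add_mod, Nat.mod_eq_of_lt (hlt p hp)]
    omega
  have h0 := hpos 0 hN
  change GridTest g N m G X
  refine ⟨?_, fun p hp c hc => ⟨fun hcX => ?_, fun hcX => ?_⟩⟩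
  · have := hdvd fun _ => True
    rw [Finset.filter_true, Finset.card_range] at this
    exact Nat.mod_eq_zero_of_dvd this
  · have h1 := hmp p 0 hp hN
    have h2 := hpos _ h1.1
    have h3 : lo (mp p 0) = lo p := by
      have : F (mp p 0) = F p := hFmp p hp 0 hN
      change (Finset.card _) = (Finset.card _)
      rw [this]
    rw [h3, hr 0 hN p hp, show r 0 = 0 by omega] at h2
    rw [(hmod p hp).2, ← add_zero (lo p), ← h2, h1.2, mix_of_mem hcX]
  · have h1 := hmp 0 p hN hp
    have h2 := hpos _ h1.1
    have h3 : lo (mp 0 p) = lo 0 := by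
      have : F (mp 0 p) = F 0 := hFmp 0 hN p hp
      change (Finset.card _) = (Finset.card _)
      rw [this]
    rw [h3, hr p hp 0 hN, show lo 0 = 0 by omega, zero_add] at h2
    rw [(hmod p hp).1, ← h2, h1.2, mix_of_notMem hcX]

end SortedSplit

end PrimeFact

/-! ### Subroutines: lists of columns, relabelling, constancy, and the test for a product -/

namespace PrimeFact

variable {A : Type u} {D : Type v} [LinearOrder D] {m n : ℕ} {κ : Type w} [LinearOrder κ]

namespace Acc

variable (acc : Acc)

/-- Lists in `buf` the columns with label `cl`, and counts them in `kk`. -/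
def gather : Stmt :=
  putr Nm.kk 0 ;;
  acc.forR Nm.b 0 .arity
    (acc.ite (.eq (.get Nm.lab Nm.b) Nm.cl) (put Nm.buf Nm.kk Nm.b ;; putr Nm.kk (.reg Nm.kk + 1)) .skip)

/-- Replaces the label `cl` by `a`. -/
def relabel : Stmt :=
  acc.forR Nm.b 0 .arity (acc.ite (.eq (.get Nm.lab Nm.b) Nm.cl) (put Nm.lab Nm.b Nm.a) .skip)

/-- Sets `f` to 0 if the rows in the positions below `x` agree in column `b`, otherwise to 1. -/
def nonconst (x : Nm) : Stmt :=
  putr Nm.f 0 ;; acc.forR Nm.p 0 x (acc.ite (.veq Nm.p Nm.b 0 Nm.b) .skip (putr Nm.f 1))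

/-- Sets `f` to 1 if the rows in positions `p` and `y` agree in the columns in `buf`, and to 0
otherwise. -/
def agree (y : Ex) : Stmt :=
  putr Nm.f 1 ;;
  acc.forR Nm.c 0 Nm.kk (acc.ite (.veq Nm.p (.get Nm.buf Nm.c) y (.get Nm.buf Nm.c)) .skip (putr Nm.f 0))

/-- Counts in `g` the rows that agree with the first one in the columns in `buf`. -/
def groupSize : Stmt :=
  putr Nm.g 0 ;;
  acc.forR Nm.p 0 Nm.sz (acc.agree 0 ;; acc.ite (.eq Nm.f 1) (putr Nm.g (.reg Nm.g + 1)) .skip)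

/-- Sets `ok` to 1 if the sorted rows pass the test for a product, and to 0 otherwise. -/
def gridTest : Stmt :=
  acc.ite (.eq (.reg Nm.sz % .reg Nm.g) 0) (putr Nm.ok 1) (putr Nm.ok 0) ;;
  acc.forR Nm.p 0 Nm.sz
    (acc.forR Nm.b 0 .arity
      (acc.ite (.eq (.get Nm.lab Nm.b) Nm.cl) (putr Nm.q (.reg Nm.p - .reg Nm.p % .reg Nm.g))
        (putr Nm.q (.reg Nm.p % .reg Nm.g)) ;;
      acc.ite (.veq Nm.p Nm.b Nm.q Nm.b) .skip (putr Nm.ok 0)))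

end Acc

/-- The register `kk` and the array `buf` contain the list of the columns satisfying `X`. -/
structure BufLists (σ : St A D m n) (X : ℕ → Prop) (K : ℕ) : Prop where
  kk : σ.M .kk 0 = K
  le : K ≤ m
  lt : ∀ i < K, σ.M .buf i < m
  mem : ∀ i < K, X (σ.M .buf i)
  cover : ∀ c < m, X c → ∃ i < K, σ.M .buf i = c
  inj : ∀ i < K, ∀ j < K, σ.M .buf i = σ.M .buf j → i = j

theorem BufLists.congr {σ τ : St A D m n} {X : ℕ → Prop} {K : ℕ} (h : BufLists σ X K)
    (h₁ : τ.M .kk = σ.M .kk) (h₂ : τ.M .buf = σ.M .buf) : BufLists τ X K := by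
  obtain ⟨a1, a2, a3, a4, a5, a6⟩ := h
  constructor <;> simpa only [h₁, h₂]

namespace Runs

variable {ly : Layer A D m n κ} {σ : St A D m n} {Q : St A D m n → Prop} {T : ℕ} {s : Stmt}

/-- An amortized form of `loopW`: the invariant carries the time still available, so neither the
number of rounds nor the cost of a round has to be known in advance. -/
theorem loopBudget {c : Cd} (I : ℕ → St A D m n → Prop) (hok : ∀ β σ, I β σ → c.Ok σ)
    (h₁ : ∀ β σ, I β σ → 1 ≤ β)
    (hs : ∀ β σ, I β σ → c.Holds σ → ∃ t β', t + 1 + β' ≤ β ∧ Runs ly s σ t (I β'))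
    (hQ : ∀ β σ, I β σ → ¬ c.Holds σ → Q σ) (h : I T σ) :
    Runs ly (ly.acc.loopW c s) σ T Q := by
  induction T using Nat.strong_induction_on generalizing σ with
  | _ T ih =>
    intro st hst
    obtain ⟨h1, h2⟩ := comp_sound_cd ly hst (hok _ _ h)
    by_cases hc : c.Holds σ
    · obtain ⟨t, β', hb, hr⟩ := hs T σ h hc
      obtain ⟨t', ht', st', σ', k1, k2, k3⟩ := hr st hst
      obtain ⟨t'', ht'', st'', σ'', l1, l2, l3⟩ := ih β' (by omega) k3 st' k2
      exact ⟨t' + t'' + 1, by omega, st'', σ'',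
        .loopStep _ _ _ _ _ _ _ h2 (by simp [h1, hc]) k1 l1, l2, l3⟩
    · exact ⟨1, h₁ _ _ h, st, σ, .loopDone _ _ _ h2 (by simp [h1, hc]), hst, hQ _ _ h hc⟩

/-- Loop with a constant bound for the time of an iteration. -/
theorem forC {x : Nm} {hi : Ex} (N : ℕ) (I : ℕ → St A D m n → Prop) (B : ℕ)
    (hN : N ≤ m + n) (h : I 0 (σ.set x 0 0))
    (hhi : ∀ i σ, I i σ → σ.M x 0 = i → hi.Ok σ ∧ hi.val σ = N)
    (hs : ∀ i σ, i < N → I i σ → σ.M x 0 = i →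
      Runs ly s σ B fun σ' => σ'.M x 0 = i ∧ I (i + 1) (σ'.set x 0 (i + 1)))
    (hQ : ∀ σ, I N σ → σ.M x 0 = N → Q σ) (hT : N * (B + 2) + 2 ≤ T) :
    Runs ly (ly.acc.forR x 0 hi s) σ T Q :=
  forR 0 N I (fun _ => B) (by simp) rfl (Nat.zero_le _) hN h hhi (fun i σ _ => hs i σ) hQ
    (by simpa using hT)

theorem gather (hQ : ∀ τ, St.Fr [.kk, .b, .buf] σ τ → τ.g = σ.g → τ.out = σ.out →
      BufLists τ (fun c => σ.M .lab c = σ.M .cl 0)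
        ((Finset.range m).filter fun c => σ.M .lab c = σ.M .cl 0).card → Q τ)
    (hT : 5 * m + 3 ≤ T) : Runs ly ly.acc.gather σ T Q := by
  refine seq (T₁ := 1) (T₂ := 5 * m + 2) (put (by simp) (by simp) (by simp) ?_ le_rfl) (by omega)
  simp only [Ex.val_ofNat]
  refine forC m (fun i τ => St.Fr [.kk, .b, .buf] σ τ ∧ τ.g = σ.g ∧ τ.out = σ.out ∧
    ∃ K, K = ((Finset.range i).filter fun c => σ.M .lab c = σ.M .cl 0).card ∧ τ.M .kk 0 = K ∧
      (∀ j < K, τ.M .buf j < i ∧ σ.M .lab (τ.M .buf j) = σ.M .cl 0) ∧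
      (∀ c < i, σ.M .lab c = σ.M .cl 0 → ∃ j < K, τ.M .buf j = c) ∧
      ∀ j < K, ∀ l < K, τ.M .buf j = τ.M .buf l → j = l) 3 (by omega) ?_ ?_ ?_ ?_ (by omega)
  · exact ⟨((St.Fr.refl _ _).set (by simp) _ _).set (by simp) _ _, rfl, rfl, 0, by simp, by simp,
      by simp, by simp, by simp⟩
  · simp
  · rintro i τ hi ⟨h1, h2, h3, K, hK, h4, h5, h6, h7⟩ hb
    have hlab := h1 .lab (by simp)
    have hcl := h1 .cl (by simp)
    have hKi : K ≤ i := by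
      rw [hK]
      exact (Finset.card_filter_le _ _).trans (by simp)
    refine ite (T₁ := 2) (by simp [hb]; omega) (fun hc => ?_) (fun hc => ?_) le_rfl
    · simp only [Cd.holds_eq, Ex.val_get, Ex.val_ofNat, hb, hlab, hcl] at hc
      refine seq (T₁ := 1) (T₂ := 1) (put (by simp) (by simp [h4]; omega) (by simp) ?_ le_rfl)
        le_rfl
      simp only [Ex.val_get, Ex.val_ofNat, h4, hb]
      refine put (by simp) (by simp) (by simp [h4]; omega) ?_ le_rfl
      simp only [Ex.val_add, Ex.val_get, Ex.val_ofNat]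
      refine ⟨by simp [hb], ((h1.set (by simp) _ _).set (by simp) _ _).set (by simp) _ _, h2, h3,
        K + 1, ?_, by simp [h4], ?_, ?_, ?_⟩
      · rw [Finset.range_add_one, Finset.filter_insert, if_pos hc, Finset.card_insert_of_notMem
          (by simp), hK]
      · intro j hj
        simp only [St.set_M_ne, St.set_M_same, ne_eq, reduceCtorEq, not_false_eq_true]
        by_cases hjK : j = K
        · simp [hjK, hc]
        · have := h5 j (by omega)
          simp only [hjK, if_false]
          exact ⟨by omega, this.2⟩
      · intro c hci hcl'
        simp only [St.set_M_ne, St.set_M_same, ne_eq, reduceCtorEq, not_false_eq_true]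
        by_cases hc' : c = i
        · exact ⟨K, by omega, by simp [hc']⟩
        · obtain ⟨j, hj, hj'⟩ := h6 c (by omega) hcl'
          exact ⟨j, by omega, by rw [if_neg (by omega), hj']⟩
      · intro j hj l hl
        simp only [St.set_M_ne, St.set_M_same, ne_eq, reduceCtorEq, not_false_eq_true]
        by_cases hjK : j = K <;> by_cases hlK : l = K
        · omega
        · have := h5 l (by omega)
          simp only [hjK, hlK, if_true, if_false]; omega
        · have := h5 j (by omega)
          simp only [hjK, hlK, if_true, if_false]; omega
        · simp only [hjK, hlK, if_false]; exact h7 j (by omega) l (by omega)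
    · simp only [Cd.holds_eq, Ex.val_get, Ex.val_ofNat, hb, hlab, hcl] at hc
      refine skip ⟨hb, h1.set (by simp) _ _, h2, h3, K, ?_, by simp [h4], ?_, ?_, ?_⟩ (by omega)
      · rw [Finset.range_add_one, Finset.filter_insert, if_neg hc, hK]
      · intro j hj
        have := h5 j hj
        simp
        exact ⟨by omega, this.2⟩
      · intro c hci hcl'
        have : c ≠ i := by rintro rfl; exact hc hcl'
        simpa using h6 c (by omega) hcl'
      · simpa using h7
  · rintro τ ⟨h1, h2, h3, K, hK, h4, h5, h6, h7⟩ -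
    subst hK
    exact hQ τ h1 h2 h3 ⟨h4, (Finset.card_filter_le _ _).trans (by simp), fun i hi => (h5 i hi).1,
      fun i hi => (h5 i hi).2, h6, h7⟩

theorem relabel (hQ : ∀ τ, St.Fr [.b, .lab] σ τ → τ.g = σ.g → τ.out = σ.out →
      (∀ c < m, τ.M .lab c = if σ.M .lab c = σ.M .cl 0 then σ.M .a 0 else σ.M .lab c) → Q τ)
    (hT : 4 * m + 2 ≤ T) : Runs ly ly.acc.relabel σ T Q := by
  refine forC m (fun i τ => St.Fr [.b, .lab] σ τ ∧ τ.g = σ.g ∧ τ.out = σ.out ∧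
    (∀ c, τ.M .lab c = if c < i ∧ σ.M .lab c = σ.M .cl 0 then σ.M .a 0 else σ.M .lab c)) 2
    (by omega) ?_ ?_ ?_ ?_ (by omega)
  · exact ⟨(St.Fr.refl _ _).set (by simp) _ _, rfl, rfl, by simp⟩
  · simp
  · rintro i τ hi ⟨h1, h2, h3, h4⟩ hb
    have hcl := h1 .cl (by simp)
    have ha := h1 .a (by simp)
    have hi' : τ.M .lab i = σ.M .lab i := by simp [h4]
    refine ite (T₁ := 1) (by simp [hb]; omega) (fun hc => ?_) (fun hc => ?_) le_rfl
    · simp only [Cd.holds_eq, Ex.val_get, Ex.val_ofNat, hb, hcl, hi'] at hc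
      refine put (by simp) (by simp [hb]; omega) (by simp) ?_ le_rfl
      simp only [Ex.val_get, Ex.val_ofNat, hb, ha]
      refine ⟨by simp [hb], (h1.set (by simp) _ _).set (by simp) _ _, h2, h3, fun c => ?_⟩
      simp only [St.set_M_ne, St.set_M_same, ne_eq, reduceCtorEq, not_false_eq_true, h4]
      by_cases hci : c = i
      · simp [hci, hc]
      · simp only [hci, if_false]
        have : c < i + 1 ↔ c < i := by omega
        simp [this]
    · simp only [Cd.holds_eq, Ex.val_get, Ex.val_ofNat, hb, hcl, hi'] at hc
      refine skip ⟨hb, h1.set (by simp) _ _, h2, h3, fun c => ?_⟩ (by omega)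
      simp only [St.set_M_ne, ne_eq, reduceCtorEq, not_false_eq_true, h4]
      by_cases hci : c = i
      · simp [hci, hc]
      · have : c < i + 1 ↔ c < i := by omega
        simp [this]
  · rintro τ ⟨h1, h2, h3, h4⟩ -
    exact hQ τ h1 h2 h3 fun c hc => by simp [h4, hc]

theorem nonconst {x : Nm} {N : ℕ} (hx : x ≠ .f ∧ x ≠ .p) (hN : σ.M x 0 = N) (hn : N ≤ n)
    (hb : σ.M .b 0 < m)
    (hQ : ∀ τ, St.Fr [.f, .p] σ τ → τ.g = σ.g → τ.out = σ.out → τ.M .f 0 ≤ 1 →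
      (τ.M .f 0 = 0 ↔ ∀ p < N, σ.g p (σ.M .b 0) = σ.g 0 (σ.M .b 0)) → Q τ)
    (hT : 4 * N + 3 ≤ T) : Runs ly (ly.acc.nonconst x) σ T Q := by
  refine seq (T₁ := 1) (T₂ := 4 * N + 2) (put (by simp) (by simp) (by simp) ?_ le_rfl) (by omega)
  simp only [Ex.val_ofNat]
  refine forC N (fun i τ => St.Fr [.f, .p] σ τ ∧ τ.g = σ.g ∧ τ.out = σ.out ∧ τ.M .f 0 ≤ 1 ∧
    (τ.M .f 0 = 0 ↔ ∀ p < i, σ.g p (σ.M .b 0) = σ.g 0 (σ.M .b 0))) 2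
    (by omega) ?_ ?_ ?_ ?_ (by omega)
  · exact ⟨((St.Fr.refl _ _).set (by simp) _ _).set (by simp) _ _, rfl, rfl, by simp, by simp⟩
  · rintro i τ ⟨h1, -⟩ -
    simp [h1 x (by simp [hx]), hN]
  · rintro i τ hi ⟨h1, h2, h3, h4, h5⟩ hp
    have hb' := h1 .b (by simp)
    have hstep : (∀ p < i + 1, σ.g p (σ.M .b 0) = σ.g 0 (σ.M .b 0)) ↔
        (∀ p < i, σ.g p (σ.M .b 0) = σ.g 0 (σ.M .b 0)) ∧
          σ.g i (σ.M .b 0) = σ.g 0 (σ.M .b 0) :=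
      ⟨fun h => ⟨fun p hp => h p (by omega), h i (by omega)⟩, fun h p hp => by
        rcases Nat.lt_succ_iff_lt_or_eq.1 hp with hp | rfl
        exacts [h.1 p hp, h.2]⟩
    refine ite (T₁ := 1) (by simp [hp, hb']; omega) (fun hc => ?_) (fun hc => ?_) le_rfl
    · simp only [Cd.holds_veq, Ex.val_get, Ex.val_ofNat, hp, hb', h2] at hc
      refine skip ⟨hp, h1.set (by simp) _ _, h2, h3, by simpa using h4, ?_⟩ le_rfl
      rw [hstep]
      simp [h5, hc]
    · simp only [Cd.holds_veq, Ex.val_get, Ex.val_ofNat, hp, hb', h2] at hc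
      refine put (by simp) (by simp) (by simp) ⟨by simp [hp],
        (h1.set (by simp) _ _).set (by simp) _ _, h2, h3, by simp, ?_⟩ le_rfl
      rw [hstep]
      simp [hc]
  · rintro τ ⟨h1, h2, h3, h4, h5⟩ -
    exact hQ τ h1 h2 h3 h4 h5

/-- The position `y` is evaluated anew in every round, so its value must survive changes of `f` and
`c`. -/
theorem agree {y : Ex} {K r : ℕ} {X : ℕ → Prop} (hX : BufLists σ X K) (hp : σ.M .p 0 < n)
    (hy : ∀ τ, St.Fr [.f, .c] σ τ → y.Ok τ ∧ y.val τ = r) (hr : r < n)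
    (hQ : ∀ τ, St.Fr [.f, .c] σ τ → τ.g = σ.g → τ.out = σ.out → τ.M .f 0 ≤ 1 →
      (τ.M .f 0 = 1 ↔
        lexKey (σ.M .buf) K (σ.g (σ.M .p 0)) = lexKey (σ.M .buf) K (σ.g r)) → Q τ)
    (hT : 4 * K + 3 ≤ T) : Runs ly (ly.acc.agree y) σ T Q := by
  have hKm := hX.le
  refine seq (T₁ := 1) (T₂ := 4 * K + 2) (put (by simp) (by simp) (by simp) ?_ le_rfl) (by omega)
  simp only [Ex.val_ofNat]
  refine forC K (fun i τ => St.Fr [.f, .c] σ τ ∧ τ.g = σ.g ∧ τ.out = σ.out ∧ τ.M .f 0 ≤ 1 ∧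
    (τ.M .f 0 = 1 ↔ ∀ j < i, σ.g (σ.M .p 0) (σ.M .buf j) = σ.g r (σ.M .buf j))) 2
    (by omega) ?_ ?_ ?_ ?_ (by omega)
  · exact ⟨((St.Fr.refl _ _).set (by simp) _ _).set (by simp) _ _, rfl, rfl, by simp, by simp⟩
  · rintro i τ ⟨h1, -⟩ -
    simp [h1 .kk (by simp), hX.kk]
  · rintro i τ hi ⟨h1, h2, h3, h4, h5⟩ hc
    have hbuf := h1 .buf (by simp)
    have hp' := h1 .p (by simp)
    obtain ⟨hy1, hy2⟩ := hy τ h1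
    have hlt := hX.lt i hi
    have hstep : (∀ j < i + 1, σ.g (σ.M .p 0) (σ.M .buf j) = σ.g r (σ.M .buf j)) ↔
        (∀ j < i, σ.g (σ.M .p 0) (σ.M .buf j) = σ.g r (σ.M .buf j)) ∧
          σ.g (σ.M .p 0) (σ.M .buf i) = σ.g r (σ.M .buf i) :=
      ⟨fun h => ⟨fun p hp => h p (by omega), h i (by omega)⟩, fun h p hp => by
        rcases Nat.lt_succ_iff_lt_or_eq.1 hp with hp | rfl
        exacts [h.1 p hp, h.2]⟩
    refine ite (T₁ := 1) (by simp [hc, hbuf, hp', hy1, hy2]; omega) (fun he => ?_) (fun he => ?_)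
      le_rfl
    · simp only [Cd.holds_veq, Ex.val_get, Ex.val_ofNat, hc, hbuf, hp', hy2, h2] at he
      refine skip ⟨hc, h1.set (by simp) _ _, h2, h3, by simpa using h4, ?_⟩ le_rfl
      rw [hstep]
      simp [h5, he]
    · simp only [Cd.holds_veq, Ex.val_get, Ex.val_ofNat, hc, hbuf, hp', hy2, h2] at he
      refine put (by simp) (by simp) (by simp) ⟨by simp [hc],
        (h1.set (by simp) _ _).set (by simp) _ _, h2, h3, by simp, ?_⟩ le_rfl
      rw [hstep]
      simp [he]
  · rintro τ ⟨h1, h2, h3, h4, h5⟩ -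
    exact hQ τ h1 h2 h3 h4 (by rw [h5, lexKey_eq_iff])

theorem groupSize {K N : ℕ} {X : ℕ → Prop} (hX : BufLists σ X K) (hN : σ.M .sz 0 = N)
    (hn : N ≤ n)
    (hQ : ∀ τ, St.Fr [.g, .p, .f, .c] σ τ → τ.g = σ.g → τ.out = σ.out →
      τ.M .g 0 = ((Finset.range N).filter fun p =>
        lexKey (σ.M .buf) K (σ.g p) = lexKey (σ.M .buf) K (σ.g 0)).card → Q τ)
    (hT : N * (4 * K + 7) + 3 ≤ T) : Runs ly ly.acc.groupSize σ T Q := by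
  refine seq (T₁ := 1) (T₂ := N * (4 * K + 7) + 2) (put (by simp) (by simp) (by simp) ?_ le_rfl)
    (by omega)
  simp only [Ex.val_ofNat]
  refine forC N (fun i τ => St.Fr [.g, .p, .f, .c] σ τ ∧ τ.g = σ.g ∧ τ.out = σ.out ∧
    τ.M .g 0 = ((Finset.range i).filter fun p =>
        lexKey (σ.M .buf) K (σ.g p) = lexKey (σ.M .buf) K (σ.g 0)).card) (4 * K + 5)
    (by omega) ?_ ?_ ?_ ?_ le_rfl
  · exact ⟨((St.Fr.refl _ _).set (by simp) _ _).set (by simp) _ _, rfl, rfl, by simp⟩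
  · rintro i τ ⟨h1, -⟩ -
    simp [h1 .sz (by simp), hN]
  · rintro i τ hi ⟨h1, h2, h3, h4⟩ hp
    have hbuf := h1 .buf (by simp)
    have hle : τ.M .g 0 ≤ i := by
      rw [h4]; exact (Finset.card_filter_le _ _).trans (by simp)
    refine seq (T₁ := 4 * K + 3) (T₂ := 2) (agree (r := 0) (hX.congr (h1 .kk (by simp)) hbuf)
      (by omega) (by simp) (by omega) (fun ρ k1 k2 k3 k4 k5 => ?_) le_rfl) le_rfl
    rw [hbuf, h2, hp] at k5
    have hp' := k1 .p (by simp)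
    have hg' := k1 .g (by simp)
    have f1 := h1.trans (k1.mono (ls := [.g, .p, .f, .c]) (by simp))
    refine ite (T₁ := 1) (by simp) (fun he => ?_) (fun he => ?_) le_rfl
    · simp only [Cd.holds_eq, Ex.val_get, Ex.val_ofNat, k5] at he
      refine put (by simp) (by simp) (by simp [hg']; omega) ⟨by simp [hp', hp],
        (f1.set (by simp) _ _).set (by simp) _ _, by simp [k2, h2], by simp [k3, h3], ?_⟩ le_rfl
      rw [Finset.range_add_one, Finset.filter_insert, if_pos he, Finset.card_insert_of_notMem
          (by simp), ← h4]
      simp [hg']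
    · simp only [Cd.holds_eq, Ex.val_get, Ex.val_ofNat, k5] at he
      refine skip ⟨by simp [hp', hp], f1.set (by simp) _ _, by simp [k2, h2], by simp [k3, h3], ?_⟩
        le_rfl
      rw [Finset.range_add_one, Finset.filter_insert, if_neg he, ← h4]
      simp [hg']
  · rintro τ ⟨h1, h2, h3, h4⟩ -
    exact hQ τ h1 h2 h3 h4

theorem gridTest {N G : ℕ} (hN : σ.M .sz 0 = N) (hn : N ≤ n) (hG : σ.M .g 0 = G)
    (hQ : ∀ τ, St.Fr [.ok, .p, .b, .q] σ τ → τ.g = σ.g → τ.out = σ.out → τ.M .ok 0 ≤ 1 →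
      (τ.M .ok 0 = 1 ↔ GridTest σ.g N m G {c | σ.M .lab c = σ.M .cl 0}) → Q τ)
    (hT : N * (6 * m + 4) + 4 ≤ T) : Runs ly ly.acc.gridTest σ T Q := by
  set R : ℕ → ℕ → Prop := fun p c =>
    (c ∈ {c | σ.M .lab c = σ.M .cl 0} → σ.g p c = σ.g (p - p % G) c) ∧
    (c ∉ {c | σ.M .lab c = σ.M .cl 0} → σ.g p c = σ.g (p % G) c) with hR
  -- The double loop is treated once, for both outcomes of the test of divisibility.
  have hmain : ∀ ρ, St.Fr [.ok, .p, .b, .q] σ ρ → ρ.g = σ.g → ρ.out = σ.out → ρ.M .ok 0 ≤ 1 →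
      (ρ.M .ok 0 = 1 ↔ N % G = 0) → Runs ly (ly.acc.forR .p 0 Nm.sz
    (ly.acc.forR .b 0 .arity
      (ly.acc.ite (.eq (.get .lab Nm.b) Nm.cl) (putr .q (.reg .p - .reg .p % .reg .g))
        (putr .q (.reg .p % .reg .g)) ;;
      ly.acc.ite (.veq Nm.p Nm.b Nm.q Nm.b) .skip (putr .ok 0)))) ρ (N * (6 * m + 4) + 2) Q := by
    intro ρ k1 k2 k3 k4 k5
    refine forC N (fun i τ => St.Fr [.ok, .p, .b, .q] σ τ ∧ τ.g = σ.g ∧ τ.out = σ.out ∧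
      τ.M .ok 0 ≤ 1 ∧ (τ.M .ok 0 = 1 ↔ N % G = 0 ∧ ∀ p < i, ∀ c < m, R p c)) (6 * m + 2)
      (by omega) ?_ ?_ ?_ ?_ le_rfl
    · exact ⟨k1.set (by simp) _ _, k2, k3, by simpa using k4, by simpa using k5⟩
    · rintro i τ ⟨h1, -⟩ -
      simp [h1 .sz (by simp), hN]
    · rintro i τ hi ⟨h1, h2, h3, h4, h5⟩ hp
      refine forC m (fun b τ => τ.M .p 0 = i ∧ St.Fr [.ok, .p, .b, .q] σ τ ∧ τ.g = σ.g ∧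
        τ.out = σ.out ∧ τ.M .ok 0 ≤ 1 ∧
        (τ.M .ok 0 = 1 ↔ (N % G = 0 ∧ ∀ p < i, ∀ c < m, R p c) ∧ ∀ c < b, R i c)) 4
        (by omega) ?_ ?_ ?_ ?_ (by omega)
      · exact ⟨by simp [hp], h1.set (by simp) _ _, h2, h3, by simpa using h4, by simpa using h5⟩
      · simp
      · rintro b τ hb ⟨h0, h1, h2, h3, h4, h5⟩ hbb
        have hlab := h1 .lab (by simp)
        have hcl := h1 .cl (by simp)
        have hg := h1 .g (by simp)
        have hstep : (∀ c < b + 1, R i c) ↔ (∀ c < b, R i c) ∧ R i b :=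
          ⟨fun h => ⟨fun p hp => h p (by omega), h b (by omega)⟩, fun h p hp => by
          rcases Nat.lt_succ_iff_lt_or_eq.1 hp with hp | rfl
          exacts [h.1 p hp, h.2]⟩
        have hfin : ∀ r, r ≤ i → (R i b ↔ σ.g i b = σ.g r b) →
            Runs ly (ly.acc.ite (.veq Nm.p Nm.b Nm.q Nm.b) .skip (putr .ok 0)) (τ.set .q 0 r) 2
            fun σ' => σ'.M .b 0 = b ∧ (σ'.set .b 0 (b + 1)).M .p 0 = i ∧
              St.Fr [.ok, .p, .b, .q] σ (σ'.set .b 0 (b + 1)) ∧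
              (σ'.set .b 0 (b + 1)).g = σ.g ∧ (σ'.set .b 0 (b + 1)).out = σ.out ∧
              (σ'.set .b 0 (b + 1)).M .ok 0 ≤ 1 ∧
              ((σ'.set .b 0 (b + 1)).M .ok 0 = 1 ↔
                (N % G = 0 ∧ ∀ p < i, ∀ c < m, R p c) ∧ ∀ c < b + 1, R i c) := by
          intro r hr hRr
          refine ite (T₁ := 1) (by simp [h0, hbb]; omega) (fun he => ?_) (fun he => ?_) le_rfl
          · simp [h0, hbb, h2] at he
            refine skip ⟨by simp [hbb], by simp [h0],
              (h1.set (by simp) _ _).set (by simp) _ _, h2, h3, by simpa using h4, ?_⟩ le_rfl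
            rw [hstep, hRr]
            simp [h5, he, and_assoc]
          · simp [h0, hbb, h2] at he
            refine put (by simp) (by simp) (by simp) ⟨by simp [hbb], by simp [h0],
              ((h1.set (by simp) _ _).set (by simp) _ _).set (by simp) _ _, h2, h3, by simp, ?_⟩
              le_rfl
            rw [hstep, hRr]
            simp [he]
        have hmodle := Nat.mod_le i G
        refine seq (T₁ := 2) (T₂ := 2) (ite (T₁ := 1) (by simp [hbb]; omega) (fun he => ?_)
          (fun he => ?_) le_rfl) le_rfl
        · simp only [Cd.holds_eq, Ex.val_get, Ex.val_ofNat, hlab, hcl, hbb] at he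
          refine put (by simp) (by simp) (by simp) ?_ le_rfl
          simp only [Ex.val_sub, Ex.val_mod, Ex.val_get, Ex.val_ofNat, h0, hg, hG]
          exact hfin _ (by omega) (by simp [hR, he])
        · simp only [Cd.holds_eq, Ex.val_get, Ex.val_ofNat, hlab, hcl, hbb] at he
          refine put (by simp) (by simp) (by simp) ?_ le_rfl
          simp only [Ex.val_mod, Ex.val_get, Ex.val_ofNat, h0, hg, hG]
          exact hfin _ hmodle (by simp [hR, he])
      · rintro τ ⟨h0, h1, h2, h3, h4, h5⟩ -
        refine ⟨h0, h1.set (by simp) _ _, h2, h3, by simpa using h4, ?_⟩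
        simp only [St.set_M_ne, ne_eq, reduceCtorEq, not_false_eq_true, h5, and_assoc]
        refine and_congr_right fun _ => ⟨fun h p hp => ?_, fun h =>
          ⟨fun p hp => h p (by omega), h i (by omega)⟩⟩
        rcases Nat.lt_succ_iff_lt_or_eq.1 hp with hp | rfl
        exacts [h.1 p hp, h.2]
    · rintro τ ⟨h1, h2, h3, h4, h5⟩ -
      exact hQ τ h1 h2 h3 h4 h5
  have f1 := (St.Fr.refl [.ok, .p, .b, .q] σ)
  refine seq (T₁ := 2) (T₂ := N * (6 * m + 4) + 2) (ite (T₁ := 1) (by simp) (fun he => ?_)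
    (fun he => ?_) le_rfl) (by omega)
  · simp [hN, hG] at he
    refine put (by simp) (by simp) (by simp) (hmain _ (f1.set (by simp) _ _) rfl rfl (by simp) ?_)
      le_rfl
    simp [he]
  · simp [hN, hG] at he
    refine put (by simp) (by simp) (by simp) (hmain _ (f1.set (by simp) _ _) rfl rfl (by simp) ?_)
      le_rfl
    simp [he]

end Runs

end PrimeFact

/-! ### Chains of selections, and the subroutines of a single selection -/

namespace PrimeFact

section Chain

variable {D : Type v}

theorem ConstAt.mono {ι : Type*} {S S' : Set (ι → D)} {a : ι} (h : ConstAt S a) (hs : S' ⊆ S) :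
    ConstAt S' a := fun s hs' t ht => h s (hs hs') t (hs ht)

theorem constAt_image_iff {g : ℕ → ℕ → D} {N c : ℕ} (hN : 0 < N) :
    ConstAt (g '' Set.Iio N) c ↔ ∀ p < N, g p c = g 0 c := by
  constructor
  · exact fun h p hp => h _ ⟨p, hp, rfl⟩ _ ⟨0, hN, rfl⟩
  · rintro h _ ⟨p, hp, rfl⟩ _ ⟨q, hq, rfl⟩
    rw [h p hp, h q hq]

/-- Successive selections `S 0 ⊇ S 1 ⊇ … ⊇ S j`, the `i`-th one in the column `stk i`; the numbers
`nn i` bound the sizes. -/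
structure Chain (m : ℕ) (S : ℕ → Set (ℕ → D)) (stk nn : ℕ → ℕ) (j : ℕ) : Prop where
  lt : ∀ i < j, stk i < m
  nonconst : ∀ i < j, ¬ ConstAt (S i) (stk i)
  select : ∀ i < j, ∃ v, (∃ r ∈ S i, r (stk i) = v) ∧ S (i + 1) = {s ∈ S i | s (stk i) = v}
  half : ∀ i < j, 2 * nn (i + 1) ≤ nn i
  pos : ∀ i ≤ j, 0 < nn i

/-- The labels of the columns after the selections: a column that became constant in the `i`-th
selection is labelled by the column of this selection. -/
def DownLab (m : ℕ) (S : ℕ → Set (ℕ → D)) (stk lab : ℕ → ℕ) (j : ℕ) : Prop :=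
  ∀ c < m, (¬ ConstAt (S j) c → lab c = c) ∧ (ConstAt (S 0) c → lab c = c) ∧
    ∀ i < j, ¬ ConstAt (S i) c → ConstAt (S (i + 1)) c → lab c = stk i

namespace Chain

variable {m : ℕ} {S S' : ℕ → Set (ℕ → D)} {stk stk' nn nn' : ℕ → ℕ} {j : ℕ}

theorem extend (h : Chain m S stk nn j) (hS : ∀ i ≤ j, S' i = S i) (hstk : ∀ i < j, stk' i = stk i)
    (hnn : ∀ i ≤ j, nn' i = nn i) (h₁ : stk' j < m) (h₂ : ¬ ConstAt (S j) (stk' j))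
    (h₃ : ∃ v, (∃ r ∈ S j, r (stk' j) = v) ∧ S' (j + 1) = {s ∈ S j | s (stk' j) = v})
    (h₄ : 2 * nn' (j + 1) ≤ nn j) (h₅ : 0 < nn' (j + 1)) : Chain m S' stk' nn' (j + 1) := by
  have hlt : ∀ i < j + 1, i = j ∨ i < j := fun i hi => by omega
  refine ⟨fun i hi => ?_, fun i hi => ?_, fun i hi => ?_, fun i hi => ?_, fun i hi => ?_⟩
  · rcases hlt i hi with rfl | hi
    exacts [h₁, by rw [hstk i hi]; exact h.lt i hi]
  · rcases hlt i hi with rfl | hi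
    · rwa [hS i le_rfl]
    · rw [hstk i hi, hS i hi.le]; exact h.nonconst i hi
  · rcases hlt i hi with rfl | hi
    · rwa [hS i le_rfl]
    · rw [hstk i hi, hS i hi.le, hS (i + 1) hi]; exact h.select i hi
  · rcases hlt i hi with rfl | hi
    · rwa [hnn i le_rfl]
    · rw [hnn i hi.le, hnn (i + 1) hi]; exact h.half i hi
  · rcases Nat.le_succ_iff.1 hi with hi | rfl
    exacts [by rw [hnn i hi]; exact h.pos i hi, h₅]

theorem anti (h : Chain m S stk nn j) {i k : ℕ} (hik : i ≤ k) (hk : k ≤ j) : S k ⊆ S i := by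
  induction k, hik using Nat.le_induction with
  | base => exact subset_rfl
  | succ k hik ih =>
    obtain ⟨v, -, hv⟩ := h.select k hk
    rw [hv]
    exact (Set.sep_subset _ _).trans (ih (by omega))

theorem constAt (h : Chain m S stk nn j) {i k : ℕ} (hik : i < k) (hk : k ≤ j) :
    ConstAt (S k) (stk i) := by
  obtain ⟨v, -, hv⟩ := h.select i (by omega)
  refine ConstAt.mono (S := S (i + 1)) ?_ (h.anti hik hk)
  rw [hv]
  exact fun s hs t ht => hs.2.trans ht.2.symm

/-- A selected column is constant from then on, so it is never selected again. -/
theorem stk_ne (h : Chain m S stk nn j) {i k : ℕ} (hik : i < k) (hk : k < j) : stk i ≠ stk k :=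
  fun he => h.nonconst k hk (he ▸ h.constAt hik hk.le)

theorem injOn (h : Chain m S stk nn j) : Set.InjOn stk (Set.Iio j) := by
  intro i hi k hk he
  rcases lt_trichotomy i k with h1 | h1 | h1
  exacts [absurd he (h.stk_ne h1 hk), h1, absurd he.symm (h.stk_ne h1 hi)]

theorem le_arity (h : Chain m S stk nn j) : j ≤ m := by
  have := Finset.card_le_card_of_injOn (s := Finset.range j) (t := Finset.range m) stk
    (fun i hi => by simpa using h.lt i (by simpa using hi))
    (fun i hi k hk he => h.injOn (by simpa using hi) (by simpa using hk) he)
  simpa using this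

theorem pow_le (h : Chain m S stk nn j) {i : ℕ} (hi : i ≤ j) : 2 ^ i * nn i ≤ nn 0 := by
  induction i with
  | zero => simp
  | succ i ih =>
    refine le_trans ?_ (ih (by omega))
    rw [pow_succ, mul_assoc]
    exact Nat.mul_le_mul_left _ (h.half i hi)

theorem nn_anti (h : Chain m S stk nn j) {i k : ℕ} (hik : i ≤ k) (hk : k ≤ j) : nn k ≤ nn i := by
  induction k, hik using Nat.le_induction with
  | base => exact le_rfl
  | succ k hik ih =>
    have := h.half k hk
    have := ih (by omega)
    omega

theorem le_zero (h : Chain m S stk nn j) {i : ℕ} (hi : i ≤ j) : nn i ≤ nn 0 :=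
  le_trans (Nat.le_mul_of_pos_left _ (by positivity)) (h.pow_le hi)

theorem sum_le (h : Chain m S stk nn j) : ∑ i ∈ Finset.range j, nn i ≤ 2 * nn 0 := by
  -- The additional term `2 * nn k` is what the halving at the next level consumes.
  have : ∀ k ≤ j, ∑ i ∈ Finset.range k, nn i + 2 * nn k ≤ 2 * nn 0 := by
    intro k
    induction k with
    | zero => simp
    | succ k ih =>
      intro hk
      rw [Finset.sum_range_succ]
      have := ih (by omega)
      have := h.half k hk
      omega
  have := this j le_rfl
  omega

theorem le_log (h : Chain m S stk nn j) : j ≤ Nat.log 2 (nn 0 + 1) := by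
  have h1 := h.pow_le le_rfl
  have h2 := h.pos j le_rfl
  refine Nat.le_log_of_pow_le (by norm_num) ?_
  have : 2 ^ j ≤ 2 ^ j * nn j := Nat.le_mul_of_pos_right _ h2
  omega

end Chain

theorem DownLab.extend {m : ℕ} {S S' : ℕ → Set (ℕ → D)} {stk stk' lab lab' : ℕ → ℕ} {j : ℕ}
    (h : DownLab m S stk lab j) (hS : ∀ i ≤ j, S' i = S i) (hstk : ∀ i < j, stk' i = stk i)
    (hanti : ∀ i ≤ j, S j ⊆ S i) (hsub : S' (j + 1) ⊆ S j)
    (h₁ : ∀ c < m, ¬ ConstAt (S j) c → ConstAt (S' (j + 1)) c → lab' c = stk' j)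
    (h₂ : ∀ c < m, ¬ (¬ ConstAt (S j) c ∧ ConstAt (S' (j + 1)) c) → lab' c = lab c) :
    DownLab m S' stk' lab' (j + 1) := by
  intro c hc
  obtain ⟨k1, k2, k3⟩ := h c hc
  refine ⟨fun hn => ?_, fun h0 => ?_, fun i hi hn hcon => ?_⟩
  · rw [h₂ c hc fun h => hn h.2]
    exact k1 fun h => hn (h.mono hsub)
  · rw [hS 0 (by omega)] at h0
    rw [h₂ c hc fun h => h.1 (h0.mono (hanti 0 (by omega)))]
    exact k2 h0
  · rcases Nat.lt_succ_iff_lt_or_eq.1 hi with hi | rfl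
    · rw [hS i (by omega)] at hn
      rw [hS (i + 1) (by omega)] at hcon
      rw [h₂ c hc fun h => h.1 (hcon.mono (hanti (i + 1) (by omega))), hstk i hi]
      exact k3 i hi hn hcon
    · rw [hS i le_rfl] at hn
      exact h₁ c hc hn hcon

end Chain

variable {A : Type u} {D : Type v} [LinearOrder D] {m n : ℕ} {κ : Type w} [LinearOrder κ]

namespace Acc

variable (acc : Acc)

/-- Finds a column `a` that is not constant below `sz`; `ok` tells whether there is one. -/
def pick : Stmt :=
  putr Nm.ok 0 ;;
  acc.forR Nm.b 0 .arity (acc.nonconst Nm.sz ;; acc.ite (.eq Nm.f 1) (putr Nm.ok 1 ;; putr Nm.a Nm.b) .skip)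

/-- Moves a row to the front whose value in column `a` occurs in at most half of the rows. -/
def pivot : Stmt :=
  putr Nm.g 0 ;;
  acc.forR Nm.p 0 Nm.sz (acc.ite (.veq Nm.p Nm.a 0 Nm.a) (putr Nm.g (.reg Nm.g + 1)) (putr Nm.q Nm.p)) ;;
  acc.ite (.lt Nm.sz (.reg Nm.g + .reg Nm.g)) (acc.exch 0 Nm.q) .skip

/-- Moves the rows that agree with the first one in column `a` to the front, counting them in
`g`. -/
def partition : Stmt :=
  putr Nm.g 0 ;;
  acc.forR Nm.p 0 Nm.sz
    (acc.ite (.veq Nm.p Nm.a 0 Nm.a) (acc.exch Nm.g Nm.p ;; putr Nm.g (.reg Nm.g + 1)) .skip)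

/-- Labels by `a` the columns that are constant below `g`, but not below `sz`. -/
def mark : Stmt :=
  acc.forR Nm.b 0 .arity
    (acc.nonconst Nm.sz ;; putr Nm.v Nm.f ;; acc.nonconst Nm.g ;;
      acc.ite (.and (.eq Nm.v 1) (.eq Nm.f 0)) (put Nm.lab Nm.b Nm.a) .skip)

/-- One selection. -/
def downStep : Stmt :=
  putr Nm.sz (.get Nm.nn Nm.lv) ;; acc.pick ;;
  acc.ite (.eq Nm.ok 1)
    (acc.pivot ;; acc.partition ;; put Nm.stk Nm.lv Nm.a ;; acc.mark ;; putr Nm.lv (.reg Nm.lv + 1) ;;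
      put Nm.nn Nm.lv Nm.g)
    .skip

/-- The selections. -/
def down : Stmt :=
  acc.forR Nm.b 0 .arity (put Nm.lab Nm.b Nm.b) ;; put Nm.nn 0 .size ;; putr Nm.lv 0 ;; putr Nm.ok 1 ;;
  acc.loopW (.eq Nm.ok 1) acc.downStep ;; putr Nm.w Nm.lv

end Acc

namespace Runs

variable {ly : Layer A D m n κ} {σ : St A D m n} {Q : St A D m n → Prop} {T : ℕ}

theorem pick {N : ℕ} (hN : σ.M .sz 0 = N) (hn : N ≤ n)
    (hQ : ∀ τ, St.Fr [.ok, .b, .f, .p, .a] σ τ → τ.g = σ.g → τ.out = σ.out → τ.M .ok 0 ≤ 1 →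
      (τ.M .ok 0 = 0 → ∀ c < m, ∀ p < N, σ.g p c = σ.g 0 c) →
      (τ.M .ok 0 = 1 → τ.M .a 0 < m ∧ ¬ ∀ p < N, σ.g p (τ.M .a 0) = σ.g 0 (τ.M .a 0)) → Q τ)
    (hT : m * (4 * N + 8) + 3 ≤ T) : Runs ly ly.acc.pick σ T Q := by
  refine seq (T₁ := 1) (T₂ := m * (4 * N + 8) + 2) (put (by simp) (by simp) (by simp) ?_ le_rfl)
    (by omega)
  simp only [Ex.val_ofNat]
  refine forC m (fun i τ => St.Fr [.ok, .b, .f, .p, .a] σ τ ∧ τ.g = σ.g ∧ τ.out = σ.out ∧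
    τ.M .ok 0 ≤ 1 ∧ (τ.M .ok 0 = 0 → ∀ c < i, ∀ p < N, σ.g p c = σ.g 0 c) ∧
    (τ.M .ok 0 = 1 → τ.M .a 0 < m ∧ ¬ ∀ p < N, σ.g p (τ.M .a 0) = σ.g 0 (τ.M .a 0)))
    (4 * N + 6) (by omega) ?_ ?_ ?_ ?_ le_rfl
  · exact ⟨((St.Fr.refl _ _).set (by simp) _ _).set (by simp) _ _, rfl, rfl, by simp, by simp,
      by simp⟩
  · simp
  · rintro i τ hi ⟨h1, h2, h3, h4, h5, h6⟩ hb
    have hsz := h1 .sz (by simp)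
    refine seq (T₁ := 4 * N + 3) (T₂ := 3) (nonconst (N := N) (by simp) (by rw [hsz, hN]) hn
      (by omega) (fun ρ k1 k2 k3 k4 k5 => ?_) le_rfl) le_rfl
    rw [hb, h2] at k5
    have f1 := h1.trans (k1.mono (ls := [.ok, .b, .f, .p, .a]) (by simp))
    have hb' := k1 .b (by simp)
    have hok := k1 .ok (by simp)
    have ha := k1 .a (by simp)
    refine ite (T₁ := 2) (by simp) (fun hc => ?_) (fun hc => ?_) le_rfl
    · simp only [Cd.holds_eq, Ex.val_get, Ex.val_ofNat] at hc
      refine seq (T₁ := 1) (T₂ := 1) (put (by simp) (by simp) (by simp) ?_ le_rfl) le_rfl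
      refine put (by simp) (by simp) (by simp) ⟨by simp [hb', hb],
        ((f1.set (by simp) _ _).set (by simp) _ _).set (by simp) _ _, by simp [k2, h2],
        by simp [k3, h3], by simp, by simp, fun _ => ?_⟩ le_rfl
      simp only [Ex.val_get, Ex.val_ofNat, St.set_M_ne, St.set_M_same, ne_eq, reduceCtorEq,
        not_false_eq_true, if_true, hb', hb]
      exact ⟨hi, fun h => by have := k5.2 h; omega⟩
    · simp only [Cd.holds_eq, Ex.val_get, Ex.val_ofNat] at hc
      refine skip ⟨by simp [hb', hb], f1.set (by simp) _ _, by simp [k2, h2],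
        by simp [k3, h3], by simpa [hok] using h4, ?_, by simpa [hok, ha] using h6⟩ (by omega)
      simp only [St.set_M_ne, ne_eq, reduceCtorEq, not_false_eq_true, hok]
      intro h c hc'
      rcases Nat.lt_succ_iff_lt_or_eq.1 hc' with hc' | rfl
      · exact h5 h c hc'
      · exact k5.1 (by omega)
  · rintro τ ⟨h1, h2, h3, h4, h5, h6⟩ -
    exact hQ τ h1 h2 h3 h4 h5 h6

theorem card_filter_perm {α : Type*} {N : ℕ} {g g' : ℕ → α} (h : PermBelow N g g') (P : α → Prop)
    [DecidablePred P] : ((Finset.range N).filter fun p => P (g' p)).card =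
      ((Finset.range N).filter fun p => P (g p)).card := by
  have key : ∀ g g' : ℕ → α, PermBelow N g g' → ((Finset.range N).filter fun p => P (g' p)).card ≤
      ((Finset.range N).filter fun p => P (g p)).card := by
    rintro g g' ⟨π, h1, rfl⟩
    refine Finset.card_le_card_of_injOn π (fun p hp => ?_) (π.injective.injOn)
    have hp := Finset.mem_filter.1 hp
    refine Finset.mem_filter.2 ⟨Finset.mem_range.2 ?_, hp.2⟩
    by_contra hn
    have := π.injective (h1 (π p) (by omega))
    have := Finset.mem_range.1 hp.1
    omega
  exact le_antisymm (key _ _ h) (key _ _ h.symm)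

/-- Two different values cannot both occur in more than half of the rows. If the value of the first
row does, any row `q` with another value can replace it. -/
theorem pivot {N : ℕ} (hN : σ.M .sz 0 = N) (hn : N ≤ n) (hN0 : 0 < N) (ha : σ.M .a 0 < m)
    (hnc : ¬ ∀ p < N, σ.g p (σ.M .a 0) = σ.g 0 (σ.M .a 0))
    (hQ : ∀ τ, St.Fr [.g, .p, .q] σ τ → PermBelow N σ.g τ.g → τ.out = σ.out →
      2 * ((Finset.range N).filter fun p => τ.g p (σ.M .a 0) = τ.g 0 (σ.M .a 0)).card ≤ N → Q τ)
    (hT : 4 * N + ly.ws + 5 ≤ T) : Runs ly ly.acc.pivot σ T Q := by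
  set a := σ.M .a 0 with ha'
  refine seq (T₁ := 1) (T₂ := 4 * N + ly.ws + 4) (put (by simp) (by simp) (by simp) ?_ le_rfl)
    (by omega)
  simp only [Ex.val_ofNat]
  refine seq (T₁ := 4 * N + 2) (T₂ := ly.ws + 2) ?_ (by omega)
  refine forC N (fun i τ => St.Fr [.g, .p, .q] σ τ ∧ τ.g = σ.g ∧ τ.out = σ.out ∧
    τ.M .g 0 = ((Finset.range i).filter fun p => σ.g p a = σ.g 0 a).card ∧
    ((¬ ∀ p < i, σ.g p a = σ.g 0 a) → τ.M .q 0 < N ∧ σ.g (τ.M .q 0) a ≠ σ.g 0 a)) 2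
    (by omega) ?_ ?_ ?_ ?_ (by omega)
  · exact ⟨((St.Fr.refl _ _).set (by simp) _ _).set (by simp) _ _, rfl, rfl, by simp, by simp⟩
  · rintro i τ ⟨h1, -⟩ -
    simp [h1 .sz (by simp), hN]
  · rintro i τ hi ⟨h1, h2, h3, h4, h5⟩ hp
    have hA := h1 .a (by simp)
    have hle : τ.M .g 0 ≤ i := by
      rw [h4]; exact (Finset.card_filter_le _ _).trans (by simp)
    refine ite (T₁ := 1) (by simp [hp, hA]; omega) (fun hc => ?_) (fun hc => ?_) le_rfl
    · simp only [Cd.holds_veq, Ex.val_get, Ex.val_ofNat, hp, hA, h2, ← ha'] at hc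
      refine put (by simp) (by simp) (by simp; omega) ⟨by simp [hp],
        (h1.set (by simp) _ _).set (by simp) _ _, h2, h3, ?_, ?_⟩ le_rfl
      · rw [Finset.range_add_one, Finset.filter_insert, if_pos hc, Finset.card_insert_of_notMem
          (by simp), ← h4]
        simp
      · intro hnot
        simp only [St.set_M_ne, ne_eq, reduceCtorEq, not_false_eq_true]
        refine h5 fun h => hnot fun p hp => ?_
        rcases Nat.lt_succ_iff_lt_or_eq.1 hp with hp | rfl
        exacts [h p hp, hc]
    · simp only [Cd.holds_veq, Ex.val_get, Ex.val_ofNat, hp, hA, h2, ← ha'] at hc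
      refine put (by simp) (by simp) (by simp) ⟨by simp [hp],
        (h1.set (by simp) _ _).set (by simp) _ _, h2, h3, ?_, ?_⟩ le_rfl
      · rw [Finset.range_add_one, Finset.filter_insert, if_neg hc, ← h4]
        simp
      · intro _
        simp [hp, hi, hc]
  · rintro τ ⟨h1, h2, h3, h4, h5⟩ -
    obtain ⟨hq, hq'⟩ := h5 hnc
    have hle : τ.M .g 0 ≤ N := by
      rw [h4]; exact (Finset.card_filter_le _ _).trans (by simp)
    have hsz := h1 .sz (by simp)
    refine ite (T₁ := ly.ws + 1) (by simp; omega) (fun hc => ?_) (fun hc => ?_) (by omega)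
    · simp only [Cd.holds_lt, Ex.val_add, Ex.val_get, Ex.val_ofNat, hsz, hN] at hc
      have hper : PermBelow N σ.g (σ.g ∘ Equiv.swap 0 (τ.M .q 0)) := PermBelow.swap _ hN0 hq
      refine exch (by simp) (by simp) (by simp; omega) (by simp; omega) (hQ _ h1 ?_ h3 ?_)
        (by omega)
      · simpa [h2] using hper
      · have hval : (σ.g ∘ Equiv.swap 0 (τ.M .q 0)) 0 = σ.g (τ.M .q 0) := by simp
        simp only [Ex.val_get, Ex.val_ofNat, St.swap_g, h2, hval]
        rw [card_filter_perm hper fun s => s a = σ.g (τ.M .q 0) a]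
        have h6 := Finset.card_union_of_disjoint
          (s := (Finset.range N).filter fun p => σ.g p a = σ.g 0 a)
          (t := (Finset.range N).filter fun p => σ.g p a = σ.g (τ.M .q 0) a)
          (Finset.disjoint_filter.2 fun p _ e1 e2 => hq' (e2.symm.trans e1))
        have h7 := Finset.card_le_card (Finset.union_subset
          (Finset.filter_subset (fun p => σ.g p a = σ.g 0 a) (Finset.range N))
          (Finset.filter_subset (fun p => σ.g p a = σ.g (τ.M .q 0) a) (Finset.range N)))
        rw [Finset.card_range] at h7
        omega
    · simp only [Cd.holds_lt, Ex.val_add, Ex.val_get, Ex.val_ofNat, hsz, hN] at hc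
      refine skip (hQ _ h1 (h2 ▸ PermBelow.refl _ _) h3 ?_) (by omega)
      rw [h2]
      omega

/-- Rows before `g` have the value sought, those from `g` up to the current one do not, and later
rows are untouched. Row 0 can serve as reference throughout, because exchanges never change its
value in column `a`. -/
theorem partition {N : ℕ} (hN : σ.M .sz 0 = N) (hn : N ≤ n) (hN0 : 0 < N) (ha : σ.M .a 0 < m)
    (hQ : ∀ τ, St.Fr [.g, .p] σ τ → PermBelow N σ.g τ.g → τ.out = σ.out →
      τ.M .g 0 =
        ((Finset.range N).filter fun p => σ.g p (σ.M .a 0) = σ.g 0 (σ.M .a 0)).card →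
      τ.g '' Set.Iio (τ.M .g 0) =
        {s ∈ σ.g '' Set.Iio N | s (σ.M .a 0) = σ.g 0 (σ.M .a 0)} → Q τ)
    (hT : N * (ly.ws + 4) + 3 ≤ T) : Runs ly ly.acc.partition σ T Q := by
  set a := σ.M .a 0 with ha'
  refine seq (T₁ := 1) (T₂ := N * (ly.ws + 4) + 2) (put (by simp) (by simp) (by simp) ?_ le_rfl)
    (by omega)
  simp only [Ex.val_ofNat]
  refine forC N (fun i τ => St.Fr [.g, .p] σ τ ∧ PermBelow N σ.g τ.g ∧ τ.out = σ.out ∧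
    τ.M .g 0 = ((Finset.range i).filter fun p => σ.g p a = σ.g 0 a).card ∧ τ.M .g 0 ≤ i ∧
    (∀ p < τ.M .g 0, τ.g p a = σ.g 0 a) ∧ (∀ p, τ.M .g 0 ≤ p → p < i → τ.g p a ≠ σ.g 0 a) ∧
    τ.g 0 a = σ.g 0 a ∧ ∀ p, i ≤ p → τ.g p = σ.g p) (ly.ws + 2)
    (by omega) ?_ ?_ ?_ ?_ le_rfl
  · exact ⟨((St.Fr.refl _ _).set (by simp) _ _).set (by simp) _ _, PermBelow.refl _ _, rfl,
      by simp, by simp, by simp, by simp, rfl, by simp⟩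
  · rintro i τ ⟨h1, -⟩ -
    simp [h1 .sz (by simp), hN]
  · rintro i τ hi ⟨h1, h2, h3, h4, h5, h6, h7, h8, h9⟩ hp
    have hA := h1 .a (by simp)
    refine ite (T₁ := ly.ws + 1) (by simp [hp, hA]; omega) (fun hc => ?_) (fun hc => ?_) le_rfl
    · simp only [Cd.holds_veq, Ex.val_get, Ex.val_ofNat, hp, hA, ← ha', h8, h9 i le_rfl] at hc
      refine seq (T₁ := ly.ws) (T₂ := 1) (exch (by simp) (by simp) (by simp; omega)
        (by simp; omega) ?_ le_rfl) le_rfl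
      simp only [Ex.val_get, Ex.val_ofNat, hp]
      set k := τ.M .g 0 with hk
      have hi' : τ.g i a = σ.g 0 a := by rw [h9 i le_rfl, hc]
      have hk' : (τ.g ∘ Equiv.swap k i) k a = σ.g 0 a := by simpa using hi'
      have hlt : ∀ p < k, (τ.g ∘ Equiv.swap k i) p = τ.g p := fun p hp => by
        simp only [Function.comp]; rw [Equiv.swap_apply_of_ne_of_ne (by omega) (by omega)]
      refine put (by simp) (by simp) (by simp; omega) ?_ le_rfl
      simp only [Ex.val_get, Ex.val_ofNat, Ex.val_add, St.swap_M, ← hk]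
      refine ⟨by simp [hp], (St.Fr.set (τ := τ.swap k i) h1 (by simp) _ _).set (by simp) _ _,
        h2.trans (PermBelow.swap _ (by omega) hi), h3, ?_, by simp; omega, ?_, ?_, ?_, ?_⟩
      · rw [Finset.range_add_one, Finset.filter_insert, if_pos hc, Finset.card_insert_of_notMem
          (by simp), ← h4]
        simp
      · intro p hpk
        simp only [St.set_M_ne, St.set_M_same, ne_eq, reduceCtorEq, not_false_eq_true,
          if_true] at hpk
        rcases Nat.lt_succ_iff_lt_or_eq.1 hpk with hpk | rfl
        · simp only [St.set_g, St.swap_g, hlt p hpk]; exact h6 p hpk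
        · exact hk'
      · intro p hpk hpi
        simp only [St.set_M_ne, St.set_M_same, ne_eq, reduceCtorEq, not_false_eq_true,
          if_true] at hpk
        simp only [St.set_g, St.swap_g, Function.comp]
        by_cases hpi' : p = i
        · subst hpi'
          rw [Equiv.swap_apply_right]
          exact h7 k le_rfl (by omega)
        · rw [Equiv.swap_apply_of_ne_of_ne (by omega) hpi']
          exact h7 p (by omega) (by omega)
      · simp only [St.set_g, St.swap_g]
        by_cases hk0 : k = 0
        · rw [← hk0]; rw [← hk0] at hk'; convert hk' using 2
        · rw [hlt 0 (by omega), h8]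
      · intro p hpi
        simp only [St.set_g, St.swap_g, Function.comp]
        rw [Equiv.swap_apply_of_ne_of_ne (by omega) (by omega)]
        exact h9 p (by omega)
    · simp only [Cd.holds_veq, Ex.val_get, Ex.val_ofNat, hp, hA, ← ha', h8, h9 i le_rfl] at hc
      refine skip ⟨hp, h1.set (by simp) _ _, h2, h3, ?_, by simp; omega, by simpa using h6, ?_, h8,
        fun p hp => h9 p (by omega)⟩ (by omega)
      · rw [Finset.range_add_one, Finset.filter_insert, if_neg hc, ← h4]
        simp
      · simp only [St.set_M_ne, ne_eq, reduceCtorEq, not_false_eq_true, St.set_g]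
        intro p hp hpi
        rcases Nat.lt_succ_iff_lt_or_eq.1 hpi with hpi | rfl
        · exact h7 p hp hpi
        · rw [h9 p le_rfl]; exact hc
  · rintro τ ⟨h1, h2, h3, h4, h5, h6, h7, h8, h9⟩ -
    refine hQ τ h1 h2 h3 h4 ?_
    rw [← h2.image_eq le_rfl]
    ext s
    constructor
    · rintro ⟨p, hp, rfl⟩
      exact ⟨⟨p, lt_of_lt_of_le hp h5, rfl⟩, h6 p hp⟩
    · rintro ⟨⟨p, hp, rfl⟩, hs⟩
      refine ⟨p, ?_, rfl⟩
      by_contra hn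
      exact h7 p (not_lt.1 hn) hp hs

theorem mark {N G : ℕ} (hN : σ.M .sz 0 = N) (hn : N ≤ n) (hG : σ.M .g 0 = G) (hGN : G ≤ N)
    (hQ : ∀ τ, St.Fr [.b, .f, .p, .v, .lab] σ τ → τ.g = σ.g → τ.out = σ.out →
      (∀ c < m, (¬ ∀ p < N, σ.g p c = σ.g 0 c) → (∀ p < G, σ.g p c = σ.g 0 c) →
        τ.M .lab c = σ.M .a 0) →
      (∀ c < m, ¬ ((¬ ∀ p < N, σ.g p c = σ.g 0 c) ∧ (∀ p < G, σ.g p c = σ.g 0 c)) →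
        τ.M .lab c = σ.M .lab c) → Q τ)
    (hT : m * (8 * N + 11) + 2 ≤ T) : Runs ly ly.acc.mark σ T Q := by
  classical
  refine forC m (fun i τ => St.Fr [.b, .f, .p, .v, .lab] σ τ ∧ τ.g = σ.g ∧ τ.out = σ.out ∧
    ∀ c, τ.M .lab c = if c < i ∧ (¬ ∀ p < N, σ.g p c = σ.g 0 c) ∧ ∀ p < G, σ.g p c = σ.g 0 c
      then σ.M .a 0 else σ.M .lab c) (8 * N + 9) (by omega) ?_ ?_ ?_ ?_ hT
  · exact ⟨(St.Fr.refl _ _).set (by simp) _ _, rfl, rfl, by simp⟩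
  · simp
  · rintro i τ hi ⟨h1, h2, h3, h4⟩ hb
    have hsz := h1 .sz (by simp)
    have hg := h1 .g (by simp)
    have ha := h1 .a (by simp)
    refine seq (T₁ := 4 * N + 3) (T₂ := 4 * N + 6) (nonconst (N := N) (by simp)
      (by rw [hsz, hN]) hn (by omega) (fun ρ k1 k2 k3 k4 k5 => ?_) le_rfl) (by omega)
    rw [hb, h2] at k5
    refine seq (T₁ := 1) (T₂ := 4 * N + 5) (put (by simp) (by simp) (by simp) ?_ le_rfl)
      (by omega)
    simp only [Ex.val_get, Ex.val_ofNat]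
    have k6 := k1 .b (by simp)
    have k7 := k1 .g (by simp)
    refine seq (T₁ := 4 * N + 3) (T₂ := 2) (nonconst (N := G) (by simp)
      (by simp [k7, hg, hG]) (by omega) (by simp [k6]; omega)
      (fun ρ' l1 l2 l3 l4 l5 => ?_) (by omega)) (by omega)
    simp [k6, k2, hb, h2] at l5
    have f1 : St.Fr [.b, .f, .p, .v, .lab] σ ρ' := ((h1.trans (k1.mono (by simp))).set
      (by simp) _ _).trans (l1.mono (by simp))
    have m1 := l1 .lab (by simp)
    have m2 := l1 .v (by simp)
    have m3 := l1 .b (by simp)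
    have m4 := l1 .a (by simp)
    have m5 := k1 .lab (by simp)
    have m6 := k1 .a (by simp)
    simp at m1 m2 m3 m4
    refine ite (T₁ := 1) (by simp) (fun hc => ?_) (fun hc => ?_) le_rfl
    · simp [m2] at hc
      refine put (by simp) (by simp [m3, k6]; omega) (by simp) ⟨by simp [m3, k6, hb],
        (f1.set (by simp) _ _).set (by simp) _ _, by simp [l2, k2, h2], by simp [l3, k3, h3],
        fun c => ?_⟩ le_rfl
      have hnc : ¬ ∀ p < N, σ.g p i = σ.g 0 i := fun h => by have := k5.2 h; omega
      simp only [Ex.val_get, Ex.val_ofNat, St.set_M_ne, St.set_M_same, ne_eq, reduceCtorEq,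
        not_false_eq_true, m3, k6, hb, m4, m6, ha, m1, m5, h4]
      by_cases hci : c = i
      · subst hci
        simp only [if_true]
        rw [if_pos ⟨by omega, hnc, l5.1 hc.2⟩]
      · have : c < i + 1 ↔ c < i := by omega
        simp [this, hci]
    · simp only [Cd.holds_and, Cd.holds_eq, Ex.val_get, Ex.val_ofNat, m2, St.set_M_same,
        if_true] at hc
      refine skip ⟨by simp [m3, k6, hb], f1.set (by simp) _ _, by simp [l2, k2, h2],
        by simp [l3, k3, h3], fun c => ?_⟩ (by omega)
      simp only [St.set_M_ne, ne_eq, reduceCtorEq, not_false_eq_true, m1, m5, h4]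
      by_cases hci : c = i
      · subst hci
        simp only [lt_irrefl, false_and, if_false]
        rw [if_neg]
        rintro ⟨-, e1, e2⟩
        refine hc ⟨?_, l5.2 e2⟩
        have : ρ.M .f 0 ≠ 0 := fun h => e1 (k5.1 h)
        omega
      · have : c < i + 1 ↔ c < i := by omega
        simp [this]
  · rintro τ ⟨h1, h2, h3, h4⟩ -
    refine hQ τ h1 h2 h3 (fun c hc e1 e2 => ?_) (fun c hc e => ?_)
    · rw [h4, if_pos ⟨hc, e1, e2⟩]
    · rw [h4, if_neg fun h => e h.2]

end Runs

end PrimeFact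

/-! ### The descent: selections until all columns are constant -/

namespace PrimeFact

variable {A : Type u} {D : Type v} [LinearOrder D] {m n : ℕ} {κ : Type w} [LinearOrder κ]

/-- The state after `j` selections. -/
structure DownInv (σ τ : St A D m n) (j : ℕ) : Prop where
  perm : PermBelow n σ.g τ.g
  out : τ.out = σ.out
  lv : τ.M .lv 0 = j
  nn : τ.M .nn 0 = n
  chain : Chain m (fun i => τ.g '' Set.Iio (τ.M .nn i)) (τ.M .stk) (τ.M .nn) j
  lab : DownLab m (fun i => τ.g '' Set.Iio (τ.M .nn i)) (τ.M .stk) (τ.M .lab) j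

namespace Runs

variable {ly : Layer A D m n κ} {σ : St A D m n} {Q : St A D m n → Prop} {T : ℕ}

/-- Every selection is a prefix of the rearranged table, so it is stored by its length alone.
Rearranging the current prefix changes none of the longer prefixes as sets. -/
theorem downStep {τ : St A D m n} {j N : ℕ} (h : DownInv σ τ j) (hN : τ.M .nn j = N) (hm : 0 < m)
    (hT : N * (57 * m + 2 * ly.ws) ≤ T) :
    Runs ly ly.acc.downStep τ T fun ρ =>
      (ρ.M .ok 0 = 1 ∧ DownInv σ ρ (j + 1) ∧ 2 * ρ.M .nn (j + 1) ≤ N) ∨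
      (ρ.M .ok 0 = 0 ∧ DownInv σ ρ j ∧ ∀ c < m, ConstAt (ρ.g '' Set.Iio (ρ.M .nn j)) c) := by
  obtain ⟨h1, h2, h3, h4, h5, h6⟩ := h
  have hjm := h5.le_arity
  have hN0 : 0 < N := hN ▸ h5.pos j le_rfl
  have hNn : N ≤ n := by have := h5.le_zero (le_refl j); omega
  have hT' : 1 + ((m * (4 * N + 8) + 3) + (1 + ((4 * N + ly.ws + 5) + ((N * (ly.ws + 4) + 3) +
      (1 + ((m * (8 * N + 11) + 2) + (1 + 1))))))) ≤ T := by
    refine le_trans ?_ hT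
    obtain ⟨a, rfl⟩ := Nat.exists_eq_add_of_lt hm
    obtain ⟨b, rfl⟩ := Nat.exists_eq_add_of_lt hN0
    nlinarith [Nat.zero_le (a * b), Nat.zero_le (b * ly.ws)]
  refine seq (put (by simp) (by simp) (by simp [h3, hjm]) ?_ le_rfl) hT'
  simp only [Ex.val_get, Ex.val_ofNat, h3, hN]
  refine seq (pick (N := N) (by simp) hNn (fun ρ1 k1 k2 k3 k4 k5 k6 => ?_) le_rfl) le_rfl
  simp only [St.set_g] at k2 k5 k6
  have f1 : St.Fr [.sz, .ok, .b, .f, .p, .a] τ ρ1 :=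
    ((St.Fr.refl _ _).set (by simp) _ _).trans (k1.mono (by simp))
  refine ite (by simp) (fun hc => ?_) (fun hc => ?_) (by omega)
    (T₁ := (4 * N + ly.ws + 5) + ((N * (ly.ws + 4) + 3) +
      (1 + ((m * (8 * N + 11) + 2) + (1 + 1)))))
  · simp only [Cd.holds_eq, Ex.val_get, Ex.val_ofNat] at hc
    obtain ⟨ha, hnc⟩ := k6 hc
    have hsz := k1 .sz (by simp)
    refine seq (pivot (N := N) (by simp [hsz]) hNn hN0 ha (by simpa [k2] using hnc)
      (fun ρ2 l1 l2 l3 l4 => ?_) le_rfl) le_rfl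
    have hsz2 := l1 .sz (by simp)
    have ha2 := l1 .a (by simp)
    refine seq (partition (N := N) (by simp [hsz, hsz2]) hNn hN0 (by simpa [ha2])
      (fun ρ3 m1 m2 m3 m4 m5 => ?_) le_rfl) le_rfl
    rw [ha2] at m4 m5
    rw [← m4] at l4
    have f2 : St.Fr [.sz, .ok, .b, .f, .p, .a, .g, .q] τ ρ3 :=
      (f1.mono (by simp)).trans ((l1.mono (by simp)).trans (m1.mono (by simp)))
    have hlv3 := f2 .lv (by simp)
    have ha3 := m1 .a (by simp)
    have hok3 := (m1 .ok (by simp)).trans (l1 .ok (by simp))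
    refine seq (put (by simp) (by simp [hlv3, h3, hjm]) (by simp) ?_ le_rfl) le_rfl
    simp only [Ex.val_get, Ex.val_ofNat, hlv3, h3, ha3, ha2]
    set a := ρ1.M .a 0 with ha'
    set G := ρ3.M .g 0 with hG
    have hsz3 := m1 .sz (by simp)
    have hGN : G ≤ N := by omega
    have hG0 : 0 < G := by
      rw [m4]
      exact Finset.card_pos.2 ⟨0, Finset.mem_filter.2 ⟨Finset.mem_range.2 hN0, rfl⟩⟩
    refine seq (mark (N := N) (G := G) (by simp [hsz, hsz2, hsz3]) hNn (by simp [hG]) hGN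
      (fun ρ4 q1 q2 q3 q4 q5 => ?_) le_rfl) le_rfl
    simp only [St.set_g, St.set_M_ne, ne_eq, reduceCtorEq, not_false_eq_true, ha3, ha2] at q2 q4 q5
    have hlv4 := q1 .lv (by simp)
    refine seq (put (by simp) (by simp) (by simp [hlv4, hlv3, h3]; omega) ?_ le_rfl) le_rfl
    simp only [Ex.val_get, Ex.val_ofNat, Ex.val_add, hlv4, St.set_M_ne, ne_eq, reduceCtorEq,
      not_false_eq_true, hlv3, h3]
    -- the arrays in the final state
    have hper : PermBelow N τ.g ρ3.g := by
      have := l2.trans m2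
      rwa [k2] at this
    have hnn4 : ρ4.M .nn = τ.M .nn := by rw [q1 .nn (by simp)]; simp [f2 .nn (by simp)]
    have hstk4 : ∀ i, ρ4.M .stk i = if i = j then a else τ.M .stk i := fun i => by
      rw [q1 .stk (by simp)]; simp [f2 .stk (by simp)]
    have hlab3 := f2 .lab (by simp)
    have hg4 := q1 .g (by simp)
    simp only [St.set_M_ne, ne_eq, reduceCtorEq, not_false_eq_true] at hg4
    have hfin : ∀ φ : St A D m n, φ.g = ρ3.g → φ.M .stk = ρ4.M .stk →
        (∀ i, φ.M .nn i = if i = j + 1 then G else τ.M .nn i) →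
        Chain m (fun i => φ.g '' Set.Iio (φ.M .nn i)) (φ.M .stk) (φ.M .nn) (j + 1) := by
      intro φ e1 e2 e3
      have hnn : ∀ i ≤ j, φ.M .nn i = τ.M .nn i := fun i hi => by rw [e3, if_neg (by omega)]
      have himg : ∀ i ≤ j, φ.g '' Set.Iio (φ.M .nn i) = τ.g '' Set.Iio (τ.M .nn i) := by
        intro i hi
        rw [hnn i hi, e1]
        exact hper.image_eq (hN ▸ h5.nn_anti hi le_rfl)
      have hstkj : φ.M .stk j = a := by rw [e2, hstk4, if_pos rfl]
      refine h5.extend himg (fun i hi => by rw [e2, hstk4, if_neg (by omega)]) hnn ?_ ?_ ?_ ?_ ?_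
      · rwa [hstkj]
      · rw [hstkj, hN, constAt_image_iff hN0]; exact hnc
      · rw [hstkj]
        refine ⟨ρ2.g 0 a, ?_, ?_⟩
        · rw [hN]
          have := l2.image_eq le_rfl
          rw [k2] at this
          rw [← this]
          exact ⟨_, ⟨0, hN0, rfl⟩, rfl⟩
        · simp only [e3, if_true, e1, m5]
          have := l2.image_eq le_rfl
          rw [k2] at this
          rw [this, hN]
      · rw [e3, if_pos rfl, hN]; omega
      · rw [e3, if_pos rfl]; exact hG0
    -- The new entry of `nn` has index `j + 1`, which is at most `m` because the selected columns
    -- are distinct; the extended chain is needed already here.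
    refine put (by simp) ?_ (by simp) ?_ le_rfl
    · have := (hfin (ρ4.set .nn (j + 1) G) (by simp [q2]) (by simp)
        (fun i => by simp [hnn4])).le_arity
      simpa using this
    simp only [Ex.val_get, Ex.val_ofNat, St.set_M_same, if_true, St.set_M_ne, ne_eq, reduceCtorEq,
      not_false_eq_true, hg4, ← hG]
    have hch := hfin ((ρ4.set .lv 0 (j + 1)).set .nn (j + 1) G) (by simp [q2]) (by simp)
        (fun i => by simp [hnn4])
    refine Or.inl ⟨?_, ⟨?_, ?_, by simp, by simp [hnn4, h4], hch, ?_⟩, by simpa using l4⟩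
    · simp [q1 .ok (by simp), hok3, hc]
    · simp only [St.set_g, q2]
      exact h1.trans (hper.mono hNn)
    · simp [q3, m3, l3, k3, h2]
    · have himg : ∀ i ≤ j, ρ3.g '' Set.Iio (if i = j + 1 then G else τ.M .nn i) =
          τ.g '' Set.Iio (τ.M .nn i) := fun i hi => by
        rw [if_neg (by omega)]
        exact hper.image_eq (hN ▸ h5.nn_anti hi le_rfl)
      have hSj : τ.g '' Set.Iio (τ.M .nn j) = ρ3.g '' Set.Iio N := by
        rw [hN]; exact (hper.image_eq le_rfl).symm
      refine h6.extend (j := j) (fun i hi => ?_) (fun i hi => ?_)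
        (fun i hi => h5.anti hi le_rfl) ?_ (fun c hc e1 e2 => ?_) (fun c hc e => ?_)
      · simp [q2, hnn4, himg i hi]
      · simp [hstk4, hi.ne]
      · simp only [St.set_g, q2, St.set_M_same, if_true, hSj]
        exact Set.image_mono (Set.Iio_subset_Iio hGN)
      · simp only [St.set_g, q2, St.set_M_same, if_true, constAt_image_iff hG0] at e2
        rw [hSj, constAt_image_iff hN0] at e1
        simpa [hstk4] using q4 c hc e1 e2
      · simp only [St.set_g, q2, St.set_M_same, if_true, constAt_image_iff hG0] at e
        rw [hSj, constAt_image_iff hN0] at e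
        simpa [hlab3] using q5 c hc e
  · simp only [Cd.holds_eq, Ex.val_get, Ex.val_ofNat] at hc
    have hok : ρ1.M .ok 0 = 0 := by omega
    have e1 := f1 .nn (by simp)
    have e2 := f1 .stk (by simp)
    have e3 := f1 .lab (by simp)
    have e4 := f1 .lv (by simp)
    refine skip (Or.inr ⟨hok, ⟨by rwa [k2], by rw [k3]; exact h2, by rwa [e4], by rwa [e1],
      by rwa [k2, e1, e2], by rwa [k2, e1, e2, e3]⟩, fun c hc => ?_⟩) (by omega)
    rw [e1, hN, k2, constAt_image_iff hN0]
    exact k5 hok c hc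

/-- A selection costs at most `X` per row of the current prefix, whose length then at least halves.
So the budget `2 * nn j * (X + 1) + 1` pays for this level and for all that follow, including the
last round, which finds every column constant. -/
theorem down (hm : 0 < m) (hn : 0 < n)
    (hQ : ∀ τ L, DownInv σ τ L → τ.M .w 0 = L →
      (∀ c < m, ConstAt (τ.g '' Set.Iio (τ.M .nn L)) c) → Q τ)
    (hT : 3 * m + 2 * n * (57 * m + 2 * ly.ws + 1) + 7 ≤ T) : Runs ly ly.acc.down σ T Q := by
  set X := 57 * m + 2 * ly.ws with hX
  refine seq (T₁ := 3 * m + 2) (T₂ := 2 * n * (X + 1) + 5) ?_ (by omega)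
  refine forC m (fun i τ => τ.g = σ.g ∧ τ.out = σ.out ∧ ∀ c < i, τ.M .lab c = c) 1 (by omega)
    ?_ ?_ ?_ ?_ (by omega)
  · simp
  · simp
  · rintro i τ hi ⟨h1, h2, h3⟩ hb
    refine put (by simp) (by simp; omega) (by simp) ⟨by simp [hb], h1, h2, fun c hc => ?_⟩ le_rfl
    simp only [Ex.val_get, Ex.val_ofNat, hb, St.set_M_same, St.set_M_ne, ne_eq, reduceCtorEq,
      not_false_eq_true]
    split_ifs with hci
    · exact hci.symm
    · exact h3 c (by omega)
  rintro τ ⟨h1, h2, h3⟩ -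
  refine seq (T₁ := 1) (T₂ := 2 * n * (X + 1) + 4) (put (by simp) (by simp) (by simp) ?_ le_rfl)
    (by omega)
  refine seq (T₁ := 1) (T₂ := 2 * n * (X + 1) + 3) (put (by simp) (by simp) (by simp) ?_ le_rfl)
    (by omega)
  refine seq (T₁ := 1) (T₂ := 2 * n * (X + 1) + 2) (put (by simp) (by simp) (by simp) ?_ le_rfl)
    (by omega)
  simp only [Ex.val_ofNat, Ex.val_size]
  refine seq (T₁ := 2 * n * (X + 1) + 1) (T₂ := 1) ?_ le_rfl
  refine loopBudget (fun β τ => (τ.M .ok 0 = 1 ∧ ∃ j, DownInv σ τ j ∧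
      2 * τ.M .nn j * (X + 1) + 1 ≤ β) ∨ (τ.M .ok 0 = 0 ∧ 1 ≤ β ∧ ∃ j, DownInv σ τ j ∧
      ∀ c < m, ConstAt (τ.g '' Set.Iio (τ.M .nn j)) c)) ?_ ?_ ?_ ?_ ?_
  · simp
  · rintro β τ (⟨-, j, -, h⟩ | ⟨-, h, -⟩)
    exacts [by omega, h]
  · rintro β τ (⟨k1, j, k2, k3⟩ | ⟨k1, -⟩) hc
    · have hpos := k2.chain.pos j le_rfl
      refine ⟨τ.M .nn j * X, τ.M .nn j * (X + 1) + 1, ?_,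
        (downStep k2 rfl hm (le_refl (τ.M .nn j * X))).mono ?_ le_rfl⟩
      · nlinarith
      · rintro ρ (⟨l1, l2, l3⟩ | ⟨l1, l2, l3⟩)
        · exact Or.inl ⟨l1, j + 1, l2, by nlinarith⟩
        · exact Or.inr ⟨l1, by omega, j, l2, l3⟩
    · simp [k1] at hc
  · rintro β τ (⟨k1, -⟩ | ⟨k1, -, j, k2, k3⟩) hc
    · simp [k1] at hc
    · refine put (by simp) (by simp) (by simp) (hQ _ j ?_ (by simp [k2.lv]) k3) le_rfl
      exact ⟨k2.perm, k2.out, by simp [k2.lv], by simp [k2.nn], k2.chain, k2.lab⟩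
  · refine Or.inl ⟨by simp, 0, ⟨by simp [h1, PermBelow.refl], h2, by simp, by simp,
      ⟨by simp, by simp, by simp, by simp, ?_⟩, ?_⟩, by simp⟩
    · intro i hi
      obtain rfl : i = 0 := by omega
      simpa using hn
    · intro c hc
      refine ⟨fun _ => by simp [h3 c hc], fun _ => by simp [h3 c hc], by simp⟩

end Runs

end PrimeFact

/-! ### The ascent: merging classes on return from the selections -/

namespace PrimeFact

section UpLab

variable {D : Type v}

/-- The labels of the columns that are not constant in `S j` describe the classes of inseparable
columns of `S j`; the other labels are those after the selections. -/
structure UpLab (m : ℕ) (S : ℕ → Set (ℕ → D)) (stk lab : ℕ → ℕ) (L j : ℕ) : Prop where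
  cls : ∀ a < m, ∀ b < m, ¬ ConstAt (S j) a → ¬ ConstAt (S j) b →
    (lab a = lab b ↔ Insep (S j) a b)
  range : ∀ b < m, ¬ ConstAt (S j) b → ∃ i, j ≤ i ∧ i < L ∧ lab b = stk i
  old : ∀ b < m, ∀ i < j, ¬ ConstAt (S i) b → ConstAt (S (i + 1)) b → lab b = stk i
  const : ∀ b < m, ConstAt (S 0) b → lab b = b

variable {m L : ℕ} {S : ℕ → Set (ℕ → D)} {stk nn lab lab' : ℕ → ℕ} {j : ℕ}

theorem DownLab.upLab (h : DownLab m S stk lab L) (hL : ∀ c < m, ConstAt (S L) c) :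
    UpLab m S stk lab L L :=
  ⟨fun a ha _ _ hn => absurd (hL a ha) hn, fun b hb hn => absurd (hL b hb) hn,
    fun b hb => (h b hb).2.2, fun b hb => (h b hb).2.1⟩

theorem exists_constAt_succ {b : ℕ} (h0 : ¬ ConstAt (S 0) b) (hj : ConstAt (S j) b) :
    ∃ i < j, ¬ ConstAt (S i) b ∧ ConstAt (S (i + 1)) b := by
  induction j with
  | zero => exact absurd hj h0
  | succ j ih =>
    by_cases h : ConstAt (S j) b
    · obtain ⟨i, hi, h'⟩ := ih h
      exact ⟨i, by omega, h'⟩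
    · exact ⟨j, by omega, h, hj⟩

/-- Mixing at a constant column has no effect, so this column splits off alone. -/
theorem not_insep_of_constAt {ι : Type*} {S : Set (ι → D)} {a b : ι} (ha : ConstAt S a)
    (hb : ¬ ConstAt S b) : ¬ Insep S a b := by
  intro h
  have : Split S {a} := by
    intro s hs t ht
    have : mix {a} s t = t := by
      funext x
      by_cases hx : x = a
      · subst hx; simp [mix, ha s hs t ht]
      · simp [mix, hx]
    rwa [this]
  exact hb ((((h _ this).1 rfl : b = a)) ▸ ha)

namespace UpLab

/-- A column constant at level `j` either is constant from the start, keeps its own name and is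
never selected, or carries the name of a selection made before level `j`. -/
theorem ne_stk_of_constAt (h : UpLab m S stk lab L j) (hc : Chain m S stk nn L) {a i : ℕ}
    (ha : a < m) (hac : ConstAt (S j) a) (hji : j ≤ i) (hi : i < L) : lab a ≠ stk i := by
  intro he
  by_cases h0 : ConstAt (S 0) a
  · rw [h.const a ha h0] at he
    exact hc.nonconst i hi (he ▸ h0.mono (hc.anti (Nat.zero_le i) hi.le))
  · obtain ⟨k, hk, h1, h2⟩ := exists_constAt_succ h0 hac
    rw [h.old a ha k hk h1 h2] at he
    exact hc.stk_ne (by omega) hi he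

theorem lab_eq_iff (h : UpLab m S stk lab L j) (hc : Chain m S stk nn L) {a b : ℕ} (ha : a < m)
    (hb : b < m) (hbc : ¬ ConstAt (S j) b) : lab a = lab b ↔ Insep (S j) a b := by
  by_cases hac : ConstAt (S j) a
  · refine ⟨fun he => ?_, fun he => absurd he (not_insep_of_constAt hac hbc)⟩
    obtain ⟨i, h1, h2, h3⟩ := h.range b hb hbc
    exact absurd (he.trans h3) (h.ne_stk_of_constAt hc ha hac h1 h2)
  · exact h.cls a ha b hb hac hbc

-- This is `insep_iff_of_select` for the column `A = stk j`, whose name is also the label of the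
-- merged class. The columns made constant by this selection received that label during the descent.
open scoped Classical in
theorem step (h : UpLab m S stk lab L (j + 1)) (hc : Chain m S stk nn L) (hj : j < L)
    (hm : ∀ c, m ≤ c → ConstAt (S 0) c)
    (hlab : ∀ b < m, lab' b = if ∃ i, j < i ∧ i < L ∧ lab b = stk i ∧
      ¬ Split (S j) {x | x < m ∧ lab x = stk i} then stk j else lab b) :
    UpLab m S stk lab' L j := by
  obtain ⟨v, hne, hv⟩ := hc.select j hj
  have hkeep : ∀ b < m, (∀ i, j < i → i < L → lab b ≠ stk i) → lab' b = lab b := by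
    intro b hb hn
    rw [hlab b hb, if_neg]
    rintro ⟨i, h1, h2, h3, -⟩
    exact hn i h1 h2 h3
  -- Columns marked by one of the selections up to `j` do not carry the name of a later one, so the
  -- merging leaves them alone.
  have hold : ∀ b < m, ∀ i < j + 1, ¬ ConstAt (S i) b → ConstAt (S (i + 1)) b →
      lab' b = stk i := by
    intro b hb i hi h1 h2
    have := h.old b hb i hi h1 h2
    rw [hkeep b hb, this]
    intro k hk hkL
    rw [this]
    exact hc.stk_ne (by omega) hkL
  refine ⟨fun a ha b hb hac hbc => ?_, fun b hb hbc => ?_, fun b hb i hi => hold b hb i (by omega),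
    fun b hb h0 => ?_⟩
  · refine insep_iff_of_select (F := Finset.range m) (A := stk j) (v := v) ?_ hne
      lab lab' (stk j) ?_ ?_ ?_ ?_ (by simpa) (by simpa) hac hbc
    · rw [← hv]
      refine supportedOn_of_constAt fun a ha => (hm a ?_).mono (hc.anti (Nat.zero_le _) hj)
      simpa using ha
    · rw [← hv]
      exact fun a ha b hb hbc => h.lab_eq_iff hc (by simpa using ha) (by simpa using hb) hbc
    · rw [← hv]
      exact fun b hb h1 h2 => hold b (by simpa using hb) j (by omega) h1 h2
    · rw [← hv]
      intro b hb hbc hns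
      have hb := Finset.mem_range.1 hb
      obtain ⟨i, h1, h2, h3⟩ := h.range b hb hbc
      rw [hlab b hb, if_pos ⟨i, h1, h2, h3, by simpa [h3] using hns⟩]
    · rw [← hv]
      intro b hb hbc hs
      have hb := Finset.mem_range.1 hb
      obtain ⟨i, h1, h2, h3⟩ := h.range b hb hbc
      refine ⟨?_, by rw [h3]; exact (hc.stk_ne h1 h2).symm⟩
      rw [hlab b hb, if_neg]
      rintro ⟨k, k1, k2, k3, k4⟩
      rw [← k3] at k4
      exact k4 (by simpa using hs)
  · by_cases hb' : ConstAt (S (j + 1)) b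
    · exact ⟨j, le_rfl, hj, hold b hb j (by omega) hbc hb'⟩
    · obtain ⟨i, h1, h2, h3⟩ := h.range b hb hb'
      rw [hlab b hb]
      split_ifs
      exacts [⟨j, le_rfl, hj, rfl⟩, ⟨i, by omega, h2, h3⟩]
  · rw [hkeep b hb, h.const b hb h0]
    intro i _ hi
    rw [h.const b hb h0]
    rintro rfl
    exact hc.nonconst i hi (h0.mono (hc.anti (Nat.zero_le i) hi.le))

end UpLab

end UpLab

theorem GridTest.congr {D : Type v} {g : ℕ → ℕ → D} {N m G : ℕ} {X Y : Set ℕ}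
    (h : GridTest g N m G X) (hXY : ∀ c < m, c ∈ X ↔ c ∈ Y) : GridTest g N m G Y :=
  ⟨h.1, fun p hp c hc => by simpa only [← hXY c hc] using h.2 p hp c hc⟩

variable {A : Type u} {D : Type v} [LinearOrder D] {m n : ℕ}

namespace Acc

variable (acc : Acc)

/-- Tests whether the rows split at the columns with label `cl`. -/
def splitTest : Stmt := acc.gather ;; acc.sort ;; acc.groupSize ;; acc.gridTest

/-- Merges the class `t` with the class of the selected column, if the rows do not split. -/
def upStep : Stmt :=
  putr Nm.cl (.get Nm.stk Nm.t) ;; acc.splitTest ;; acc.ite (.eq Nm.ok 1) .skip acc.relabel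

/-- Returns from the selections to the whole relation. -/
def up : Stmt :=
  acc.loopW (.lt 0 Nm.lv)
    (putr Nm.lv (.reg Nm.lv - 1) ;; putr Nm.a (.get Nm.stk Nm.lv) ;;
      putr Nm.sz (.get Nm.nn Nm.lv) ;; acc.forR Nm.t (.reg Nm.lv + 1) Nm.w acc.upStep)

end Acc

namespace Runs

variable {ly : Layer A D m n (Lex (Fin m → D))} {σ : St A D m n} {Q : St A D m n → Prop} {T : ℕ}

/-- The time is affine in the size of the class, so that the costs of disjoint classes can be added
up. -/
theorem splitTest {N d : ℕ} (htk : ly.tk = lexKey id m) (hN : σ.M .sz 0 = N) (hN0 : 0 < N)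
    (hn : N ≤ n) (hd : N ≤ 2 ^ d) (hinj : Set.InjOn σ.g (Set.Iio N))
    (hm : ∀ p < N, ∀ q < N, ∀ c, m ≤ c → σ.g p c = σ.g q c)
    (hQ : ∀ τ, St.Fr [.kk, .b, .buf, .c, .f, .cur, .ch, .chh, .hi, .e, .g, .p, .ok, .q] σ τ →
      PermBelow N σ.g τ.g → τ.out = σ.out →
      (τ.M .ok 0 = 1 ↔ Split (σ.g '' Set.Iio N) {c | c < m ∧ σ.M .lab c = σ.M .cl 0}) → Q τ)
    (hT : N * ((2 * d * (2 * ly.wt + ly.ws + 18) + 2 * ly.ws + 11 * m + 37) + (20 * d + 4) *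
      ((Finset.range m).filter fun c => σ.M .lab c = σ.M .cl 0).card) ≤ T) :
    Runs ly ly.acc.splitTest σ T Q := by
  set K := ((Finset.range m).filter fun c => σ.M .lab c = σ.M .cl 0).card with hK
  refine seq (T₁ := 5 * m + 3) (T₂ := (2 * N * (d * (10 * K + 2 * ly.wt + ly.ws + 18) + ly.ws + 6)
    + 4) + ((N * (4 * K + 7) + 3) + (N * (6 * m + 4) + 4))) ?_ ?_
  swap
  · refine le_trans ?_ hT
    have : 5 * m + 14 ≤ N * (5 * m + 14) := Nat.le_mul_of_pos_left _ hN0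
    nlinarith
  refine gather (fun τ h1 h2 h3 h4 => ?_) le_rfl
  rw [← hK] at h4
  refine seq (sort (K := K) (N := N) (d := d) h4.kk h4.le h4.lt (by rw [h1 .sz (by simp), hN]) hn hd
    (fun ρ k1 k2 k3 k4 => ?_) le_rfl) le_rfl
  rw [h2] at k3
  have hbuf := k1 .buf (by simp)
  refine seq (groupSize (h4.congr (k1 .kk (by simp)) hbuf) (N := N)
    (by rw [k1 .sz (by simp), h1 .sz (by simp), hN]) hn (fun φ l1 l2 l3 l4 => ?_) le_rfl) le_rfl
  rw [hbuf] at l4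
  refine gridTest (N := N) (G := φ.M .g 0)
    (by rw [l1 .sz (by simp), k1 .sz (by simp), h1 .sz (by simp), hN]) hn rfl
    (fun ψ q1 q2 q3 q4 q5 => ?_) le_rfl
  have hlab : φ.M .lab = σ.M .lab := by
    rw [l1 .lab (by simp), k1 .lab (by simp), h1 .lab (by simp)]
  have hcl : φ.M .cl = σ.M .cl := by
    rw [l1 .cl (by simp), k1 .cl (by simp), h1 .cl (by simp)]
  refine hQ ψ ((h1.mono (by simp)).trans ((k1.mono (by simp)).trans ((l1.mono (by simp)).trans
    (q1.mono (by simp))))) (by rw [q2, l2]; exact k3) (by rw [q3, l3, k2, h3]) ?_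
  rw [q5, l2, l4, hlab, hcl, ← k3.image_eq le_rfl]
  have hm' : ∀ p < N, ∀ q < N, ∀ c, m ≤ c → ρ.g p c = ρ.g q c := by
    intro p hp q hq c hc
    obtain ⟨p', hp', e1⟩ := k3.exists_eq hp
    obtain ⟨q', hq', e2⟩ := k3.exists_eq hq
    rw [e1, e2]
    exact hm p' hp' q' hq' c hc
  have hcongr : ∀ c < m, (c ∈ {c | σ.M .lab c = σ.M .cl 0} ↔
      c ∈ {c | c < m ∧ σ.M .lab c = σ.M .cl 0}) := fun c hc => by simp [hc]
  constructor
  · intro h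
    refine (h.congr hcongr).split ?_ hm'
    exact Finset.card_pos.2 ⟨0, by simpa using hN0⟩
  · intro h
    refine (gridTest_of_split h (fun c => ⟨fun hc => h4.cover c hc.1 hc.2, ?_⟩) (k3.injOn hinj) hm'
      (by rw [← htk]; exact k4) hN0).congr fun c hc => (hcongr c hc).symm
    rintro ⟨i, hi, rfl⟩
    exact ⟨h4.lt i hi, h4.mem i hi⟩

/-- The state on return to the level `j`. -/
structure UpInv (σ τ : St A D m n) (L j : ℕ) : Prop where
  perm : PermBelow n σ.g τ.g
  out : τ.out = σ.out
  lv : τ.M .lv 0 = j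
  le : j ≤ L
  stk : τ.M .stk = σ.M .stk
  nn : τ.M .nn = σ.M .nn
  w : τ.M .w = σ.M .w
  img : ∀ i ≤ j, τ.g '' Set.Iio (σ.M .nn i) = σ.g '' Set.Iio (σ.M .nn i)
  lab : UpLab m (fun i => σ.g '' Set.Iio (σ.M .nn i)) (σ.M .stk) (τ.M .lab) L j

/-- Different labels have disjoint classes. This keeps the comparisons of columns on one level
within the cost of a single sort by all columns. -/
theorem sum_card_filter_le {lab stk : ℕ → ℕ} {L j : ℕ} (h : Set.InjOn stk (Set.Iio L)) :
    ∑ t ∈ Finset.Ico j L, ((Finset.range m).filter fun c => lab c = stk t).card ≤ m := by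
  rw [← Finset.card_biUnion]
  · refine (Finset.card_le_card (t := Finset.range m) ?_).trans (by simp)
    intro c hc
    simp only [Finset.mem_biUnion, Finset.mem_filter] at hc
    obtain ⟨t, -, hc, -⟩ := hc
    exact hc
  · intro s hs t ht hst
    rw [Function.onFun, Finset.disjoint_filter]
    intro c _ h1 h2
    exact hst (h (by simpa using (Finset.mem_Ico.1 hs).2) (by simpa using (Finset.mem_Ico.1 ht).2)
      (h1.symm.trans h2))

/-- Sorting the prefix of level `j` destroys shorter prefixes, which are no longer needed, and
preserves the others as sets. The invariant therefore refers to the selections in the state before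
the ascent. -/
theorem up {L d : ℕ} (htk : ly.tk = lexKey id m) (hn0 : 0 < n)
    (hinj : Set.InjOn σ.g (Set.Iio n)) (hm : ∀ p < n, ∀ q < n, ∀ c, m ≤ c → σ.g p c = σ.g q c)
    (hd : n ≤ 2 ^ d) (hnn : σ.M .nn 0 = n) (hlv : σ.M .lv 0 = L) (hw : σ.M .w 0 = L)
    (hc : Chain m (fun i => σ.g '' Set.Iio (σ.M .nn i)) (σ.M .stk) (σ.M .nn) L)
    (hl : DownLab m (fun i => σ.g '' Set.Iio (σ.M .nn i)) (σ.M .stk) (σ.M .lab) L)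
    (hL : ∀ c < m, ConstAt (σ.g '' Set.Iio (σ.M .nn L)) c)
    (hQ : ∀ τ, UpInv σ τ L 0 → Q τ)
    (hT : 2 * n * (L * (2 * d * (2 * ly.wt + ly.ws + 18) + 2 * ly.ws + 15 * m + 43) +
      (20 * d + 4) * m) + 6 * L + 1 ≤ T) :
    Runs ly ly.acc.up σ T Q := by
  classical
  have hLm := hc.le_arity
  set α := 2 * d * (2 * ly.wt + ly.ws + 18) + 2 * ly.ws + 11 * m + 37 with hα
  set β := 20 * d + 4 with hβ
  refine loopW (fun k τ => UpInv σ τ L k)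
    (fun k => σ.M .nn k * (L * (α + 4 * m + 6) + β * m) + 5) ?_ ?_ ?_ L ?_ ?_ ?_
  · intros; simp
  · intro τ h; simp [h.lv]
  · rintro j τ ⟨h1, h2, h3, h4, h5, h6, h7, h8, h9⟩ -
    set N := σ.M .nn j with hN
    have hN0 : 0 < N := hc.pos j (by omega)
    have hNn : N ≤ n := by have := hc.le_zero (i := j) (by omega); omega
    refine seq (T₁ := 1) (T₂ := N * (L * (α + 4 * m + 6) + β * m) + 4)
      (put (by simp) (by simp) (by simp) ?_ le_rfl) (by omega)
    refine seq (T₁ := 1) (T₂ := N * (L * (α + 4 * m + 6) + β * m) + 3)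
      (put (by simp) (by simp) (by simp [h3]; omega) ?_ le_rfl) (by omega)
    refine seq (T₁ := 1) (T₂ := N * (L * (α + 4 * m + 6) + β * m) + 2)
      (put (by simp) (by simp) (by simp [h3]; omega) ?_ le_rfl) (by omega)
    simp only [Ex.val_sub, Ex.val_get, Ex.val_ofNat, h3, St.set_M_same, St.set_M_ne, ne_eq,
      reduceCtorEq, not_false_eq_true, if_true, Nat.add_sub_cancel, h5, h6, ← hN]
    set τ' := ((τ.set .lv 0 j).set .a 0 (σ.M .stk j)).set .sz 0 N with hτ'
    have hτg : τ'.g = τ.g := rfl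
    have hτo : τ'.out = τ.out := rfl
    have hτlab : τ'.M .lab = τ.M .lab := by simp [hτ']
    have hτstk : τ'.M .stk = σ.M .stk := by simp [hτ', h5]
    have hτnn : τ'.M .nn = σ.M .nn := by simp [hτ', h6]
    have hτw : τ'.M .w = σ.M .w := by simp [hτ', h7]
    have hτlv : τ'.M .lv 0 = j := by simp [hτ']
    have hτa : τ'.M .a 0 = σ.M .stk j := by simp [hτ']
    have hτsz : τ'.M .sz 0 = N := by simp [hτ']
    clear_value τ'
    set ks : List Nm := [.kk, .b, .buf, .c, .f, .cur, .ch, .chh, .hi, .e, .g, .p, .ok, .q, .cl,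
      .lab, .t] with hks
    set Kt : ℕ → ℕ := fun t => ((Finset.range m).filter fun c => τ.M .lab c = σ.M .stk t).card
      with hKt
    refine forR (j + 1) L (fun t ρ => St.Fr ks τ' ρ ∧ PermBelow N τ.g ρ.g ∧ ρ.out = σ.out ∧
      ∀ b < m, ρ.M .lab b = if ∃ i, j < i ∧ i < t ∧ τ.M .lab b = σ.M .stk i ∧
        ¬ Split (σ.g '' Set.Iio N) {x | x < m ∧ τ.M .lab x = σ.M .stk i} then σ.M .stk j
        else τ.M .lab b) (fun t => N * (α + β * Kt t) + 4 * m + 4) (by simp [hτlv]; omega)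
      (by simp [hτlv]) (by omega) (by omega) ?_ ?_ ?_ ?_ ?_
    · refine ⟨(St.Fr.refl _ _).set (by simp [hks]) _ _, hτg ▸ PermBelow.refl _ _, hτo.trans h2,
        fun b hb => ?_⟩
      rw [if_neg (by rintro ⟨i, h1, h2, -⟩; omega)]
      simp [hτlab]
    · rintro t ρ ⟨k1, -⟩ -
      simp [k1 .w (by simp [hks]), hτw, hw]
    · rintro t ρ hjt htL ⟨k1, k2, k3, k4⟩ ht
      have e1 := k1 .stk (by simp [hks])
      have e2 := k1 .sz (by simp [hks])
      have e3 := k1 .a (by simp [hks])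
      -- Merges made earlier on this level do not affect the class `t`: they take columns with other
      -- labels and rename them to `stk j`.
      have hcls : ∀ b < m, ρ.M .lab b = σ.M .stk t ↔ τ.M .lab b = σ.M .stk t := by
        intro b hb
        rw [k4 b hb]
        split_ifs with hif
        · obtain ⟨i, h1, h2, h3, -⟩ := hif
          constructor
          · exact fun h => absurd h (hc.stk_ne (by omega) htL)
          · exact fun h => absurd (h3.symm.trans h) (hc.stk_ne h2 htL)
        · rfl
      refine seq (T₁ := 1) (T₂ := N * (α + β * Kt t) + 4 * m + 3)
        (put (by simp) (by simp) (by simp [ht]; omega) ?_ le_rfl) (by omega)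
      simp only [Ex.val_get, Ex.val_ofNat, ht, e1, hτstk]
      have himg : τ.g '' Set.Iio N = σ.g '' Set.Iio N := h8 j (by omega)
      refine seq (T₁ := N * (α + β * Kt t)) (T₂ := 4 * m + 3) (splitTest (N := N) (d := d) htk
        (by simp [e2, hτsz]) hN0 hNn (by omega) ?_ ?_ (fun φ l1 l2 l3 l4 => ?_) ?_) (by omega)
      · exact ((h1.trans (k2.mono hNn)).injOn hinj).mono (Set.Iio_subset_Iio hNn)
      · intro p hp q hq c hc'
        obtain ⟨p', hp', f1⟩ := (h1.trans (k2.mono hNn)).exists_eq (hp.trans_le hNn)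
        obtain ⟨q', hq', f2⟩ := (h1.trans (k2.mono hNn)).exists_eq (hq.trans_le hNn)
        simp only [St.set_g, f1, f2]
        exact hm p' hp' q' hq' c hc'
      · simp only [St.set_g, St.set_M_ne, St.set_M_same, ne_eq, reduceCtorEq, not_false_eq_true,
          if_true] at l2 l4
        rw [k2.image_eq le_rfl, himg] at l4
        have hset : {c | c < m ∧ ρ.M .lab c = σ.M .stk t} =
            {c | c < m ∧ τ.M .lab c = σ.M .stk t} := by
          ext c
          exact and_congr_right fun hc => hcls c hc
        rw [hset] at l4
        have l5 := l1 .lab (by simp)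
        have l6 := l1 .cl (by simp)
        have l7 := l1 .a (by simp)
        have l8 := l1 .t (by simp)
        simp only [St.set_M_ne, ne_eq, reduceCtorEq, not_false_eq_true] at l5 l7 l8
        have f1 : St.Fr ks τ' φ := (k1.set (by simp [hks]) _ _).trans (l1.mono (by simp [hks]))
        have hex : ∀ b, (∃ i, j < i ∧ i < t + 1 ∧ τ.M .lab b = σ.M .stk i ∧
            ¬ Split (σ.g '' Set.Iio N) {x | x < m ∧ τ.M .lab x = σ.M .stk i}) ↔
            (∃ i, j < i ∧ i < t ∧ τ.M .lab b = σ.M .stk i ∧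
            ¬ Split (σ.g '' Set.Iio N) {x | x < m ∧ τ.M .lab x = σ.M .stk i}) ∨
            (τ.M .lab b = σ.M .stk t ∧ ¬ φ.M .ok 0 = 1) := by
          intro b
          rw [l4]
          constructor
          · rintro ⟨i, h1, h2, h3, h4⟩
            rcases Nat.lt_succ_iff_lt_or_eq.1 h2 with h2 | rfl
            exacts [Or.inl ⟨i, h1, h2, h3, h4⟩, Or.inr ⟨h3, h4⟩]
          · rintro (⟨i, h1, h2, h3, h4⟩ | ⟨h3, h4⟩)
            exacts [⟨i, h1, by omega, h3, h4⟩, ⟨t, by omega, by omega, h3, h4⟩]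
        refine ite (T₁ := 4 * m + 2) (by simp) (fun he => ?_) (fun he => ?_) le_rfl
        · simp only [Cd.holds_eq, Ex.val_get, Ex.val_ofNat] at he
          refine skip ⟨by rw [l8, ht], f1.set (by simp [hks]) _ _, k2.trans l2, l3.trans k3,
            fun b hb => ?_⟩ (by omega)
          simp only [St.set_M_ne, ne_eq, reduceCtorEq, not_false_eq_true, l5, k4 b hb, hex, he,
            not_true_eq_false, and_false, or_false]
        · simp only [Cd.holds_eq, Ex.val_get, Ex.val_ofNat] at he
          refine relabel (fun ψ q1 q2 q3 q4 => ?_) le_rfl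
          refine ⟨by rw [q1 .t (by simp), l8, ht], (f1.trans (q1.mono (by simp [hks]))).set
            (by simp [hks]) _ _, by simpa [q2] using k2.trans l2, q3.trans (l3.trans k3),
            fun b hb => ?_⟩
          simp only [St.set_M_ne, ne_eq, reduceCtorEq, not_false_eq_true, q4 b hb, l5, l6, l7, e3,
            hτa, St.set_M_same, if_true, hcls b hb, hex, he, and_true]
          by_cases hb' : τ.M .lab b = σ.M .stk t
          · simp [hb']
          · simp [hb', k4 b hb]
      · simp only [St.set_M_ne, St.set_M_same, ne_eq, reduceCtorEq, not_false_eq_true, if_true]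
        have : ((Finset.range m).filter fun c => ρ.M .lab c = σ.M .stk t) =
            (Finset.range m).filter fun c => τ.M .lab c = σ.M .stk t :=
          Finset.filter_congr fun c hc => hcls c (Finset.mem_range.1 hc)
        rw [this]
    · rintro ρ ⟨k1, k2, k3, k4⟩ -
      have e1 := k1 .stk (by simp [hks])
      have e2 := k1 .nn (by simp [hks])
      have e3 := k1 .w (by simp [hks])
      have e4 := k1 .lv (by simp [hks])
      refine ⟨h1.trans (k2.mono hNn), k3, by rw [e4, hτlv], by omega, by rw [e1, hτstk],
        by rw [e2, hτnn], by rw [e3, hτw], fun i hi => ?_, ?_⟩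
      · rw [← h8 i (by omega)]
        exact k2.image_eq (hc.nn_anti hi (by omega))
      · refine h9.step hc (by omega) (fun c hc' => ?_) k4
        simp only [hnn]
        rintro _ ⟨p, hp, rfl⟩ _ ⟨q, hq, rfl⟩
        exact hm p hp q hq c hc'
    · have hsum := sum_card_filter_le (m := m) (lab := τ.M .lab) (j := j + 1) hc.injOn
      have h1 : ∑ t ∈ Finset.Ico (j + 1) L, (N * (α + β * Kt t) + 4 * m + 4 + 2) =
          (L - (j + 1)) * (N * α + 4 * m + 6) + N * β * ∑ t ∈ Finset.Ico (j + 1) L, Kt t := by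
        have h0 := Finset.sum_const (s := Finset.Ico (j + 1) L) (N * α + 4 * m + 6)
        rw [Nat.card_Ico, smul_eq_mul] at h0
        rw [Finset.mul_sum, ← h0, ← Finset.sum_add_distrib]
        exact Finset.sum_congr rfl fun t _ => by ring
      rw [h1]
      have h2 : (L - (j + 1)) * (N * α + 4 * m + 6) ≤ L * (N * (α + 4 * m + 6)) := by
        refine Nat.mul_le_mul (Nat.sub_le _ _) ?_
        have : 4 * m + 6 ≤ N * (4 * m + 6) := Nat.le_mul_of_pos_left _ hN0
        nlinarith
      have h3 := Nat.mul_le_mul_left (N * β) hsum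
      simp only [← hKt] at h3
      nlinarith
  · exact ⟨PermBelow.refl _ _, rfl, hlv, le_rfl, rfl, rfl, rfl, fun _ _ => rfl, hl.upLab hL⟩
  · intro k τ h hc'
    have : k = 0 := by
      have := h.lv
      simp at hc'
      omega
    exact hQ τ (this ▸ h)
  · refine le_trans ?_ hT
    -- All levels together have at most `2 * n` rows.
    have h1 := hc.sum_le
    rw [hnn] at h1
    have h2 : ∑ i ∈ Finset.range L, (σ.M .nn i * (L * (α + 4 * m + 6) + β * m) + 5 + 1) =
        (∑ i ∈ Finset.range L, σ.M .nn i) * (L * (α + 4 * m + 6) + β * m) + 6 * L := by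
      rw [Finset.sum_mul, Finset.sum_add_distrib, Finset.sum_add_distrib]
      simp; ring
    rw [h2]
    have h3 := Nat.mul_le_mul_right (L * (α + 4 * m + 6) + β * m) h1
    have h4 : α + 4 * m + 6 = 2 * d * (2 * ly.wt + ly.ws + 18) + 2 * ly.ws + 15 * m + 43 := by
      rw [hα]; ring
    rw [h4] at h3 ⊢
    omega

end Runs

end PrimeFact

/-! ### Output of the classes as tables -/

namespace PrimeFact

section TableOf

variable {A : Type u} {D : Type v} {m : ℕ}

/-- The table lists the restrictions of the tuples of `S` to the columns in `X`. -/
def TableOf (attr : Fin m → A) (S : Set (ℕ → D)) (X : Set ℕ) (T : Table A D) : Prop :=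
  (∀ a, (∃ j, T.attr j = a) ↔ ∃ c : Fin m, (c : ℕ) ∈ X ∧ attr c = a) ∧
    ∀ t : A → D, (∃ i, ∀ j, t (T.attr j) = T.rows i j) ↔
      ∃ s ∈ S, ∀ c : Fin m, (c : ℕ) ∈ X → t (attr c) = s c

theorem TableOf.congr {attr : Fin m → A} {S : Set (ℕ → D)} {X Y : Set ℕ} {T : Table A D}
    (h : TableOf attr S X T) (hXY : ∀ c < m, c ∈ X ↔ c ∈ Y) : TableOf attr S Y T := by
  have h' : ∀ c : Fin m, (c : ℕ) ∈ X ↔ (c : ℕ) ∈ Y := fun c => hXY c c.2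
  simpa only [TableOf, h'] using h

theorem encodeTables_append (Ts Ts' : List (Table A D)) :
    encodeTables (Ts ++ Ts') = encodeTables Ts ++ encodeTables Ts' := by
  simp [encodeTables]

theorem encodeTables_singleton (T : Table A D) : encodeTables [T] = T.encode := by
  simp [encodeTables]

theorem ofFn_val_succ {α : Type*} (F : ℕ → α) (k : ℕ) :
    (List.ofFn fun j : Fin (k + 1) => F j) = (List.ofFn fun j : Fin k => F j) ++ [F k] := by
  rw [List.ofFn_succ_last]
  simp

/-- Emission of the distinct restrictions of rows that are sorted by columns listed in `b`. -/
theorem exists_tableOf [LinearOrder D] {g : ℕ → ℕ → D} {N K : ℕ} {b : ℕ → ℕ} {X : Set ℕ}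
    {attr : Fin m → A} (ha : Function.Injective attr) (hlt : ∀ i < K, b i < m)
    (hmem : ∀ i < K, b i ∈ X) (hcov : ∀ c < m, c ∈ X → ∃ i < K, b i = c)
    (hinj : ∀ i < K, ∀ j < K, b i = b j → i = j)
    (hs : ∀ p q, p ≤ q → q < N → lexKey b K (g p) ≤ lexKey b K (g q)) {l : List ℕ}
    (hl : l = (List.range N).filter fun p => p = 0 ∨ lexKey b K (g p) ≠ lexKey b K (g (p - 1))) :
    ∃ T : Table A D, TableOf attr (g '' Set.Iio N) X T ∧
      T.encode = Token.table ::
        (List.ofFn fun j : Fin K => Token.attr (attr ⟨b j, hlt j j.2⟩)) ++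
        (l.map fun p => Token.row :: List.ofFn fun j : Fin K =>
          (Token.value (g p (b j)) : Token A D)).flatten := by
  have hmeml : ∀ p, p ∈ l ↔ p < N ∧ (p = 0 ∨ lexKey b K (g p) ≠ lexKey b K (g (p - 1))) := by
    intro p
    simp [hl]
  have hsorted : l.Pairwise (· < ·) := by
    rw [hl]
    exact List.Pairwise.filter _ List.pairwise_lt_range
  -- Going back from `p` while the restriction does not change leads to a listed position.
  have hfirst : ∀ p < N, ∃ q ∈ l, lexKey b K (g q) = lexKey b K (g p) := by
    intro p
    induction p with
    | zero => exact fun hp => ⟨0, (hmeml 0).2 ⟨hp, Or.inl rfl⟩, rfl⟩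
    | succ p ih =>
      intro hp
      by_cases h : lexKey b K (g (p + 1)) = lexKey b K (g p)
      · obtain ⟨q, hq, hq'⟩ := ih (by omega)
        exact ⟨q, hq, hq'.trans h.symm⟩
      · exact ⟨p + 1, (hmeml _).2 ⟨hp, Or.inr (by simpa using h)⟩, rfl⟩
  -- If the keys at `p < q` were equal, sortedness would force the same key at `q - 1`, and `q`
  -- would not be listed.
  have hne : ∀ p ∈ l, ∀ q ∈ l, p < q → lexKey b K (g p) ≠ lexKey b K (g q) := by
    intro p hp q hq hpq he
    obtain ⟨hq1, hq2⟩ := (hmeml q).1 hq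
    have h1 := hs p (q - 1) (by omega) (by omega)
    have h2 := hs (q - 1) q (by omega) hq1
    rcases hq2 with hq2 | hq2
    · omega
    · exact hq2 (le_antisymm (he ▸ h1) h2)
  refine ⟨⟨K, l.length, fun j => attr ⟨b j, hlt j j.2⟩, fun i j h => ?_,
    fun i j => g (l.get i) (b j), fun i j h => ?_⟩, ⟨fun a => ?_, fun t => ?_⟩, ?_⟩
  · exact Fin.ext (hinj i i.2 j j.2 (by simpa using ha h))
  · have he : lexKey b K (g (l.get i)) = lexKey b K (g (l.get j)) :=
      lexKey_eq_iff.2 fun k hk => congrFun h ⟨k, hk⟩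
    rcases lt_trichotomy i j with h1 | h1 | h1
    · exact absurd he (hne _ (l.get_mem i) _ (l.get_mem j) (List.pairwise_iff_get.1 hsorted i j h1))
    · exact h1
    · exact absurd he.symm
        (hne _ (l.get_mem j) _ (l.get_mem i) (List.pairwise_iff_get.1 hsorted j i h1))
  · constructor
    · rintro ⟨j, rfl⟩
      exact ⟨⟨b j, hlt j j.2⟩, hmem j j.2, rfl⟩
    · rintro ⟨c, hc, rfl⟩
      obtain ⟨i, hi, he⟩ := hcov c c.2 hc
      exact ⟨⟨i, hi⟩, by simp [he]⟩
  · constructor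
    · rintro ⟨i, hi⟩
      refine ⟨g (l.get i), ⟨_, ((hmeml _).1 (l.get_mem i)).1, rfl⟩, fun c hc => ?_⟩
      obtain ⟨j, hj, he⟩ := hcov c c.2 hc
      have := hi ⟨j, hj⟩
      simpa [he] using this
    · rintro ⟨_, ⟨p, hp, rfl⟩, h⟩
      obtain ⟨q, hq, hq'⟩ := hfirst p hp
      obtain ⟨i, rfl⟩ := List.get_of_mem hq
      refine ⟨i, fun j => ?_⟩
      exact (h ⟨b j, hlt j j.2⟩ (hmem j j.2)).trans (lexKey_eq_iff.1 hq' j j.2).symm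
  · simp only [Table.encode]
    congr 2
    conv_rhs => rw [← List.ofFn_get l, List.map_ofFn]
    rfl

end TableOf

variable {A : Type u} {D : Type v} [LinearOrder D] {m n : ℕ} {κ : Type w} [LinearOrder κ]

namespace Acc

variable (acc : Acc)

/-- Outputs the table of the distinct restrictions of the sorted rows to the columns in `buf`. -/
def emitTable : Stmt :=
  .outTable ;; acc.forR Nm.c 0 Nm.kk (.outAttr (Ex.get Nm.buf Nm.c).comp) ;;
  acc.forR Nm.p 0 Nm.sz
    (acc.ite (.lt 0 Nm.p) (acc.agree (.reg Nm.p - 1)) (putr Nm.f 0) ;;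
      acc.ite (.eq Nm.f 0) (.outRow ;; acc.forR Nm.c 0 Nm.kk (acc.outVal Nm.p (.get Nm.buf Nm.c)))
        .skip)

/-- Outputs a table for every constant column. -/
def emitConst : Stmt :=
  acc.forR Nm.b 0 .arity
    (acc.nonconst Nm.sz ;;
      acc.ite (.eq Nm.f 0) (put Nm.buf 0 Nm.b ;; putr Nm.kk 1 ;; acc.emitTable) .skip)

/-- Outputs a table for every other class. -/
def emitClasses : Stmt :=
  acc.forR Nm.t 0 Nm.w
    (putr Nm.cl (.get Nm.stk Nm.t) ;; acc.gather ;;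
      acc.ite (.lt 0 Nm.kk) (acc.sort ;; acc.emitTable) .skip)

/-- Outputs the prime factors. -/
def emitAll : Stmt := putr Nm.sz .size ;; acc.emitConst ;; acc.emitClasses

end Acc

namespace Runs

variable {ly : Layer A D m n κ} {σ : St A D m n} {Q : St A D m n → Prop} {T : ℕ}

theorem emitTable {N K : ℕ} {X : Set ℕ} (ha : Function.Injective ly.attr)
    (hX : BufLists σ (· ∈ X) K) (hN : σ.M .sz 0 = N) (hn : N ≤ n)
    (hs : ∀ p q, p ≤ q → q < N →
      lexKey (σ.M .buf) K (σ.g p) ≤ lexKey (σ.M .buf) K (σ.g q))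
    (hQ : ∀ τ T, St.Fr [.c, .f, .p] σ τ → τ.g = σ.g →
      TableOf ly.attr (σ.g '' Set.Iio N) X T → τ.out = σ.out ++ T.encode → Q τ)
    (hT : N * (7 * K + 10) + 3 * K + 5 ≤ T) : Runs ly ly.acc.emitTable σ T Q := by
  have hKm := hX.le
  set b := σ.M .buf with hb
  obtain ⟨T', hT1, hT2⟩ := exists_tableOf ha hX.lt hX.mem hX.cover hX.inj hs rfl
  -- The default token is never output; it extends the list of attributes to a function on `ℕ`, as
  -- `ofFn_val_succ` requires.
  set FA : ℕ → Token A D := fun j => if h : b j < m then .attr (ly.attr ⟨b j, h⟩) else .table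
    with hFA
  set FV : ℕ → ℕ → Token A D := fun p j => .value (σ.g p (b j)) with hFV
  have hattrs : (List.ofFn fun j : Fin K => Token.attr (ly.attr ⟨b j, hX.lt j j.2⟩)) =
      List.ofFn fun j : Fin K => FA j := by
    refine congrArg List.ofFn (funext fun j => ?_)
    simp only [hFA]
    rw [dif_pos (hX.lt j j.2)]
  rw [hattrs] at hT2
  refine seq (T₁ := 1) (T₂ := N * (7 * K + 10) + 3 * K + 4) (outTable ?_ le_rfl) (by omega)
  refine seq (T₁ := 3 * K + 2) (T₂ := N * (7 * K + 10) + 2) ?_ (by omega)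
  refine forC K (fun i τ => St.Fr [.c, .f, .p] σ τ ∧ τ.g = σ.g ∧
    τ.out = σ.out ++ (Token.table :: List.ofFn fun j : Fin i => FA j)) 1 (by omega) ?_ ?_ ?_ ?_
    (by omega)
  · exact ⟨St.Fr.set (τ := σ.emit _) (St.Fr.refl _ _) (by simp) _ _, rfl, by simp⟩
  · rintro i τ ⟨h1, -⟩ -
    simp [h1 .kk (by simp), hX.kk]
  · rintro i τ hi ⟨h1, h2, h3⟩ hc
    have hbuf := h1 .buf (by simp)
    have hlt : (Ex.get .buf Nm.c).val τ < m := by simpa [hc, hbuf] using hX.lt i hi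
    refine outAttr (by simp [hc]; omega) hlt ⟨by simp [hc],
      St.Fr.set (τ := τ.emit _) h1 (by simp) _ _, by simp [h2], ?_⟩ le_rfl
    rw [ofFn_val_succ]
    simp [h3, hFA, hc, hbuf, ← hb]
    exact hX.lt i hi
  rintro τ ⟨h1, h2, h3⟩ -
  refine forC N (fun i τ => St.Fr [.c, .f, .p] σ τ ∧ τ.g = σ.g ∧
    τ.out = σ.out ++ (Token.table :: (List.ofFn fun j : Fin K => FA j) ++
      (((List.range i).filter fun p => p = 0 ∨
        lexKey b K (σ.g p) ≠ lexKey b K (σ.g (p - 1))).map fun p =>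
        Token.row :: List.ofFn fun j : Fin K => FV p j).flatten)) (7 * K + 8) (by omega) ?_ ?_ ?_ ?_
    le_rfl
  · exact ⟨h1.set (by simp) _ _, h2, by simp [h3]⟩
  · rintro i τ ⟨h1, -⟩ -
    simp [h1 .sz (by simp), hN]
  · rintro i τ hi ⟨h1, h2, h3⟩ hp
    refine seq (T₁ := 4 * K + 4) (T₂ := 3 * K + 4) (Runs.mono (Q₁ := fun ρ =>
      St.Fr [.c, .f] τ ρ ∧ ρ.g = τ.g ∧ ρ.out = τ.out ∧ (ρ.M .f 0 = 0 ↔ (i = 0 ∨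
        lexKey b K (σ.g i) ≠ lexKey b K (σ.g (i - 1)))))
      (T₁ := 4 * K + 4) (ite (T₁ := 4 * K + 3) (by simp) (fun he => ?_) (fun he => ?_) le_rfl) ?_
      le_rfl) (by omega)
    · simp only [Cd.holds_lt, Ex.val_get, Ex.val_ofNat, hp] at he
      refine agree (K := K) (r := i - 1) (X := (· ∈ X)) (hX.congr (h1 .kk (by simp))
        (h1 .buf (by simp))) (by omega) (fun ρ k1 => ?_) (by omega)
        (fun ρ k1 k2 k3 k4 k5 => ⟨k1.mono (by simp), k2, k3, ?_⟩) le_rfl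
      · simp [k1 .p (by simp), hp]
      · rw [h1 .buf (by simp), hp, h2] at k5
        have : ρ.M .f 0 = 0 ↔ ¬ ρ.M .f 0 = 1 := by omega
        rw [this, k5]
        simp [he.ne', ← hb]
    · simp only [Cd.holds_lt, Ex.val_get, Ex.val_ofNat, hp] at he
      refine put (by simp) (by simp) (by simp) ⟨(St.Fr.refl _ _).set (by simp) _ _, rfl, rfl, ?_⟩
        (by omega)
      simp; omega
    rintro ρ ⟨k1, k2, k3, k4⟩
    have f1 : St.Fr [.c, .f, .p] σ ρ := h1.trans (k1.mono (by simp))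
    have hp' := k1 .p (by simp)
    refine ite (T₁ := 3 * K + 3) (by simp) (fun he => ?_) (fun he => ?_) (by omega)
    · simp only [Cd.holds_eq, Ex.val_get, Ex.val_ofNat, k4] at he
      refine seq (T₁ := 1) (T₂ := 3 * K + 2) (outRow ?_ le_rfl) (by omega)
      refine forC K (fun j φ => St.Fr [.c] ρ φ ∧ φ.g = σ.g ∧
        φ.out = τ.out ++ (Token.row :: List.ofFn fun l : Fin j => FV i l)) 1 (by omega) ?_ ?_ ?_ ?_
        (by omega)
      · exact ⟨St.Fr.set (τ := ρ.emit _) (St.Fr.refl _ _) (by simp) _ _, by simp [k2, h2],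
          by simp [k3]⟩
      · rintro j φ ⟨l1, -⟩ -
        simp [l1 .kk (by simp), f1 .kk (by simp), hX.kk]
      · rintro j φ hj ⟨l1, l2, l3⟩ hc
        have hbuf := (l1 .buf (by simp)).trans (f1 .buf (by simp))
        have hpp := (l1 .p (by simp)).trans hp'
        refine outVal (by simp) (by simp [hc]; omega) (by simp [hpp, hp]; omega)
          (by simpa [hc, hbuf] using hX.lt j hj) ⟨by simp [hc],
          St.Fr.set (τ := φ.emit _) l1 (by simp) _ _, by simp [l2], ?_⟩ le_rfl
        rw [ofFn_val_succ]
        simp [l3, hFV, hc, hbuf, hpp, hp, l2, ← hb]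
      · rintro φ ⟨l1, l2, l3⟩ -
        refine ⟨by rw [l1 .p (by simp), hp', hp], (f1.trans (l1.mono (by simp))).set (by simp) _ _,
          by simp [l2], ?_⟩
        rw [List.range_succ, List.filter_append, List.map_append, List.flatten_append]
        simp [l3, h3, he]
    · simp only [Cd.holds_eq, Ex.val_get, Ex.val_ofNat, k4] at he
      refine skip ⟨by rw [hp', hp], f1.set (by simp) _ _, by simp [k2, h2], ?_⟩ (by omega)
      rw [List.range_succ, List.filter_append, List.map_append, List.flatten_append]
      simp [k3, h3, he]
  · rintro ρ ⟨k1, k2, k3⟩ -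
    refine hQ ρ T' k1 k2 hT1 ?_
    rw [k3, hT2]

/-- The tables in the list `Ts` are those of the classes of the columns in `rs`, which are in
different classes. -/
structure Lists (attr : Fin m → A) (S : Set (ℕ → D)) (Ts : List (Table A D)) (rs : List ℕ) :
    Prop where
  tables : List.Forall₂ (fun T r => TableOf attr S {c | Insep S r c} T) Ts rs
  lt : ∀ r ∈ rs, r < m
  ne : rs.Pairwise fun r r' => ¬ Insep S r r'

theorem Lists.nil (attr : Fin m → A) (S : Set (ℕ → D)) : Lists attr S [] [] :=
  ⟨.nil, by simp, .nil⟩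

theorem Lists.append {attr : Fin m → A} {S : Set (ℕ → D)} {Ts : List (Table A D)} {rs : List ℕ}
    (h : Lists attr S Ts rs) {T : Table A D} {r : ℕ} (hT : TableOf attr S {c | Insep S r c} T)
    (hr : r < m) (hne : ∀ r' ∈ rs, ¬ Insep S r' r) : Lists attr S (Ts ++ [T]) (rs ++ [r]) := by
  refine ⟨List.rel_append h.tables (.cons hT .nil), ?_, ?_⟩
  · intro x hx
    rcases List.mem_append.1 hx with hx | hx
    exacts [h.lt x hx, by simpa [List.mem_singleton.1 hx] using hr]
  · rw [List.pairwise_append]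
    exact ⟨h.ne, List.pairwise_singleton _ _, fun a ha b hb => by
      rw [List.mem_singleton.1 hb]; exact hne a ha⟩

/-- A constant column splits off alone, so its class is a singleton. -/
theorem insep_iff_eq_of_constAt {S : Set (ℕ → D)} {a b : ℕ} (ha : ConstAt S a) :
    Insep S a b ↔ b = a := by
  refine ⟨fun h => ?_, fun h => h ▸ Insep.refl S b⟩
  have : Split S {a} := by
    intro s hs t ht
    have : mix {a} s t = t := by
      funext x
      by_cases hx : x = a
      · subst hx; simp [mix, ha s hs t ht]
      · simp [mix, hx]
    rwa [this]
  exact (h _ this).1 rfl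

theorem emitConst (ha : Function.Injective ly.attr) (hn0 : 0 < n) (hsz : σ.M .sz 0 = n)
    (hQ : ∀ τ Ts rs, St.Fr [.f, .p, .c, .b, .kk, .buf] σ τ → τ.g = σ.g →
      τ.out = σ.out ++ encodeTables Ts → Lists ly.attr (σ.g '' Set.Iio n) Ts rs →
      (∀ c < m, (∃ r ∈ rs, Insep (σ.g '' Set.Iio n) r c) ↔ ConstAt (σ.g '' Set.Iio n) c) → Q τ)
    (hT : m * (21 * n + 16) + 2 ≤ T) : Runs ly ly.acc.emitConst σ T Q := by
  set S := σ.g '' Set.Iio n with hS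
  refine forC m (fun i τ => St.Fr [.f, .p, .c, .b, .kk, .buf] σ τ ∧ τ.g = σ.g ∧ ∃ Ts rs,
    τ.out = σ.out ++ encodeTables Ts ∧ Lists ly.attr S Ts rs ∧
    ∀ c < m, (∃ r ∈ rs, Insep S r c) ↔ c < i ∧ ConstAt S c) (21 * n + 14) (by omega) ?_ ?_ ?_ ?_ hT
  · exact ⟨(St.Fr.refl _ _).set (by simp) _ _, rfl, [], [], by simp [encodeTables], .nil _ _,
      by simp⟩
  · simp
  · rintro i τ hi ⟨h1, h2, Ts, rs, h3, h4, h5⟩ hb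
    refine seq (T₁ := 4 * n + 3) (T₂ := 17 * n + 11) (nonconst (N := n) (by simp)
      (by rw [h1 .sz (by simp), hsz]) le_rfl (by omega) (fun ρ k1 k2 k3 k4 k5 => ?_) le_rfl)
      (by omega)
    rw [hb, h2, ← constAt_image_iff hn0, ← hS] at k5
    have f1 : St.Fr [.f, .p, .c, .b, .kk, .buf] σ ρ := h1.trans (k1.mono (by simp))
    have hb' := k1 .b (by simp)
    have hstep : ∀ c < m, (c < i + 1 ∧ ConstAt S c) ↔
        (c < i ∧ ConstAt S c) ∨ (c = i ∧ ConstAt S i) := by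
      intro c _
      constructor
      · rintro ⟨h1, h2⟩
        rcases Nat.lt_succ_iff_lt_or_eq.1 h1 with h1 | rfl
        exacts [Or.inl ⟨h1, h2⟩, Or.inr ⟨rfl, h2⟩]
      · rintro (⟨h1, h2⟩ | ⟨rfl, h2⟩)
        exacts [⟨by omega, h2⟩, ⟨by omega, h2⟩]
    refine ite (T₁ := 17 * n + 10) (by simp) (fun he => ?_) (fun he => ?_) le_rfl
    · simp only [Cd.holds_eq, Ex.val_get, Ex.val_ofNat, k5] at he
      refine seq (T₁ := 1) (T₂ := 17 * n + 9) (put (by simp) (by simp) (by simp) ?_ le_rfl)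
        (by omega)
      refine seq (T₁ := 1) (T₂ := 17 * n + 8) (put (by simp) (by simp) (by simp) ?_ le_rfl)
        (by omega)
      simp only [Ex.val_get, Ex.val_ofNat, hb', hb]
      -- The list consists of one constant column, so the rows are sorted by it in any order.
      refine emitTable (N := n) (K := 1) (X := {i}) ha ⟨by simp, by omega, by simp; omega, by simp,
        fun c _ hc => ⟨0, by omega, by simpa using (Set.mem_singleton_iff.1 hc).symm⟩, by omega⟩ (by simp [f1 .sz (by simp), hsz]) le_rfl ?_
        (fun φ T l1 l2 l3 l4 => ?_) (by omega)
      · intro p q hpq hq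
        refine le_of_eq (lexKey_eq_iff.2 fun j hj => ?_)
        obtain rfl : j = 0 := by omega
        simp [k2, h2]
        exact he _ ⟨p, by simp; omega, rfl⟩ _ ⟨q, hq, rfl⟩
      · simp only [St.set_g, k2, h2, ← hS] at l3
        simp only [St.set_out, k3, h3] at l4
        refine ⟨by rw [l1 .b (by simp)]; simp [hb', hb],
          ((((f1.set (by simp) _ _).set (by simp) _ _).trans (l1.mono (by simp))).set (by simp) _ _),
          by simp [l2, k2, h2], Ts ++ [T], rs ++ [i], ?_, h4.append (l3.congr fun c _ => ?_) hi ?_,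
          fun c hc => ?_⟩
        · simp [l4, encodeTables_append, encodeTables_singleton]
        · simp [insep_iff_eq_of_constAt he]
        · intro r hr hri
          have := ((h5 i hi).1 ⟨r, hr, hri⟩).1
          omega
        · rw [hstep c hc, ← h5 c hc]
          simp [or_and_right, exists_or, insep_iff_eq_of_constAt he, he]
    · simp only [Cd.holds_eq, Ex.val_get, Ex.val_ofNat, k5] at he
      refine skip ⟨by rw [hb', hb], f1.set (by simp) _ _, by simp [k2, h2], Ts, rs, by simp [k3, h3],
        h4, fun c hc => ?_⟩ (by omega)
      rw [hstep c hc, ← h5 c hc]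
      simp [he]
  · rintro τ ⟨h1, h2, Ts, rs, h3, h4, h5⟩ -
    exact hQ τ Ts rs h1 h2 h3 h4 fun c hc => by rw [h5 c hc]; simp [hc]

/-- Each remaining class is labelled by exactly one selected column, so a pass over `stk` meets it
once. The labels of classes that were merged into others have become empty and are skipped. -/
theorem emitClasses {L d : ℕ} {Ts₀ : List (Table A D)} {rs₀ : List ℕ} {out₀ : List (Token A D)}
    {S : Set (ℕ → D)} (hS : S = σ.g '' Set.Iio n)
    (ha : Function.Injective ly.attr) (hsz : σ.M .sz 0 = n) (hd : n ≤ 2 ^ d) (hw : σ.M .w 0 = L)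
    (hL : L ≤ m) (hstk : Set.InjOn (σ.M .stk) (Set.Iio L))
    (hcls : ∀ a < m, ∀ b < m, ¬ ConstAt S b →
      (σ.M .lab a = σ.M .lab b ↔ Insep S a b))
    (hcon : ∀ a < m, ConstAt S a → ∀ t < L, σ.M .lab a ≠ σ.M .stk t)
    (hran : ∀ b < m, ¬ ConstAt S b → ∃ t < L, σ.M .lab b = σ.M .stk t)
    (ho : σ.out = out₀ ++ encodeTables Ts₀) (hl : Lists ly.attr S Ts₀ rs₀)
    (hrs : ∀ c < m, (∃ r ∈ rs₀, Insep S r c) ↔ ConstAt S c)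
    (hQ : ∀ τ Ts rs, τ.out = out₀ ++ encodeTables Ts → Lists ly.attr S Ts rs →
      (∀ c < m, ∃ r ∈ rs, Insep S r c) → Q τ)
    (hT : L * (n * (2 * d * (2 * ly.wt + ly.ws + 18) + 2 * ly.ws + 22) + 5 * m + 16) +
      (n * (20 * d + 7) + 3) * m + 2 ≤ T) :
    Runs ly ly.acc.emitClasses σ T Q := by
  set ks : List Nm := [.kk, .b, .buf, .c, .f, .cur, .ch, .chh, .hi, .e, .p, .cl, .t] with hks
  set Kt : ℕ → ℕ := fun t => ((Finset.range m).filter fun c => σ.M .lab c = σ.M .stk t).card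
    with hKt
  refine forR 0 L (fun i τ => St.Fr ks σ τ ∧ PermBelow n σ.g τ.g ∧ ∃ Ts rs,
    τ.out = out₀ ++ encodeTables Ts ∧ Lists ly.attr S Ts rs ∧
    ∀ c < m, (∃ r ∈ rs, Insep S r c) ↔ ConstAt S c ∨ ∃ t < i, σ.M .lab c = σ.M .stk t)
    (fun t => (n * (2 * d * (2 * ly.wt + ly.ws + 18) + 2 * ly.ws + 22) + 5 * m + 14) +
      (n * (20 * d + 7) + 3) * Kt t) (by simp) rfl (by omega) (by omega) ?_ ?_ ?_ ?_ ?_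
  · exact ⟨(St.Fr.refl _ _).set (by simp [hks]) _ _, PermBelow.refl _ _, Ts₀, rs₀, ho, hl,
      fun c hc => by simp [hrs c hc]⟩
  · rintro i τ ⟨h1, -⟩ -
    simp [h1 .w (by simp [hks]), hw]
  · rintro i τ - hi ⟨h1, h2, Ts, rs, h3, h4, h5⟩ ht
    have e1 := h1 .stk (by simp [hks])
    have e2 := h1 .lab (by simp [hks])
    have e3 := h1 .sz (by simp [hks])
    set X := n * (2 * d * (2 * ly.wt + ly.ws + 18) + 2 * ly.ws + 22) + (n * (20 * d + 7) + 3) * Kt i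
      with hX
    refine seq (T₁ := 1) (T₂ := X + 5 * m + 13) (put (by simp) (by simp) (by simp [ht]; omega) ?_
      le_rfl) (by omega)
    simp only [Ex.val_get, Ex.val_ofNat, ht, e1]
    refine seq (T₁ := 5 * m + 3) (T₂ := X + 10) (gather (fun ρ k1 k2 k3 k4 => ?_) le_rfl) (by omega)
    simp only [St.set_M_ne, St.set_M_same, ne_eq, reduceCtorEq, not_false_eq_true, if_true, e2] at k4
    change BufLists ρ _ (Kt i) at k4
    have f1 : St.Fr ks σ ρ := (h1.set (by simp [hks]) _ _).trans (k1.mono (by simp [hks]))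
    have ht' := k1 .t (by simp)
    simp only [St.set_M_ne, ne_eq, reduceCtorEq, not_false_eq_true] at ht'
    have hstep : ∀ c, (ConstAt S c ∨ ∃ t < i + 1, σ.M .lab c = σ.M .stk t) ↔
        (ConstAt S c ∨ ∃ t < i, σ.M .lab c = σ.M .stk t) ∨ σ.M .lab c = σ.M .stk i := by
      intro c
      rw [or_assoc]
      refine or_congr_right ⟨?_, ?_⟩
      · rintro ⟨t, h1, h2⟩
        rcases Nat.lt_succ_iff_lt_or_eq.1 h1 with h1 | rfl
        exacts [Or.inl ⟨t, h1, h2⟩, Or.inr h2]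
      · rintro (⟨t, h1, h2⟩ | h)
        exacts [⟨t, by omega, h2⟩, ⟨i, by omega, h⟩]
    refine ite (T₁ := X + 9) (by simp) (fun he => ?_) (fun he => ?_) (by omega)
    · simp only [Cd.holds_lt, Ex.val_get, Ex.val_ofNat, k4.kk] at he
      refine seq (T₁ := 2 * n * (d * (10 * Kt i + 2 * ly.wt + ly.ws + 18) + ly.ws + 6) + 4)
        (T₂ := n * (7 * Kt i + 10) + 3 * Kt i + 5) (sort (d := d) k4.kk k4.le k4.lt
        (by rw [f1 .sz (by simp [hks]), hsz]) le_rfl hd (fun φ l1 l2 l3 l4 => ?_) le_rfl)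
        (le_of_eq (by rw [hX]; ring))
      have hbuf := l1 .buf (by simp)
      have f2 : St.Fr ks σ φ := f1.trans (l1.mono (by simp [hks]))
      have hper : PermBelow n σ.g φ.g := by
        rw [k2] at l3; exact h2.trans l3
      refine emitTable (N := n) (K := Kt i) (X := {c | σ.M .lab c = σ.M .stk i}) ha
        (k4.congr (l1 .kk (by simp)) hbuf) (by rw [f2 .sz (by simp [hks]), hsz]) le_rfl ?_
        (fun ψ T q1 q2 q3 q4 => ?_) le_rfl
      · rw [hbuf]
        exact fun p q hpq hq => lexKey_le_of_rowKey_le (l4 p q hpq hq)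
      · rw [hper.image_eq le_rfl, ← hS] at q3
        have hr := k4.lt 0 he
        have hr' : σ.M .lab (ρ.M .buf 0) = σ.M .stk i := k4.mem 0 he
        set r := ρ.M .buf 0
        have hrn : ¬ ConstAt S r := fun h => hcon r hr h i hi hr'
        have hcl : ∀ c < m, Insep S r c ↔ σ.M .lab c = σ.M .stk i := fun c hc => by
          rw [← hr', hcls c hc r hr hrn]
          exact ⟨Insep.symm, Insep.symm⟩
        refine ⟨by rw [q1 .t (by simp), l1 .t (by simp), ht', ht], (f2.trans
          (q1.mono (by simp [hks]))).set (by simp [hks]) _ _, by simpa [q2] using hper, Ts ++ [T],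
          rs ++ [r], ?_, h4.append (q3.congr fun c hc => ?_) hr ?_, fun c hc => ?_⟩
        · simp [q4, l2, k3, h3, encodeTables_append, encodeTables_singleton]
        · simp [hcl c hc]
        · intro r' hrs' hi'
          rcases (h5 r hr).1 ⟨r', hrs', hi'⟩ with h | ⟨t, h, h'⟩
          · exact hrn h
          · exact h.ne (hstk (by simp; omega) hi (h'.symm.trans hr'))
        · rw [hstep, ← h5 c hc, ← hcl c hc]
          simp [or_and_right, exists_or]
    · simp only [Cd.holds_lt, Ex.val_get, Ex.val_ofNat, k4.kk] at he
      refine skip ⟨by rw [ht', ht], f1.set (by simp [hks]) _ _, by simpa [k2] using h2, Ts, rs,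
        by simpa [k3] using h3, h4, fun c hc => ?_⟩ (by omega)
      rw [hstep, h5 c hc]
      have : ¬ σ.M .lab c = σ.M .stk i := fun h => by
        obtain ⟨j, hj, -⟩ := k4.cover c hc h
        omega
      simp [this]
  · rintro τ ⟨-, -, Ts, rs, h3, h4, h5⟩ -
    refine hQ τ Ts rs h3 h4 fun c hc => (h5 c hc).2 ?_
    by_cases h : ConstAt S c
    exacts [Or.inl h, Or.inr (hran c hc h)]
  · have hsum := sum_card_filter_le (m := m) (lab := σ.M .lab) (j := 0) hstk
    refine le_trans ?_ hT
    have h0 := Finset.sum_const (s := Finset.Ico 0 L)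
      (n * (2 * d * (2 * ly.wt + ly.ws + 18) + 2 * ly.ws + 22) + 5 * m + 16)
    rw [Nat.card_Ico, smul_eq_mul, Nat.sub_zero] at h0
    have h1 := Nat.mul_le_mul_left (n * (20 * d + 7) + 3) hsum
    rw [Finset.mul_sum] at h1
    rw [← h0]
    refine Nat.add_le_add_right (le_trans (le_of_eq ?_) (Nat.add_le_add_left h1 _)) 2
    rw [← Finset.sum_add_distrib]
    exact Finset.sum_congr rfl fun t _ => by simp only [hKt]; ring

theorem emitAll {L d : ℕ} {S : Set (ℕ → D)} (hS : S = σ.g '' Set.Iio n)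
    (ha : Function.Injective ly.attr) (hn0 : 0 < n) (hd : n ≤ 2 ^ d) (hw : σ.M .w 0 = L)
    (hL : L ≤ m) (hstk : Set.InjOn (σ.M .stk) (Set.Iio L))
    (hcls : ∀ a < m, ∀ b < m, ¬ ConstAt S b → (σ.M .lab a = σ.M .lab b ↔ Insep S a b))
    (hcon : ∀ a < m, ConstAt S a → ∀ t < L, σ.M .lab a ≠ σ.M .stk t)
    (hran : ∀ b < m, ¬ ConstAt S b → ∃ t < L, σ.M .lab b = σ.M .stk t)
    (hQ : ∀ τ Ts rs, τ.out = σ.out ++ encodeTables Ts → Lists ly.attr S Ts rs →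
      (∀ c < m, ∃ r ∈ rs, Insep S r c) → Q τ)
    (hT : L * (n * (2 * d * (2 * ly.wt + ly.ws + 18) + 2 * ly.ws + 22) + 5 * m + 16) +
      (n * (20 * d + 7) + 3) * m + m * (21 * n + 16) + 5 ≤ T) :
    Runs ly ly.acc.emitAll σ T Q := by
  refine seq (T₁ := 1) (T₂ := (m * (21 * n + 16) + 2) + (L * (n * (2 * d * (2 * ly.wt + ly.ws + 18) +
    2 * ly.ws + 22) + 5 * m + 16) + (n * (20 * d + 7) + 3) * m + 2)) (put (by simp) (by simp)
    (by simp) ?_ le_rfl) (by omega)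
  refine seq (emitConst ha hn0 (by simp) (fun τ Ts rs h1 h2 h3 h4 h5 => ?_) le_rfl) le_rfl
  simp only [Ex.val_ofNat, Ex.val_size, St.set_g, St.set_out, ← hS] at h1 h2 h3 h4 h5
  have e1 := h1 .w (by simp)
  have e2 := h1 .lab (by simp)
  have e3 := h1 .stk (by simp)
  have e4 := h1 .sz (by simp)
  simp only [St.set_M_ne, ne_eq, reduceCtorEq, not_false_eq_true] at e1 e2 e3
  refine emitClasses (S := S) (L := L) (d := d) (by rw [h2, hS]) ha (by simp [e4]) hd (by rw [e1, hw])
    hL ?_ ?_ ?_ ?_ h3 h4 h5 hQ le_rfl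
  all_goals simpa only [e2, e3]

end Runs

end PrimeFact

/-! ### The complete computation, and its meaning for tables and relations -/

namespace PrimeFact

section

variable {A : Type u} {D : Type v} [LinearOrder D] {m n : ℕ}

/-- The computation of the prime factorization. -/
def Acc.factorize (acc : Acc) : Stmt := acc.down ;; acc.up ;; acc.emitAll

namespace Runs

variable {ly : Layer A D m n (Lex (Fin m → D))} {σ : St A D m n} {Q : St A D m n → Prop} {T : ℕ}

/-- The number `L` of selections is known only after the descent, so the time must suffice for every
`L` that the two bounds on chains allow. -/
theorem factorize {d : ℕ} (htk : ly.tk = lexKey id m) (ha : Function.Injective ly.attr)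
    (hm0 : 0 < m) (hn0 : 0 < n) (hinj : Set.InjOn σ.g (Set.Iio n))
    (hm : ∀ p < n, ∀ q < n, ∀ c, m ≤ c → σ.g p c = σ.g q c) (hd : n ≤ 2 ^ d)
    (hQ : ∀ τ Ts rs, τ.out = σ.out ++ encodeTables Ts →
      Lists ly.attr (σ.g '' Set.Iio n) Ts rs →
      (∀ c < m, ∃ r ∈ rs, Insep (σ.g '' Set.Iio n) r c) → Q τ)
    (hT : ∀ L ≤ m, L ≤ Nat.log 2 (n + 1) → (3 * m + 2 * n * (57 * m + 2 * ly.ws + 1) + 7) +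
      ((2 * n * (L * (2 * d * (2 * ly.wt + ly.ws + 18) + 2 * ly.ws + 15 * m + 43) +
        (20 * d + 4) * m) + 6 * L + 1) +
      (L * (n * (2 * d * (2 * ly.wt + ly.ws + 18) + 2 * ly.ws + 22) + 5 * m + 16) +
        (n * (20 * d + 7) + 3) * m + m * (21 * n + 16) + 5)) ≤ T) :
    Runs ly ly.acc.factorize σ T Q := by
  set T₂ := T - (3 * m + 2 * n * (57 * m + 2 * ly.ws + 1) + 7) with hT₂
  have h0 := hT 0 (by omega) (by omega)
  refine seq (T₁ := 3 * m + 2 * n * (57 * m + 2 * ly.ws + 1) + 7) (T₂ := T₂)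
    (down hm0 hn0 (fun τ L h hw hL => ?_) le_rfl) (by omega)
  obtain ⟨h1, h2, h3, h4, h5, h6⟩ := h
  have himg : τ.g '' Set.Iio n = σ.g '' Set.Iio n := h1.image_eq le_rfl
  have hLm := h5.le_arity
  have hLn := h5.le_log
  rw [h4] at hLn
  have hTL := hT L hLm hLn
  have hm' : ∀ p < n, ∀ q < n, ∀ c, m ≤ c → τ.g p c = τ.g q c := by
    intro p hp q hq c hc
    obtain ⟨p', hp', e1⟩ := h1.exists_eq hp
    obtain ⟨q', hq', e2⟩ := h1.exists_eq hq
    rw [e1, e2]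
    exact hm p' hp' q' hq' c hc
  refine seq (T₁ := 2 * n * (L * (2 * d * (2 * ly.wt + ly.ws + 18) + 2 * ly.ws + 15 * m + 43) +
        (20 * d + 4) * m) + 6 * L + 1) (T₂ := L * (n * (2 * d * (2 * ly.wt + ly.ws + 18) +
        2 * ly.ws + 22) + 5 * m + 16) + (n * (20 * d + 7) + 3) * m + m * (21 * n + 16) + 5)
    (up (d := d) htk hn0 (h1.injOn hinj) hm' hd h4 h3 hw h5 h6 hL (fun ρ k => ?_) le_rfl) (by omega)
  have k9 := k.lab
  have hS : τ.g '' Set.Iio (τ.M .nn 0) = σ.g '' Set.Iio n := by rw [h4, himg]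
  refine emitAll (L := L) (d := d) (S := σ.g '' Set.Iio n) ?_ ha hn0 hd (by rw [k.w, hw]) hLm
    (by rw [k.stk]; exact h5.injOn) ?_ ?_ ?_ (fun φ Ts rs e1 e2 e3 => ?_) le_rfl
  · rw [← himg]; exact (k.perm.image_eq le_rfl).symm
  · intro a ha b hb hbc
    rw [← hS] at hbc ⊢
    exact k9.lab_eq_iff h5 ha hb hbc
  · intro a ha hac t ht
    rw [← hS] at hac
    rw [k.stk]
    exact k9.ne_stk_of_constAt h5 ha hac (Nat.zero_le _) ht
  · intro b hb hbc
    rw [← hS] at hbc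
    obtain ⟨i, -, h⟩ := k9.range b hb hbc
    rw [k.stk]
    exact ⟨i, h⟩
  · exact hQ φ Ts rs (by rw [e1, k.out, h2]) e2 e3

end Runs

end

/-! ## Tables and relations -/

namespace Table

variable {A : Type u} {D : Type v} {T : Table A D} {R : Reln A D}

theorem Represents.arity_eq (h : T.Represents R) : R.arity = T.arity := by
  classical
  have : R.sch = Finset.univ.image T.attr := by
    ext a
    simp [h.1 a]
  rw [Reln.arity, this, Finset.card_image_of_injective _ T.attr_injective, Finset.card_fin]

theorem Represents.attr_mem (h : T.Represents R) (j : Fin T.arity) : T.attr j ∈ R.sch :=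
  (h.1 _).2 ⟨j, rfl⟩

theorem Represents.exists_tuple (h : T.Represents R) (s : Fin T.arity → D) :
    ∃ t : A → D, ∀ j, t (T.attr j) = s j := by
  classical
  obtain ⟨a, ha⟩ := R.sch_nonempty
  obtain ⟨j₀, -⟩ := (h.1 a).1 ha
  refine ⟨fun a => if h : ∃ j, T.attr j = a then s h.choose else s j₀, fun j => ?_⟩
  have hex : ∃ k, T.attr k = T.attr j := ⟨j, rfl⟩
  simp only [dif_pos hex]
  rw [T.attr_injective hex.choose_spec]

theorem Represents.size_eq (h : T.Represents R) : R.size = T.size := by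
  classical
  choose f hf using h.exists_tuple
  have key : R.tuples = Finset.univ.image fun i : Fin T.size => fun a : R.sch => f (T.rows i) a := by
    ext u
    obtain ⟨t, rfl⟩ := R.exists_extend u
    simp only [Finset.mem_image, Finset.mem_univ, true_and]
    change R.Has t ↔ _
    rw [h.2]
    refine exists_congr fun i => ⟨fun hi => funext fun a => ?_, fun hi j => ?_⟩
    · obtain ⟨j, hj⟩ := (h.1 a).1 a.2
      rw [← hj, hf, hi]
    · rw [← hf (T.rows i) j]
      exact (congrFun hi ⟨_, h.attr_mem j⟩).symm
  rw [Reln.size, key, Finset.card_image_of_injective, Finset.card_fin]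
  intro i j hij
  refine T.rows_injective (funext fun k => ?_)
  rw [← hf (T.rows i) k, ← hf (T.rows j) k]
  exact congrFun hij ⟨_, h.attr_mem k⟩

open scoped Classical in
/-- The rows of a table, with default values beyond the table. -/
noncomputable def rowsNat (T : Table A D) (d : D) (p c : ℕ) : D :=
  if h : p < T.size ∧ c < T.arity then T.rows ⟨p, h.1⟩ ⟨c, h.2⟩ else d

theorem rowsNat_of_lt (d : D) (p : Fin T.size) (c : Fin T.arity) :
    T.rowsNat d p c = T.rows p c := by simp [rowsNat]

theorem rowsNat_of_le (d : D) (p : ℕ) {c : ℕ} (hc : T.arity ≤ c) : T.rowsNat d p c = d := by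
  rw [rowsNat, dif_neg (by omega)]

theorem rowsNat_injOn (d : D) : Set.InjOn (T.rowsNat d) (Set.Iio T.size) := by
  intro p hp q hq h
  have : (⟨p, hp⟩ : Fin T.size) = ⟨q, hq⟩ := T.rows_injective <| funext fun c => by
    rw [← rowsNat_of_lt d, ← rowsNat_of_lt d]
    exact congrFun h c
  exact congrArg Fin.val this

variable {d : D}

theorem Represents.has_iff (h : T.Represents R) (t : A → D) :
    R.Has t ↔ ∃ s ∈ T.rowsNat d '' Set.Iio T.size, ∀ j : Fin T.arity, t (T.attr j) = s j := by
  rw [h.2]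
  constructor
  · rintro ⟨i, hi⟩
    exact ⟨_, ⟨i, i.2, rfl⟩, fun j => by rw [rowsNat_of_lt, hi]⟩
  · rintro ⟨_, ⟨p, hp, rfl⟩, h⟩
    exact ⟨⟨p, hp⟩, fun j => by rw [h]; exact rowsNat_of_lt d ⟨p, hp⟩ j⟩

/-- Mixing commutes with reading off the columns of the table; beyond the last column all rows have
the same default value. -/
theorem Represents.split_iff (h : T.Represents R) (Z : Set A) :
    Split R.cyl Z ↔
      Split (T.rowsNat d '' Set.Iio T.size) {c | ∃ j : Fin T.arity, (j : ℕ) = c ∧ T.attr j ∈ Z} := by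
  set S := T.rowsNat d '' Set.Iio T.size with hS
  set X : Set ℕ := {c | ∃ j : Fin T.arity, (j : ℕ) = c ∧ T.attr j ∈ Z} with hX
  have hXj : ∀ j : Fin T.arity, (j : ℕ) ∈ X ↔ T.attr j ∈ Z := fun j =>
    ⟨fun ⟨k, hk, hk'⟩ => Fin.ext hk ▸ hk', fun hj => ⟨j, rfl, hj⟩⟩
  have hd : ∀ s ∈ S, ∀ c, T.arity ≤ c → s c = d := by
    rintro _ ⟨p, -, rfl⟩ c hc
    exact rowsNat_of_le d p hc
  have hmix : ∀ (t t' : A → D) (s s' : ℕ → D), (∀ j : Fin T.arity, t (T.attr j) = s j) →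
      (∀ j : Fin T.arity, t' (T.attr j) = s' j) →
      ∀ j : Fin T.arity, mix Z t t' (T.attr j) = mix X s s' j := by
    intro t t' s s' h1 h2 j
    by_cases hj : T.attr j ∈ Z
    · rw [mix_of_mem hj, mix_of_mem ((hXj j).2 hj), h1]
    · rw [mix_of_notMem hj, mix_of_notMem (fun h => hj ((hXj j).1 h)), h2]
  constructor
  · intro hZ s hs s' hs'
    obtain ⟨t, ht⟩ := h.exists_tuple fun j => s j
    obtain ⟨t', ht'⟩ := h.exists_tuple fun j => s' j
    obtain ⟨s'', hs'', he⟩ := (h.has_iff _).1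
      (hZ t ((h.has_iff (d := d) t).2 ⟨s, hs, ht⟩) t' ((h.has_iff (d := d) t').2 ⟨s', hs', ht'⟩))
    convert hs'' using 1
    funext c
    rcases Nat.lt_or_ge c T.arity with hc | hc
    · rw [← he ⟨c, hc⟩, hmix t t' s s' ht ht' ⟨c, hc⟩]
    · rw [hd s'' hs'' c hc]
      by_cases hcX : c ∈ X
      · rw [mix_of_mem hcX, hd s hs c hc]
      · rw [mix_of_notMem hcX, hd s' hs' c hc]
  · intro hX' t ht t' ht'
    obtain ⟨s, hs, e⟩ := (h.has_iff (d := d) t).1 ht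
    obtain ⟨s', hs', e'⟩ := (h.has_iff (d := d) t').1 ht'
    exact (h.has_iff (d := d) _).2 ⟨_, hX' s hs s' hs', hmix t t' s s' e e'⟩

/-- Sets of attributes and sets of columns correspond up to what lies outside the schema and beyond
the table. Columns beyond the table are constant, so they do not influence splitting. -/
theorem Represents.insep_iff (h : T.Represents R) (i j : Fin T.arity) :
    Insep R.cyl (T.attr i) (T.attr j) ↔ Insep (T.rowsNat d '' Set.Iio T.size) (i : ℕ) j := by
  constructor
  · intro hi X hX
    have hmem : ∀ k : Fin T.arity, T.attr k ∈ {a | ∃ j : Fin T.arity, (j : ℕ) ∈ X ∧ T.attr j = a} ↔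
        (k : ℕ) ∈ X := fun k =>
      ⟨fun ⟨l, hl, he⟩ => T.attr_injective he ▸ hl, fun hk => ⟨k, hk, rfl⟩⟩
    rw [← hmem i, ← hmem j]
    refine hi _ ((h.split_iff (d := d) _).2 ?_)
    refine supportedOn_of_constAt (F := Finset.range T.arity) (fun c hc => ?_) X _ (fun c hc => ?_) hX
    · rintro _ ⟨p, -, rfl⟩ _ ⟨q, -, rfl⟩
      simp only [Finset.mem_range, not_lt] at hc
      rw [rowsNat_of_le d p hc, rowsNat_of_le d q hc]
    · have hc := Finset.mem_range.1 hc
      constructor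
      · exact fun hcX => ⟨⟨c, hc⟩, rfl, (hmem ⟨c, hc⟩).2 hcX⟩
      · rintro ⟨k, rfl, hk⟩
        exact (hmem k).1 hk
  · intro hi Z hZ
    have := hi _ ((h.split_iff (d := d) Z).1 hZ)
    have hmem : ∀ k : Fin T.arity, (k : ℕ) ∈ {c | ∃ j : Fin T.arity, (j : ℕ) = c ∧ T.attr j ∈ Z} ↔
        T.attr k ∈ Z := fun k =>
      ⟨fun ⟨l, hl, he⟩ => Fin.ext hl ▸ he, fun hk => ⟨k, rfl, hk⟩⟩
    rwa [hmem, hmem] at this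

/-- The emitted tables represent the prime factorization. -/
theorem Represents.exists_factors (h : T.Represents R) (hne : R.tuples.Nonempty)
    {Ts : List (Table A D)} {rs : List ℕ}
    (hl : Runs.Lists T.attr (T.rowsNat d '' Set.Iio T.size) Ts rs)
    (hcov : ∀ c < T.arity, ∃ r ∈ rs, Insep (T.rowsNat d '' Set.Iio T.size) r c) :
    ∃ Fs : List (Reln A D), List.Forall₂ Table.Represents Ts Fs ∧ Fs.Nodup ∧
      R.IsPrimeFactorization {F | F ∈ Fs} := by
  classical
  set S := T.rowsNat d '' Set.Iio T.size with hS
  set P : Fin T.arity → Reln A D := fun j =>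
    R.proj (R.cls (T.attr j)) (Reln.cls_nonempty (h.attr_mem j)) (R.cls_subset _) with hP
  set F : ℕ → Reln A D := fun r => if hr : r < T.arity then P ⟨r, hr⟩ else R with hF
  have hFr : ∀ j : Fin T.arity, F j = P j := fun j => by simp [hF]
  refine ⟨rs.map F, ?_, ?_, ?_⟩
  · rw [List.forall₂_map_right_iff]
    refine List.Forall₂.imp (R := fun T' r => r ∈ rs ∧
      TableOf T.attr S {c | Insep S r c} T') ?_ ?_
    · rintro T' r ⟨hr, h1, h2⟩
      obtain ⟨j, rfl⟩ : ∃ j : Fin T.arity, (j : ℕ) = r := ⟨⟨r, hl.lt r hr⟩, rfl⟩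
      rw [hFr]
      have hmemP : ∀ k : Fin T.arity, T.attr k ∈ R.cls (T.attr j) ↔ Insep S (j : ℕ) k := by
        intro k
        rw [Reln.mem_cls, h.insep_iff (d := d) j k]
        simp [h.attr_mem k, hS]
      refine ⟨fun a => ?_, fun t => ?_⟩
      · change a ∈ R.cls (T.attr j) ↔ _
        rw [h1 a]
        constructor
        · intro ha
          obtain ⟨k, rfl⟩ := (h.1 a).1 (R.cls_subset _ ha)
          exact ⟨k, (hmemP k).1 ha, rfl⟩
        · rintro ⟨k, hk, rfl⟩
          exact (hmemP k).2 hk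
      · rw [h2 t, Reln.proj_has]
        constructor
        · rintro ⟨s, hs, he⟩
          obtain ⟨s', hs', he'⟩ := (h.has_iff (d := d) s).1 hs
          refine ⟨s', hs', fun c hc => ?_⟩
          rw [← he _ ((hmemP c).2 hc), he' c]
        · rintro ⟨s, hs, he⟩
          obtain ⟨t', ht'⟩ := h.exists_tuple fun j => s j
          refine ⟨t', (h.has_iff (d := d) t').2 ⟨s, hs, ht'⟩, fun a ha => ?_⟩
          obtain ⟨k, rfl⟩ := (h.1 a).1 (R.cls_subset _ ha)
          rw [ht' k, he k ((hmemP k).1 ha)]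
    · have := hl.tables
      rw [List.forall₂_iff_get] at this ⊢
      exact ⟨this.1, fun i h₁ h₂ => ⟨List.get_mem _ _, this.2 i h₁ h₂⟩⟩
  · rw [List.Nodup, List.pairwise_map]
    refine hl.ne.imp_of_mem fun {r r'} hr hr' hn he => hn ?_
    obtain ⟨i, rfl⟩ : ∃ j : Fin T.arity, (j : ℕ) = r := ⟨⟨r, hl.lt r hr⟩, rfl⟩
    obtain ⟨j, rfl⟩ : ∃ j : Fin T.arity, (j : ℕ) = r' := ⟨⟨r', hl.lt r' hr'⟩, rfl⟩
    rw [hFr, hFr] at he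
    have hs : R.cls (T.attr i) = R.cls (T.attr j) := congrArg Reln.sch he
    have hj : T.attr j ∈ R.cls (T.attr i) := by
      rw [hs, Reln.mem_cls]
      exact ⟨h.attr_mem j, Insep.refl _ _⟩
    exact (h.insep_iff i j).1 (Reln.mem_cls.1 hj).2
  · rw [Reln.isPrimeFactorization_iff (Reln.exists_has hne)]
    ext G
    simp only [List.mem_map, Set.mem_ofPred_eq]
    constructor
    · rintro ⟨r, hr, rfl⟩
      obtain ⟨j, rfl⟩ : ∃ j : Fin T.arity, (j : ℕ) = r := ⟨⟨r, hl.lt r hr⟩, rfl⟩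
      exact ⟨T.attr j, h.attr_mem j, hFr j⟩
    · rintro ⟨a, ha, rfl⟩
      obtain ⟨j, rfl⟩ := (h.1 a).1 ha
      obtain ⟨r, hr, hi⟩ := hcov j j.2
      obtain ⟨i, rfl⟩ : ∃ j : Fin T.arity, (j : ℕ) = r := ⟨⟨r, hl.lt r hr⟩, rfl⟩
      refine ⟨i, hr, ?_⟩
      rw [hFr]
      simp only [hP]
      congr 1
      exact Reln.cls_eq ((h.insep_iff i j).2 hi)

end Table

end PrimeFact

/-! ### The two implementations of row access on the machine -/

namespace PrimeFact

variable {A : Type u} {D : Type v} [LinearOrder D] {m n : ℕ} {κ : Type w} [LinearOrder κ]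

/-- The named arrays and the output agree. -/
structure Agrees (st : State A D m n) (σ : St A D m n) : Prop where
  mem : ∀ (x : Nm) i, st.mem (64 * i + x.code) = σ.M x i
  out : st.out = σ.out

namespace Agrees

variable {st : State A D m n} {σ : St A D m n}

theorem set (h : Agrees st σ) (x : Nm) (i k : ℕ) :
    Agrees { st with mem := Function.update st.mem (64 * i + x.code) k } (σ.set x i k) := by
  refine ⟨fun y j => ?_, h.out⟩
  by_cases hy : y = x
  · subst hy
    by_cases hj : j = i
    · subst hj; simp
    · change Function.update st.mem _ k _ = _
      rw [Function.update_of_ne (fun he => hj (Nm.addr_eq_iff.1 he).2)]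
      simp [hj, h.mem]
  · change Function.update st.mem _ k _ = _
    rw [Function.update_of_ne (fun he => hy (Nm.addr_eq_iff.1 he).1)]
    simp [hy, h.mem]

theorem emit (h : Agrees st σ) (l : List (Token A D)) :
    Agrees { st with out := st.out ++ l } (σ.emit l) := ⟨h.mem, by simp [h.out]⟩

/-- Cells with residues from 60 on belong to no named array and may be overwritten. -/
theorem of_mem (h : Agrees st σ) {mem : ℕ → ℕ} (hm : ∀ a, a % 64 < 60 → mem a = st.mem a) :
    Agrees { st with mem := mem } σ := by
  refine ⟨fun x i => ?_, h.out⟩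
  have := x.code_lt
  rw [← h.mem]
  exact hm _ (by omega)

theorem of_rows (h : Agrees st σ) {rows : Fin n → Fin m → D} {p q : ℕ} :
    Agrees { st with rows := rows } (σ.swap p q) := ⟨h.mem, h.out⟩

end Agrees

theorem exec_store {attr : Fin m → A} {L : Limits} {st : State A D m n} {a e : Expr} {i k : ℕ}
    (ha : a.Safe L st) (hi : a.val st = i) (hc : i < L.cells) (he : e.Safe L st)
    (hk : e.val st = k) :
    Exec attr L (.store a e) st 1 { st with mem := Function.update st.mem i k } := by
  subst hi hk
  exact .store st a e ha hc he

/-! ### Exchanging rows in storage -/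

section Perm

/-- The loop of `lexTie`. -/
def lexLoop (p q : Expr) : Stmt :=
  .loop (.mul (.lt (.load (.lit 60)) .arity) (.eq (.load (.lit 61)) (.lit 2)))
    (.ite (.valLT p (.load (.lit 60)) q (.load (.lit 60))) (.store (.lit 61) (.lit 1))
      (.ite (.valLT q (.load (.lit 60)) p (.load (.lit 60))) (.store (.lit 61) (.lit 0)) .skip) ;;
      .store (.lit 60) (.add (.load (.lit 60)) (.lit 1)))

/-- Comparison of two rows in lexicographic order. -/
def lexTie (d p q : Expr) : Stmt :=
  .store (.lit 60) (.lit 0) ;; .store (.lit 61) (.lit 2) ;; lexLoop p q ;;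
  .ite (.eq (.load (.lit 61)) (.lit 1)) (.store d (.lit 1)) (.store d (.lit 0))

/-- Access to rows by exchanging them in storage. -/
def permAcc : Acc := ⟨id, .swap, lexTie⟩

/-- Cell 60 holds the current column and cell 61 the verdict, where 2 means undecided; `k` columns
remain. The hypothesis `H` says that the expressions for the two rows do not depend on these cells.
-/
theorem exec_lexLoop (attr : Fin m → A) {L : Limits} {st : State A D m n} {p q : Expr}
    {ip iq : Fin n} (hL : m + 61 < L.maxWord) (hL' : 64 ≤ L.cells)
    (H : ∀ mem : ℕ → ℕ, (∀ a, a ≠ 60 → a ≠ 61 → mem a = st.mem a) →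
      (p.Safe L { st with mem := mem } ∧ p.val { st with mem := mem } = ip) ∧
      (q.Safe L { st with mem := mem } ∧ q.val { st with mem := mem } = iq)) :
    ∀ k c, c + k = m → ∀ mem : ℕ → ℕ, (∀ a, a ≠ 60 → a ≠ 61 → mem a = st.mem a) →
      mem 60 = c → mem 61 = 2 → (∀ j : Fin m, (j : ℕ) < c → st.rows ip j = st.rows iq j) →
      ∃ t ≤ 5 * k + 1, ∃ mem' : ℕ → ℕ, (∀ a, a ≠ 60 → a ≠ 61 → mem' a = st.mem a) ∧
        Exec attr L (lexLoop p q) { st with mem := mem } t { st with mem := mem' } ∧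
        (mem' 61 = 1 ↔ ∃ i : Fin m, (∀ j : Fin m, j < i → st.rows ip j = st.rows iq j) ∧
          st.rows ip i < st.rows iq i) := by
  intro k
  have hsafe : ∀ mem : ℕ → ℕ, (Expr.mul (.lt (.load (.lit 60)) .arity)
      (.eq (.load (.lit 61)) (.lit 2))).Safe L { st with mem := mem } := by
    intro mem
    simp only [Expr.Safe, Expr.val]
    refine ⟨⟨⟨by omega, by omega⟩, by omega⟩, ⟨⟨by omega, by omega⟩, by omega⟩, ?_⟩
    have hite : ∀ P : Prop, ∀ _ : Decidable P, (if P then 1 else 0) ≤ 1 := by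
      intro P _; split_ifs <;> omega
    exact (Nat.mul_le_mul (hite _ _) (hite _ _)).trans (by omega)
  induction k with
  | zero =>
    intro c hc mem h1 h2 h3 h4
    refine ⟨1, le_rfl, mem, h1, .loopDone _ _ _ (hsafe mem) ?_, ?_⟩
    · simp [Expr.val, h2]; omega
    · simp only [h3, OfNat.ofNat_ne_one, false_iff, not_exists, not_and]
      intro i _
      exact (h4 i (by have := i.2; omega)).ge.not_gt
  | succ k ih =>
    intro c hc mem h1 h2 h3 h4
    have hcm : c < m := by omega
    obtain ⟨⟨hp1, hp2⟩, hq1, hq2⟩ := H mem h1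
    have hpn := ip.2
    have hqn := iq.2
    have hcond : (Expr.mul (.lt (.load (.lit 60)) .arity)
        (.eq (.load (.lit 61)) (.lit 2))).val { st with mem := mem } ≠ 0 := by
      simp [Expr.val, h2, h3, hcm]
    have hload : (Expr.load (.lit 60)).Safe L { st with mem := mem } := by
      simp [Expr.Safe, Expr.val]; omega
    have hvs₁ : (Expr.valLT p (.load (.lit 60)) q (.load (.lit 60))).Safe L { st with mem := mem } :=
      ⟨hp1, hload, hq1, hload, by omega, by simpa [Expr.val, h2], by omega, by simpa [Expr.val, h2]⟩
    have hvs₂ : (Expr.valLT q (.load (.lit 60)) p (.load (.lit 60))).Safe L { st with mem := mem } :=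
      ⟨hq1, hload, hp1, hload, by omega, by simpa [Expr.val, h2], by omega, by simpa [Expr.val, h2]⟩
    have hv₁ : (Expr.valLT p (.load (.lit 60)) q (.load (.lit 60))).val { st with mem := mem } ≠ 0 ↔
        st.rows ip ⟨c, hcm⟩ < st.rows iq ⟨c, hcm⟩ := by
      simp [Expr.val, hp2, hq2, h2, hcm]
    have hv₂ : (Expr.valLT q (.load (.lit 60)) p (.load (.lit 60))).val { st with mem := mem } ≠ 0 ↔
        st.rows iq ⟨c, hcm⟩ < st.rows ip ⟨c, hcm⟩ := by
      simp [Expr.val, hp2, hq2, h2, hcm]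
    have hinc : ∀ mem' : ℕ → ℕ, mem' 60 = c → Exec attr L
        (.store (.lit 60) (.add (.load (.lit 60)) (.lit 1))) { st with mem := mem' } 1
        { st with mem := Function.update mem' 60 (c + 1) } := by
      intro mem' h
      refine exec_store (st := { st with mem := mem' }) ?_ rfl ?_ ?_ ?_
      · simp [Expr.Safe]; omega
      · omega
      · simp [Expr.Safe, Expr.val, h]; omega
      · simp [Expr.val, h]
    have hset : ∀ v, v ≤ 1 → Exec attr L (.store (.lit 61) (.lit v)) { st with mem := mem } 1
        { st with mem := Function.update mem 61 v } := by
      intro v hv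
      refine exec_store (st := { st with mem := mem }) ?_ rfl ?_ ?_ rfl
      · simp [Expr.Safe]; omega
      · omega
      · simp [Expr.Safe]; omega
    have hfin : ∀ v, v ≤ 1 → ∀ t ≤ 3, Exec attr L
        (.ite (.valLT p (.load (.lit 60)) q (.load (.lit 60))) (.store (.lit 61) (.lit 1))
          (.ite (.valLT q (.load (.lit 60)) p (.load (.lit 60))) (.store (.lit 61) (.lit 0)) .skip))
          { st with mem := mem } t { st with mem := Function.update mem 61 v } →
        (v = 1 ↔ ∃ i : Fin m, (∀ j : Fin m, j < i → st.rows ip j = st.rows iq j) ∧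
          st.rows ip i < st.rows iq i) →
        ∃ t ≤ 5 * (k + 1) + 1, ∃ mem' : ℕ → ℕ, (∀ a, a ≠ 60 → a ≠ 61 → mem' a = st.mem a) ∧
        Exec attr L (lexLoop p q) { st with mem := mem } t { st with mem := mem' } ∧
        (mem' 61 = 1 ↔ ∃ i : Fin m, (∀ j : Fin m, j < i → st.rows ip j = st.rows iq j) ∧
          st.rows ip i < st.rows iq i) := by
      intro v hv t ht hex hiff
      refine ⟨(t + 1) + 1 + 1, by omega, Function.update (Function.update mem 61 v) 60 (c + 1), ?_,
        .loopStep _ _ _ _ _ (t + 1) 1 (hsafe mem) hcond (.seq _ _ _ _ _ _ _ hex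
          (hinc _ (by simp [h2]))) (.loopDone _ _ _ (hsafe _) ?_), ?_⟩
      · intro a h60 h61
        simp [h60, h61, h1]
      · have : v ≠ 2 := by omega
        simp [Expr.val, this]
      · simpa using hiff
    by_cases hlt : st.rows ip ⟨c, hcm⟩ < st.rows iq ⟨c, hcm⟩
    · refine hfin 1 (by omega) 2 (by omega) (.iteTrue _ _ _ _ _ _ hvs₁ (hv₁.2 hlt)
        (hset 1 le_rfl)) ?_
      simp only [true_iff]
      exact ⟨⟨c, hcm⟩, fun j hj => h4 j hj, hlt⟩
    by_cases hgt : st.rows iq ⟨c, hcm⟩ < st.rows ip ⟨c, hcm⟩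
    · refine hfin 0 (by omega) 3 (by omega) (.iteFalse _ _ _ _ _ _ hvs₁
        (not_ne_iff.1 (hv₁.not.2 hlt)) (.iteTrue _ _ _ _ _ _ hvs₂ (hv₂.2 hgt)
        (hset 0 (by omega)))) ?_
      simp only [zero_ne_one, false_iff, not_exists, not_and]
      intro i hi
      rcases lt_trichotomy (i : ℕ) c with h | h | h
      · exact (h4 i h).ge.not_gt
      · have : i = ⟨c, hcm⟩ := Fin.ext h
        rw [this]; exact hgt.not_gt
      · exact absurd (hi ⟨c, hcm⟩ h) hgt.ne'
    · have heq : st.rows ip ⟨c, hcm⟩ = st.rows iq ⟨c, hcm⟩ :=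
        le_antisymm (not_lt.1 hgt) (not_lt.1 hlt)
      obtain ⟨t, ht, mem', k1, k2, k3⟩ := ih (c + 1) (by omega) (Function.update mem 60 (c + 1))
        (fun a h60 h61 => by simp [h60, h1 a h60 h61]) (by simp) (by simp [h3]) (fun j hj => by
          rcases Nat.lt_succ_iff_lt_or_eq.1 hj with h | h
          · exact h4 j h
          · rwa [show j = ⟨c, hcm⟩ from Fin.ext h])
      exact ⟨(3 + 1) + t + 1, by omega, mem', k1, .loopStep _ _ _ _ _ (3 + 1) t (hsafe mem)
        hcond (.seq _ _ _ _ _ 3 1 (.iteFalse _ _ _ _ _ 2 hvs₁ (not_ne_iff.1 (hv₁.not.2 hlt))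
          (.iteFalse _ _ _ _ _ 1 hvs₂ (not_ne_iff.1 (hv₂.not.2 hgt)) (.skip _)))
          (hinc mem h2)) k2, k3⟩

open scoped Classical in
theorem exec_lexTie (attr : Fin m → A) {L : Limits} {st : State A D m n} {d p q : Expr} {a : ℕ}
    {ip iq : Fin n} (hL : m + 61 < L.maxWord) (hL' : 64 ≤ L.cells)
    (H : ∀ mem : ℕ → ℕ, (∀ a, a ≠ 60 → a ≠ 61 → mem a = st.mem a) →
      (p.Safe L { st with mem := mem } ∧ p.val { st with mem := mem } = ip) ∧
      (q.Safe L { st with mem := mem } ∧ q.val { st with mem := mem } = iq) ∧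
      d.Safe L { st with mem := mem } ∧ d.val { st with mem := mem } = a) (ha : a < L.cells) :
    ∃ t ≤ 5 * m + 5, ∃ mem : ℕ → ℕ, (∀ a, a ≠ 60 → a ≠ 61 → mem a = st.mem a) ∧
      Exec attr L (lexTie d p q) st t { st with
        mem := Function.update mem a (if ∃ i : Fin m, (∀ j : Fin m, j < i →
          st.rows ip j = st.rows iq j) ∧ st.rows ip i < st.rows iq i then 1 else 0) } := by
  have e1 : Exec attr L (.store (.lit 60) (.lit 0)) st 1
      { st with mem := Function.update st.mem 60 0 } :=
    exec_store (by simp [Expr.Safe]; omega) rfl (by omega) (by simp [Expr.Safe]) rfl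
  have e2 : Exec attr L (.store (.lit 61) (.lit 2))
      { st with mem := Function.update st.mem 60 0 } 1
      { st with mem := Function.update (Function.update st.mem 60 0) 61 2 } :=
    exec_store (st := { st with mem := Function.update st.mem 60 0 })
      (by simp [Expr.Safe]; omega) rfl (by omega) (by simp [Expr.Safe]; omega) rfl
  obtain ⟨t, ht, mem, k1, k2, k3⟩ := exec_lexLoop attr (p := p) (q := q) (ip := ip) (iq := iq) hL hL'
    (fun mem h => ⟨(H mem h).1, (H mem h).2.1⟩) m 0 (by omega)
    (Function.update (Function.update st.mem 60 0) 61 2) (fun a h60 h61 => by simp [h60, h61])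
    (by simp) (by simp) (by simp)
  obtain ⟨-, -, hd1, hd2⟩ := H mem k1
  have hs : (Expr.eq (.load (.lit 61)) (.lit 1)).Safe L { st with mem := mem } := by
    simp [Expr.Safe, Expr.val]; omega
  refine ⟨1 + (1 + (t + 2)), by omega, mem, k1, .seq _ _ _ _ _ _ _ e1 (.seq _ _ _ _ _ _ _ e2
    (.seq _ _ _ _ _ t 2 k2 ?_))⟩
  by_cases h : ∃ i : Fin m, (∀ j : Fin m, j < i → st.rows ip j = st.rows iq j) ∧
      st.rows ip i < st.rows iq i
  · rw [if_pos h]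
    exact .iteTrue _ _ _ _ _ _ hs (by simp [Expr.val, k3.2 h])
      (exec_store (st := { st with mem := mem }) hd1 hd2 ha (by simp [Expr.Safe]; omega) rfl)
  · rw [if_neg h]
    exact .iteFalse _ _ _ _ _ _ hs (by simp [Expr.val, k3.not.2 h])
      (exec_store (st := { st with mem := mem }) hd1 hd2 ha (by simp [Expr.Safe]) rfl)

theorem lexKey_id_lt_iff_fin {s t : ℕ → D} : lexKey id m s < lexKey id m t ↔
    ∃ i : Fin m, (∀ j : Fin m, j < i → s j = t j) ∧ s i < t i :=
  Iff.rfl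

/-- The implementation that exchanges rows in storage. -/
def permLayer (attr : Fin m → A) (L : Limits) (hw : 1000 * (m + n + 1) ≤ L.maxWord)
    (hc : 64 * (m + 1) ≤ L.cells) : Layer A D m n (Lex (Fin m → D)) where
  acc := permAcc
  attr := attr
  lim := L
  tk := lexKey id m
  ws := m + 1
  wt := 5 * m + 5
  Rel st σ := Agrees st σ ∧ ∀ (p : Fin n) (c : Fin m), st.rows p c = σ.g p c
  word_le := hw
  cells_le := hc
  mem h := h.1.mem
  row {st σ e} h he hn := ⟨he, ⟨⟨e.val st, hn⟩, rfl, h.2 ⟨_, hn⟩⟩⟩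
  set h x i k := ⟨h.1.set x i k, h.2⟩
  emit h l := ⟨h.1.emit l, h.2⟩
  swp {st σ} h {p q} hp hq hpn hqn := by
    refine ⟨m + 1, le_rfl, _, .swap st _ _ ⟨p.val σ, hpn⟩ ⟨q.val σ, hqn⟩
      (p.comp_safe hw hc h.1.mem hp) (q.comp_safe hw hc h.1.mem hq) (p.comp_val h.1.mem)
      (q.comp_val h.1.mem), h.1.of_rows, fun r c => ?_⟩
    have : ((Equiv.swap (⟨p.val σ, hpn⟩ : Fin n) ⟨q.val σ, hqn⟩ r : Fin n) : ℕ) =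
        Equiv.swap (p.val σ) (q.val σ) r := by
      simp only [Equiv.swap_apply_def, Fin.ext_iff]
      split_ifs <;> rfl
    simp [h.2, this]
  tie {st σ} h x {p q} hp hq hpn hqn := by
    classical
    obtain ⟨t, ht, mem, k1, k2⟩ := exec_lexTie attr (L := L) (st := st) (d := Ex.addr x (.lit 0))
      (p := p.comp) (q := q.comp) (a := 64 * 0 + x.code) (ip := ⟨p.val σ, hpn⟩)
      (iq := ⟨q.val σ, hqn⟩) (by omega) (by omega) (fun mem hmem => by
        have h' : Agrees { st with mem := mem } σ :=
          h.1.of_mem fun a ha => hmem a (by omega) (by omega)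
        have hx := x.code_lt
        refine ⟨⟨p.comp_safe hw hc h'.mem hp, p.comp_val h'.mem⟩,
          ⟨q.comp_safe hw hc h'.mem hq, q.comp_val h'.mem⟩, ?_, rfl⟩
        simp [Ex.addr, Expr.Safe, Expr.val]
        omega) (by have := x.code_lt; omega)
    have h' : Agrees { st with mem := mem } σ :=
      h.1.of_mem fun a ha => k1 a (by omega) (by omega)
    simp only [h.2] at k2
    rw [if_congr (lexKey_id_lt_iff_fin (s := σ.g (p.val σ)) (t := σ.g (q.val σ))).symm rfl rfl] at k2
    refine ⟨t, ht, _, k2, ?_, h.2⟩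
    convert h'.set x 0 _
    rfl

end Perm

end PrimeFact

namespace PrimeFact

variable {A : Type u} {D : Type v} [LinearOrder D] {m n : ℕ} {κ : Type w} [LinearOrder κ]

/-! ### Rearranging rows by an array of indices -/

/-- The address of an entry of an array outside the named ones. -/
def adr (k : ℕ) (e : Expr) : Expr := .add (.mul (.lit 64) e) (.lit k)

/-- Access to rows by an array of indices; ties are broken by an array of ranks. -/
def idxAcc : Acc where
  row e := .load (adr 60 e)
  swp p q := .store (.lit 62) (.load (adr 60 p)) ;; .store (adr 60 p) (.load (adr 60 q)) ;;
    .store (adr 60 q) (.load (.lit 62))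
  tie d p q := .store d (.lt (.load (adr 61 (.load (adr 60 p)))) (.load (adr 61 (.load (adr 60 q)))))

/-- The array of indices describes the rows by position, and the array of ranks is `rk`. -/
structure Indexed (rows : Fin n → Fin m → D) (rk : Fin n → ℕ) (st : State A D m n)
    (σ : St A D m n) : Prop where
  agrees : Agrees st σ
  rows_eq : st.rows = rows
  idx : ∀ p < n, ∃ r : Fin n, st.mem (64 * p + 60) = r ∧ ∀ c : Fin m, rows r c = σ.g p c
  rank : ∀ r : Fin n, st.mem (64 * r + 61) = rk r

section

variable {L : Limits} {st : State A D m n} {σ : St A D m n} {rows : Fin n → Fin m → D}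
  {rk : Fin n → ℕ}

theorem adr_sound (hw : 1000 * (m + n + 1) ≤ L.maxWord) (hc : 64 * n ≤ L.cells) {e : Expr} {i k : ℕ}
    (he : e.Safe L st) (hi : e.val st = i) (hin : i < n) (hk : k < 64) :
    (adr k e).Safe L st ∧ (adr k e).val st = 64 * i + k ∧ 64 * i + k < L.cells := by
  subst hi
  refine ⟨⟨⟨?_, he, ?_⟩, ?_, ?_⟩, rfl, by omega⟩ <;> simp [Expr.Safe, Expr.val] <;> omega

theorem load_sound {a : Expr} {i k : ℕ} (ha : a.Safe L st ∧ a.val st = i ∧ i < L.cells)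
    (hk : st.mem i = k) : (Expr.load a).Safe L st ∧ (Expr.load a).val st = k := by
  obtain ⟨h1, h2, h3⟩ := ha
  exact ⟨⟨h1, h2 ▸ h3⟩, by simp [Expr.val, h2, hk]⟩

/-- Two entries of the index array are exchanged with the help of cell 62. Ranks are stored by row
and not by position, so they stay in place. -/
theorem exec_idx_swp (attr : Fin m → A) (hw : 1000 * (m + n + 1) ≤ L.maxWord)
    (hc : 64 * (m + 1) ≤ L.cells) (hc' : 64 * n ≤ L.cells) (h : Indexed rows rk st σ) {p q : Ex}
    (hp : p.Ok σ) (hq : q.Ok σ) (hpn : p.val σ < n) (hqn : q.val σ < n) :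
    ∃ t ≤ 3, ∃ st', Exec attr L (idxAcc.swp p.comp q.comp) st t st' ∧
      Indexed rows rk st' (σ.swap (p.val σ) (q.val σ)) := by
  obtain ⟨r, hr, hr'⟩ := h.idx _ hpn
  obtain ⟨s, hs, hs'⟩ := h.idx _ hqn
  have key : ∀ mem : ℕ → ℕ, (∀ a, a % 64 < 60 → mem a = st.mem a) →
      ((adr 60 p.comp).Safe L { st with mem := mem } ∧
        (adr 60 p.comp).val { st with mem := mem } = 64 * p.val σ + 60 ∧
        64 * p.val σ + 60 < L.cells) ∧
      ((adr 60 q.comp).Safe L { st with mem := mem } ∧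
        (adr 60 q.comp).val { st with mem := mem } = 64 * q.val σ + 60 ∧
        64 * q.val σ + 60 < L.cells) := by
    intro mem hmem
    have h' := (h.agrees.of_mem hmem).mem
    exact ⟨adr_sound hw hc' (p.comp_safe hw hc h' hp) (p.comp_val h') hpn (by omega),
      adr_sound hw hc' (q.comp_safe hw hc h' hq) (q.comp_val h') hqn (by omega)⟩
  have h62 : ∀ st : State A D m n, (Expr.lit 62).Safe L st := by
    intro st; simp [Expr.Safe]; omega
  set mem₁ := Function.update st.mem 62 (r : ℕ) with hm₁
  set mem₂ := Function.update mem₁ (64 * p.val σ + 60) (s : ℕ) with hm₂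
  set mem₃ := Function.update mem₂ (64 * q.val σ + 60) (r : ℕ) with hm₃
  have k1 : ∀ a, a % 64 < 60 → mem₁ a = st.mem a := fun a ha => by
    rw [hm₁, Function.update_of_ne (by omega)]
  have k2 : ∀ a, a % 64 < 60 → mem₂ a = st.mem a := fun a ha => by
    rw [hm₂, Function.update_of_ne (by omega), k1 a ha]
  have k3 : ∀ a, a % 64 < 60 → mem₃ a = st.mem a := fun a ha => by
    rw [hm₃, Function.update_of_ne (by omega), k2 a ha]
  have e1 : Exec attr L (.store (.lit 62) (.load (adr 60 p.comp))) st 1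
      { st with mem := mem₁ } := by
    obtain ⟨l1, l2⟩ := load_sound (key st.mem fun _ _ => rfl).1 hr
    exact exec_store (h62 _) rfl (by omega) l1 l2
  have e2 : Exec attr L (.store (adr 60 p.comp) (.load (adr 60 q.comp))) { st with mem := mem₁ } 1
      { st with mem := mem₂ } := by
    obtain ⟨⟨a1, a2, a3⟩, hq'⟩ := key mem₁ k1
    obtain ⟨l1, l2⟩ := load_sound (st := { st with mem := mem₁ }) (k := s) hq' (by
      change mem₁ _ = _
      rw [hm₁, Function.update_of_ne (by omega), hs])
    exact exec_store (st := { st with mem := mem₁ }) a1 a2 a3 l1 l2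
  have e3 : Exec attr L (.store (adr 60 q.comp) (.load (.lit 62))) { st with mem := mem₂ } 1
      { st with mem := mem₃ } := by
    obtain ⟨-, a1, a2, a3⟩ := key mem₂ k2
    obtain ⟨l1, l2⟩ := load_sound (L := L) (st := { st with mem := mem₂ }) (a := .lit 62) (i := 62)
      (k := r) ⟨h62 _, rfl, by omega⟩ (by
      change mem₂ _ = _
      rw [hm₂, Function.update_of_ne (by omega), hm₁, Function.update_self])
    exact exec_store (st := { st with mem := mem₂ }) a1 a2 a3 l1 l2
  refine ⟨1 + (1 + 1), le_rfl, _, .seq _ _ _ _ _ _ _ e1 (.seq _ _ _ _ _ _ _ e2 e3), ?_, h.rows_eq,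
    fun e he => ?_, fun r => ?_⟩
  · have := h.agrees.of_mem k3
    exact ⟨this.mem, this.out⟩
  · simp only [St.swap_g, Function.comp]
    -- The entry of `q` is written last and is treated first; this also settles the case of equal
    -- positions.
    by_cases heq : e = q.val σ
    · subst heq
      exact ⟨r, by simp [hm₃], by simpa using hr'⟩
    by_cases hep : e = p.val σ
    · subst hep
      refine ⟨s, ?_, by simpa using hs'⟩
      rw [hm₃, Function.update_of_ne (by omega), hm₂, Function.update_self]
    · obtain ⟨r', h1, h2⟩ := h.idx e he
      refine ⟨r', ?_, by rwa [Equiv.swap_apply_of_ne_of_ne hep heq]⟩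
      rw [hm₃, Function.update_of_ne (by omega), hm₂, Function.update_of_ne (by omega), hm₁,
        Function.update_of_ne (by omega), h1]
  · change mem₃ _ = _
    rw [hm₃, Function.update_of_ne (by omega), hm₂, Function.update_of_ne (by omega), hm₁,
      Function.update_of_ne (by omega), h.rank]

/-- The implementation by an array of indices. -/
def idxLayer (attr : Fin m → A) (L : Limits) (hw : 1000 * (m + n + 1) ≤ L.maxWord)
    (hc : 64 * (m + 1) ≤ L.cells) (hc' : 64 * n ≤ L.cells) (rows : Fin n → Fin m → D)
    (rk : Fin n → ℕ) (tk : (ℕ → D) → κ)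
    (htk : ∀ r s g g', (∀ c : Fin m, rows r c = g c) → (∀ c : Fin m, rows s c = g' c) →
      (rk r < rk s ↔ tk g < tk g')) : Layer A D m n κ where
  acc := idxAcc
  attr := attr
  lim := L
  tk := tk
  ws := 3
  wt := 1
  Rel := Indexed rows rk
  word_le := hw
  cells_le := hc
  mem h := h.agrees.mem
  row {st σ e} h he hn := by
    obtain ⟨r, hr, hr'⟩ := h.idx _ hn
    obtain ⟨l1, l2⟩ := load_sound (adr_sound hw hc' he rfl hn (k := 60) (by omega)) hr
    exact ⟨l1, r, l2, by rw [h.rows_eq]; exact hr'⟩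
  set {st σ} h x i k := by
    have hx := x.code_lt
    refine ⟨h.agrees.set x i k, h.rows_eq, fun p hp => ?_, fun r => ?_⟩
    · obtain ⟨r, hr, hr'⟩ := h.idx p hp
      exact ⟨r, by rw [← hr]; exact Function.update_of_ne (by omega) _ _, hr'⟩
    · rw [← h.rank r]
      exact Function.update_of_ne (by omega) _ _
  emit h l := ⟨h.agrees.emit l, h.rows_eq, h.idx, h.rank⟩
  swp {_ _} h {_ _} hp hq hpn hqn := exec_idx_swp attr hw hc hc' h hp hq hpn hqn
  tie {st σ} h x {p q} hp hq hpn hqn := by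
    classical
    have hx := x.code_lt
    have hL : ∀ e : Ex, e.Ok σ → e.val σ < n → ∃ r : Fin n,
        (Expr.load (adr 61 (.load (adr 60 e.comp)))).Safe L st ∧
        (Expr.load (adr 61 (.load (adr 60 e.comp)))).val st = rk r ∧
        ∀ c : Fin m, rows r c = σ.g (e.val σ) c := by
      intro e he hen
      obtain ⟨r, hr, hr'⟩ := h.idx _ hen
      obtain ⟨l1, l2⟩ := load_sound (adr_sound hw hc' (e.comp_safe hw hc h.agrees.mem he)
        (e.comp_val h.agrees.mem) hen (k := 60) (by omega)) hr
      obtain ⟨l3, l4⟩ := load_sound (adr_sound hw hc' l1 l2 r.2 (k := 61) (by omega)) (h.rank r)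
      exact ⟨r, l3, l4, hr'⟩
    obtain ⟨r, r1, r2, r3⟩ := hL p hp hpn
    obtain ⟨s, s1, s2, s3⟩ := hL q hq hqn
    refine ⟨1, le_rfl, _, exec_store (i := 64 * 0 + x.code) (k := if tk (σ.g (p.val σ)) <
      tk (σ.g (q.val σ)) then 1 else 0) ?_ rfl (by omega) ⟨r1, s1⟩ ?_, ?_⟩
    · simp [Ex.addr, Expr.Safe, Expr.val]; omega
    · exact if_congr (by rw [r2, s2]; exact htk r s _ _ r3 s3) rfl rfl
    · refine ⟨?_, h.rows_eq, fun p hp => ?_, fun r => ?_⟩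
      · convert h.agrees.set x 0 _
      · obtain ⟨r, hr, hr'⟩ := h.idx p hp
        exact ⟨r, by rw [← hr]; exact Function.update_of_ne (by omega) _ _, hr'⟩
      · rw [← h.rank r]
        exact Function.update_of_ne (by omega) _ _

/-- Writes `0, 1, …` to the cells with the addresses `a`, which may depend on the counter. -/
def fill (a : Expr) : Stmt :=
  .loop (.lt (.load (.lit 62)) .size)
    (.store a (.load (.lit 62)) ;; .store (.lit 62) (.add (.load (.lit 62)) (.lit 1)))

/-- The address `f i` of round `i` may be read from cells that the loop does not write, as with
indirect addressing. Injectivity of `f` protects the values already written. -/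
theorem exec_fill (attr : Fin m → A) (hw : n < L.maxWord) (hw' : 62 ≤ L.maxWord)
    (hc : 62 < L.cells) {a : Expr} {f : ℕ → ℕ}
    (hf : Set.InjOn f (Set.Iio n)) (hf62 : ∀ i < n, f i ≠ 62)
    (H : ∀ i < n, ∀ mem : ℕ → ℕ, mem 62 = i →
      (∀ x, x ≠ 62 → (∀ j < n, x ≠ f j) → mem x = st.mem x) →
      a.Safe L { st with mem := mem } ∧ a.val { st with mem := mem } = f i ∧ f i < L.cells) :
    ∀ k i, i + k = n → ∀ mem : ℕ → ℕ, mem 62 = i → (∀ j < i, mem (f j) = j) →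
      (∀ x, x ≠ 62 → (∀ j < n, x ≠ f j) → mem x = st.mem x) →
      ∃ mem' : ℕ → ℕ, Exec attr L (fill a) { st with mem := mem } (3 * k + 1)
        { st with mem := mem' } ∧ (∀ j < n, mem' (f j) = j) ∧
        ∀ x, x ≠ 62 → (∀ j < n, x ≠ f j) → mem' x = st.mem x := by
  have h62 : ∀ mem : ℕ → ℕ, (Expr.load (.lit 62)).Safe L { st with mem := mem } := by
    intro mem; simp [Expr.Safe, Expr.val]; omega
  have hcond : ∀ mem : ℕ → ℕ,
      (Expr.lt (.load (.lit 62)) .size).Safe L { st with mem := mem } :=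
    fun mem => ⟨h62 mem, by simp [Expr.Safe]; omega⟩
  intro k
  induction k with
  | zero =>
    intro i hi mem h1 h2 h3
    refine ⟨mem, .loopDone _ _ _ (hcond mem) (by simp [Expr.val, h1]; omega),
      fun j hj => h2 j (by omega), h3⟩
  | succ k ih =>
    intro i hi mem h1 h2 h3
    obtain ⟨a1, a2, a3⟩ := H i (by omega) mem h1 h3
    have e1 : Exec attr L (.store a (.load (.lit 62))) { st with mem := mem } 1
        { st with mem := Function.update mem (f i) i } :=
      exec_store (st := { st with mem := mem }) a1 a2 a3 (h62 mem) (by simp [Expr.val, h1])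
    have h1' : Function.update mem (f i) i 62 = i := by
      rw [Function.update_of_ne (hf62 i (by omega)).symm, h1]
    have e2 : Exec attr L (.store (.lit 62) (.add (.load (.lit 62)) (.lit 1)))
        { st with mem := Function.update mem (f i) i } 1
        { st with mem := Function.update (Function.update mem (f i) i) 62 (i + 1) } := by
      refine exec_store (st := { st with mem := Function.update mem (f i) i }) (by
        simp [Expr.Safe]; omega) rfl hc ⟨h62 _, ?_, ?_⟩ ?_
      · simp [Expr.Safe]; omega
      · simp only [Expr.val, h1']; omega
      · simp only [Expr.val, h1']
    obtain ⟨mem', k1, k2, k3⟩ := ih (i + 1) (by omega)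
      (Function.update (Function.update mem (f i) i) 62 (i + 1)) (by simp) (fun j hj => by
        rw [Function.update_of_ne (hf62 j (by omega))]
        rcases Nat.lt_succ_iff_lt_or_eq.1 hj with hj | rfl
        · rw [Function.update_of_ne, h2 j hj]
          exact fun he => hj.ne (hf (by simp; omega) (by simp; omega) he)
        · rw [Function.update_self]) (fun x hx hx' => by
        rw [Function.update_of_ne hx, Function.update_of_ne (hx' i (by omega)), h3 x hx hx'])
    refine ⟨mem', ?_, k2, k3⟩
    rw [show 3 * (k + 1) + 1 = 1 + 1 + (3 * k + 1) + 1 by ring]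
    exact .loopStep _ _ _ _ _ (1 + 1) (3 * k + 1) (hcond mem)
      (by simp [Expr.val, h1]; omega) (.seq _ _ _ _ _ _ _ e1 e2) k1

end

/-- Sorts the rows. -/
def Acc.sortAll (acc : Acc) : Stmt :=
  acc.forR .b 0 .arity (put .buf Nm.b Nm.b) ;; putr .kk .arity ;; putr .sz .size ;; acc.sort

/-- All columns are compared, so the result is sorted lexicographically whatever the tie-break. -/
theorem Runs.sortAll {ly : Layer A D m n κ} {σ : St A D m n} {Q : St A D m n → Prop} {T d : ℕ}
    (hd : n ≤ 2 ^ d)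
    (hQ : ∀ τ, τ.out = σ.out → PermBelow n σ.g τ.g →
      (∀ p q, p ≤ q → q < n → lexKey id m (τ.g p) ≤ lexKey id m (τ.g q)) → Q τ)
    (hT : 3 * m + 2 * n * (d * (10 * m + 2 * ly.wt + ly.ws + 18) + ly.ws + 6) + 8 ≤ T) :
    Runs ly ly.acc.sortAll σ T Q := by
  refine seq (T₁ := 3 * m + 2)
    (T₂ := 2 * n * (d * (10 * m + 2 * ly.wt + ly.ws + 18) + ly.ws + 6) + 6) ?_ (by omega)
  refine forC m (fun i τ => τ.g = σ.g ∧ τ.out = σ.out ∧ ∀ c < i, τ.M .buf c = c) 1 (by omega)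
    ?_ ?_ ?_ ?_ (by omega)
  · simp
  · simp
  · rintro i τ hi ⟨h1, h2, h3⟩ hb
    refine put (by simp) (by simp; omega) (by simp) ⟨by simp [hb], h1, h2, fun c hc => ?_⟩ le_rfl
    simp only [Ex.val_get, Ex.val_ofNat, hb, St.set_M_same, St.set_M_ne, ne_eq, reduceCtorEq,
      not_false_eq_true]
    split_ifs with hci
    · exact hci.symm
    · exact h3 c (by omega)
  rintro τ ⟨h1, h2, h3⟩ -
  refine seq (T₁ := 1) (T₂ := 2 * n * (d * (10 * m + 2 * ly.wt + ly.ws + 18) + ly.ws + 6) + 5)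
    (put (by simp) (by simp) (by simp) ?_ le_rfl) (by omega)
  refine seq (T₁ := 1) (T₂ := 2 * n * (d * (10 * m + 2 * ly.wt + ly.ws + 18) + ly.ws + 6) + 4)
    (put (by simp) (by simp) (by simp) ?_ le_rfl) (by omega)
  refine sort (K := m) (N := n) (d := d) (by simp) le_rfl (fun i hi => by simp [h3 i hi, hi])
    (by simp) le_rfl hd (fun ρ k1 k2 k3 k4 => hQ ρ (by simpa [h2] using k2)
      (by simpa [h1] using k3) fun p q hpq hq => ?_) le_rfl
  have h4 := lexKey_le_of_rowKey_le (k4 p q hpq hq)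
  have hk : ∀ (b : ℕ → ℕ) (s : ℕ → D), (∀ c < m, b c = c) → lexKey b m s = lexKey id m s :=
    fun b s hb => congrArg toLex (funext fun i => by simp [hb i i.2])
  have hb : ∀ b : ℕ → ℕ, b = τ.M .buf → ∀ c < m, b c = c := fun b h c hc => h ▸ h3 c hc
  rwa [hk _ (ρ.g p) (hb _ (by simp)), hk _ (ρ.g q) (hb _ (by simp))] at h4

/-! ### The two machines -/

/-- The program that exchanges rows in storage. -/
def permProgram : Stmt := permAcc.factorize

/-- The program that does not change the storage. -/
def idxProgram : Stmt :=
  fill (adr 60 (.load (.lit 62))) ;; idxAcc.sortAll ;;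
    (.store (.lit 62) (.lit 0) ;; fill (adr 61 (.load (adr 60 (.load (.lit 62)))))) ;;
    idxAcc.factorize

theorem readOnly_idxProgram : idxProgram.ReadOnly := by
  simp [idxProgram, fill, Acc.sortAll, Acc.factorize, Acc.down, Acc.downStep, Acc.pick, Acc.pivot,
    Acc.partition, Acc.mark, Acc.up, Acc.upStep, Acc.splitTest, Acc.gather, Acc.sort, Acc.sift,
    Acc.cmp, Acc.groupSize, Acc.gridTest, Acc.agree, Acc.relabel, Acc.emitAll, Acc.emitConst,
    Acc.emitClasses, Acc.emitTable, Acc.nonconst, Acc.forR, Acc.ite, Acc.loopW, Acc.exch,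
    Acc.cmpTie, Acc.outVal, put, idxAcc, Stmt.ReadOnly]

/-- The bound for the running time of the main part. -/
def factorizeTime (m n d ws wt L : ℕ) : ℕ :=
  (3 * m + 2 * n * (57 * m + 2 * ws + 1) + 7) +
    ((2 * n * (L * (2 * d * (2 * wt + ws + 18) + 2 * ws + 15 * m + 43) +
      (20 * d + 4) * m) + 6 * L + 1) +
    (L * (n * (2 * d * (2 * wt + ws + 18) + 2 * ws + 22) + 5 * m + 16) +
      (n * (20 * d + 7) + 3) * m + m * (21 * n + 16) + 5))

/-- The tables in the list `Ts` are those of the classes of inseparable columns of `T`. -/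
def ListsClasses (T : Table A D) (d : D) (Ts : List (Table A D)) : Prop :=
  ∃ rs, Runs.Lists T.attr (T.rowsNat d '' Set.Iio T.size) Ts rs ∧
    ∀ c < T.arity, ∃ r ∈ rs, Insep (T.rowsNat d '' Set.Iio T.size) r c

theorem permProgram_outputs (T : Table A D) (hm : 0 < T.arity) (hn : 0 < T.size) (v : D)
    {d time cells maxWord : ℕ} (hd : T.size ≤ 2 ^ d)
    (hw : 1000 * (T.arity + T.size + 1) ≤ maxWord) (hc : 64 * (T.arity + 1) ≤ cells)
    (hT : ∀ L ≤ T.arity, L ≤ Nat.log 2 (T.size + 1) →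
      factorizeTime T.arity T.size d (T.arity + 1) (5 * T.arity + 5) L ≤ time) :
    ∃ Ts, permProgram.Outputs T time cells maxWord Ts ∧ ListsClasses T v Ts := by
  set ly : Layer A D T.arity T.size _ := permLayer T.attr ⟨cells, maxWord⟩ hw hc
  have hrun := Runs.factorize (ly := ly) (σ := ⟨fun _ _ => 0, T.rowsNat v, []⟩) (T := time)
    (Q := fun τ => ∃ Ts rs, τ.out = encodeTables Ts ∧
      Runs.Lists T.attr (T.rowsNat v '' Set.Iio T.size) Ts rs ∧
      ∀ c < T.arity, ∃ r ∈ rs, Insep (T.rowsNat v '' Set.Iio T.size) r c) (d := d) rfl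
    T.attr_injective hm hn (T.rowsNat_injOn v)
    (fun p _ q _ c hc => (Table.rowsNat_of_le v p hc).trans (Table.rowsNat_of_le v q hc).symm) hd
    (fun τ Ts rs h1 h2 h3 => ⟨Ts, rs, h1, h2, h3⟩) hT
  obtain ⟨t, ht, st, σ, h1, h2, Ts, rs, h3, h4⟩ := hrun T.start
    ⟨⟨fun _ _ => rfl, rfl⟩, fun p c => (Table.rowsNat_of_lt v p c).symm⟩
  exact ⟨Ts, ⟨t, ht, st, h1, h2.1.out.trans h3⟩, rs, h4⟩

section

variable (attr : Fin m → A) {L : Limits} {st : State A D m n}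

theorem exec_fill_idx (hw : 1000 * (m + n + 1) ≤ L.maxWord) (hc : 64 * (m + 1) ≤ L.cells)
    (hc' : 64 * n ≤ L.cells) (h0 : st.mem = fun _ => 0) (ho : st.out = []) {g : ℕ → ℕ → D}
    (hg : ∀ p c, st.rows p c = g p c) :
    ∃ st₁, Exec attr L (fill (adr 60 (.load (.lit 62)))) st (3 * n + 1) st₁ ∧
      Indexed st.rows (fun _ => 0) st₁ ⟨fun _ _ => 0, g, []⟩ := by
  obtain ⟨mem, a1, a2, a3⟩ := exec_fill (L := L) (st := st) attr
    (a := adr 60 (.load (.lit 62))) (f := fun i => 64 * i + 60) (by omega)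
    (by omega) (by omega) (fun i _ j _ h => by simpa using h)
    (fun i _ => by omega) (fun i hi mem h1 _ => adr_sound hw hc'
      (by simp [Expr.Safe, Expr.val]; omega) (by simp [Expr.val, h1]) hi (by omega)) n 0 (by omega)
    st.mem (by rw [h0]) (by simp) (fun _ _ _ => rfl)
  rw [h0] at a3
  refine ⟨_, a1, ⟨fun x i => ?_, ho⟩, rfl, fun p hp => ⟨⟨p, hp⟩, a2 p hp, hg _⟩, fun r => ?_⟩
  · have := x.code_lt
    exact a3 _ (by omega) (fun j _ => by omega)
  · exact a3 _ (by omega) (fun j _ => by omega)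

/-- If `f p` is the stored row at position `p`, writing `p` to the rank cell of `f p` stores the
inverse of `f`. Once the rows are sorted, these positions are the ranks in lexicographic order. -/
theorem exec_fill_rank (hw : 1000 * (m + n + 1) ≤ L.maxWord) (hc : 64 * (m + 1) ≤ L.cells)
    (hc' : 64 * n ≤ L.cells) {σ : St A D m n} {rows : Fin n → Fin m → D} {rk : Fin n → ℕ}
    (h : Indexed rows rk st σ) (hn : 0 < n)
    (hg : ∀ p < n, ∀ q < n, (∀ c < m, σ.g p c = σ.g q c) → p = q) :
    ∃ st₁ rk₁, Exec attr L (.store (.lit 62) (.lit 0) ;;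
        fill (adr 61 (.load (adr 60 (.load (.lit 62)))))) st (3 * n + 2) st₁ ∧
      Indexed rows rk₁ st₁ σ ∧ ∀ r, rk₁ r < n ∧ ∀ c : Fin m, rows r c = σ.g (rk₁ r) c := by
  have : Nonempty (Fin n) := ⟨⟨0, hn⟩⟩
  choose! f hf1 hf2 using h.idx
  have hfi : ∀ p < n, ∀ q < n, f p = f q → p = q := fun p hp q hq he =>
    hg p hp q hq fun c hc => by rw [← hf2 p hp ⟨c, hc⟩, he, hf2 q hq ⟨c, hc⟩]
  -- Distinct positions hold distinct rows, so `f` is injective on a finite set and hence onto.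
  have hsur : ∀ r, ∃ p : Fin n, f p = r := Finite.surjective_of_injective (f := fun p : Fin n => f p)
    fun p q he => Fin.ext (hfi p p.2 q q.2 he)
  choose k hk using hsur
  have h62 : ∀ mem : ℕ → ℕ, (Expr.load (.lit 62)).Safe L { st with mem := mem } := by
    intro mem; simp [Expr.Safe, Expr.val]; omega
  have e0 : Exec attr L (.store (.lit 62) (.lit 0)) st 1
      { st with mem := Function.update st.mem 62 0 } :=
    exec_store (by simp [Expr.Safe]; omega) rfl (by omega) (by simp [Expr.Safe]) rfl
  obtain ⟨mem, a1, a2, a3⟩ := exec_fill (L := L) (st := st) attr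
    (a := adr 61 (.load (adr 60 (.load (.lit 62))))) (f := fun i => 64 * (f i : ℕ) + 61) (by omega)
    (by omega) (by omega) (fun i hi j hj h => hfi i hi j hj (Fin.ext (by simpa using h)))
    (fun i _ => by omega) (fun i hi mem h1 h2 => by
      obtain ⟨l1, l2⟩ := load_sound (st := { st with mem := mem }) (k := f i)
        (adr_sound (i := i) (k := 60) hw hc' (h62 mem) (by simp [Expr.val, h1]) hi (by omega))
        ((h2 _ (by omega) fun j _ => by omega).trans (hf1 i hi))
      exact adr_sound hw hc' l1 l2 (f i).2 (by omega)) n 0 (by omega)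
    (Function.update st.mem 62 0) (by simp) (by simp) (fun x hx _ => Function.update_of_ne hx _ _)
  refine ⟨_, fun r => k r, ?_, ⟨h.agrees.of_mem fun a ha => a3 a (by omega) fun j _ => by omega,
    h.rows_eq, fun p hp => ⟨f p, ?_, hf2 p hp⟩, fun r => ?_⟩, fun r => ⟨(k r).2, fun c => ?_⟩⟩
  · rw [show 3 * n + 2 = 1 + (3 * n + 1) by ring]
    exact .seq _ _ _ _ _ _ _ e0 a1
  · exact (a3 _ (by omega) fun j _ => by omega).trans (hf1 p hp)
  · have := a2 (k r) (k r).2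
    simp only [hk] at this
    exact this
  · rw [← hf2 _ (k r).2, hk]

theorem lexKey_id_congr {s s' : ℕ → D} (h : ∀ c : Fin m, s c = s' c) :
    lexKey id m s = lexKey id m s' :=
  congrArg toLex (funext h)

/-- Two layers act on the same memory. The initial sort runs with a trivial key in `Unit` and all
ranks zero; then the ranks are filled in, and the main part compares ranks instead of whole rows. -/
theorem exec_idxProgram (ha : Function.Injective attr) (hm : 0 < m) (hn : 0 < n)
    (hw : 1000 * (m + n + 1) ≤ L.maxWord) (hc : 64 * (m + 1) ≤ L.cells)
    (hc' : 64 * n ≤ L.cells) (h0 : st.mem = fun _ => 0) (ho : st.out = []) {g : ℕ → ℕ → D}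
    (hg : ∀ p c, st.rows p c = g p c) (hinj : Set.InjOn g (Set.Iio n))
    (hgm : ∀ p q c, m ≤ c → g p c = g q c) {d time : ℕ} (hd : n ≤ 2 ^ d)
    (hT : ∀ L ≤ m, L ≤ Nat.log 2 (n + 1) →
      6 * n + 3 * m + 2 * n * (d * (10 * m + 23) + 9) + 11 + factorizeTime m n d 3 1 L ≤ time) :
    ∃ t ≤ time, ∃ st₁, Exec attr L idxProgram st t st₁ ∧ ∃ Ts rs, st₁.out = encodeTables Ts ∧
      Runs.Lists attr (g '' Set.Iio n) Ts rs ∧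
      ∀ c < m, ∃ r ∈ rs, Insep (g '' Set.Iio n) r c := by
  obtain ⟨st₁, a1, a2⟩ := exec_fill_idx attr hw hc hc' h0 ho hg
  have hS := Runs.sortAll (ly := idxLayer (κ := Unit) attr L hw hc hc' st.rows (fun _ => 0)
    (fun _ => ()) (by simp)) (σ := ⟨fun _ _ => 0, g, []⟩)
    (T := 3 * m + 2 * n * (d * (10 * m + 23) + 9) + 8)
    (Q := fun τ => τ.out = [] ∧ PermBelow n g τ.g ∧
      ∀ p q, p ≤ q → q < n → lexKey id m (τ.g p) ≤ lexKey id m (τ.g q)) hd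
    (fun τ h1 h2 h3 => ⟨h1, h2, h3⟩) (by
      change 3 * m + 2 * n * (d * (10 * m + 2 * 1 + 3 + 18) + 3 + 6) + 8 ≤ _
      exact le_of_eq (by ring))
  obtain ⟨t₂, ht₂, st₂, σ, b1, b2, b3, b4, b5⟩ := hS st₁ a2
  replace b1 : Exec attr L idxAcc.sortAll st₁ t₂ st₂ := b1
  replace b2 : Indexed st.rows (fun _ => 0) st₂ σ := b2
  have hinj' : Set.InjOn σ.g (Set.Iio n) := b4.injOn hinj
  have hgm' : ∀ p < n, ∀ q < n, ∀ c, m ≤ c → σ.g p c = σ.g q c := by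
    intro p hp q hq c hc
    obtain ⟨p', hp', e1⟩ := b4.exists_eq hp
    obtain ⟨q', hq', e2⟩ := b4.exists_eq hq
    rw [e1, e2]
    exact hgm p' q' c hc
  have hcol : ∀ p < n, ∀ q < n, (∀ c < m, σ.g p c = σ.g q c) → p = q :=
    fun p hp q hq h => hinj' hp hq (lexKey_id_injOn (fun c hc => hgm' p hp q hq c hc)
      (lexKey_eq_iff.2 h))
  have hlt : ∀ p < n, ∀ q < n, (p < q ↔ lexKey id m (σ.g p) < lexKey id m (σ.g q)) := by
    intro p hp q hq
    refine ⟨fun h => lt_of_le_of_ne (b5 p q h.le hq) fun he =>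
      h.ne (hcol p hp q hq (lexKey_eq_iff.1 he)), fun h => ?_⟩
    by_contra hn
    exact absurd (b5 q p (not_lt.1 hn) hp) (not_le.2 h)
  obtain ⟨st₃, rk, c1, c2, c3⟩ := exec_fill_rank attr hw hc hc' b2 hn hcol
  have hF := Runs.factorize (ly := idxLayer attr L hw hc hc' st.rows rk (lexKey id m)
    (fun r s g g' h h' => by
      rw [lexKey_id_congr fun c => (h c).symm.trans ((c3 r).2 c),
        lexKey_id_congr fun c => (h' c).symm.trans ((c3 s).2 c)]
      exact hlt _ (c3 r).1 _ (c3 s).1)) (σ := σ)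
    (T := time - (6 * n + 3 * m + 2 * n * (d * (10 * m + 23) + 9) + 11))
    (Q := fun τ => ∃ Ts rs, τ.out = encodeTables Ts ∧ Runs.Lists attr (g '' Set.Iio n) Ts rs ∧
      ∀ c < m, ∃ r ∈ rs, Insep (g '' Set.Iio n) r c) (d := d) rfl ha hm hn hinj' hgm' hd
    (fun τ Ts rs h1 h2 h3 => ⟨Ts, rs, by rw [h1, b3, List.nil_append],
      b4.image_eq le_rfl ▸ h2, b4.image_eq le_rfl ▸ h3⟩)
    (fun K h1 h2 => Nat.le_sub_of_add_le' (hT K h1 h2))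
  obtain ⟨t₄, ht₄, st₄, σ₄, d1, d2, Ts, rs, d3, d4⟩ := hF st₃ c2
  replace d1 : Exec attr L idxAcc.factorize st₃ t₄ st₄ := d1
  replace d2 : Indexed st.rows rk st₄ σ₄ := d2
  -- The instance `L = 0` shows that the subtraction in the time allotted to the last part is not
  -- truncated.
  have := hT 0 (by omega) (by omega)
  exact ⟨_, by omega, st₄, .seq _ _ _ _ _ _ _ a1 (.seq _ _ _ _ _ _ _ b1
    (.seq _ _ _ _ _ _ _ c1 d1)), Ts, rs, d2.agrees.out.trans d3, d4⟩

end

theorem idxProgram_outputs (T : Table A D) (hm : 0 < T.arity) (hn : 0 < T.size) (v : D)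
    {d time cells maxWord : ℕ} (hd : T.size ≤ 2 ^ d)
    (hw : 1000 * (T.arity + T.size + 1) ≤ maxWord) (hc : 64 * (T.arity + 1) ≤ cells)
    (hc' : 64 * T.size ≤ cells)
    (hT : ∀ L ≤ T.arity, L ≤ Nat.log 2 (T.size + 1) →
      6 * T.size + 3 * T.arity + 2 * T.size * (d * (10 * T.arity + 23) + 9) + 11 +
        factorizeTime T.arity T.size d 3 1 L ≤ time) :
    ∃ Ts, idxProgram.Outputs T time cells maxWord Ts ∧ ListsClasses T v Ts := by
  obtain ⟨t, ht, st, h1, Ts, rs, h2, h3⟩ := exec_idxProgram T.attr (L := ⟨cells, maxWord⟩)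
    (st := T.start) T.attr_injective hm hn hw hc hc' rfl rfl
    (fun p c => (Table.rowsNat_of_lt v p c).symm) (T.rowsNat_injOn v)
    (fun p q c hc => (Table.rowsNat_of_le v p hc).trans (Table.rowsNat_of_le v q hc).symm) hd hT
  exact ⟨Ts, ⟨t, ht, st, h1, h2⟩, rs, h3⟩

end PrimeFact

/-! ### Bounds for time, space and word size; the theorem -/

namespace PrimeFact

variable {A : Type u} {D : Type v} [LinearOrder D] {m n : ℕ}

section Bounds

variable {l d L C : ℕ}

/-- As `m + n ≥ 2`, twelve of the factors already give 4096, and the thirteenth absorbs `m + n + 1`.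
-/
theorem le_word (hm : 0 < m) (hn : 0 < n) (hC : 13 ≤ C) : 1000 * (m + n + 1) ≤ (m + n) ^ C := by
  have h1 : (m + n) ^ 13 ≤ (m + n) ^ C := Nat.pow_le_pow_right (by omega) hC
  have h2 : 2 ^ 12 ≤ (m + n) ^ 12 := Nat.pow_le_pow_left (by omega) 12
  have h3 : 2 ^ 12 * (m + n) ≤ (m + n) ^ 12 * (m + n) := Nat.mul_le_mul_right _ h2
  rw [← pow_succ] at h3
  norm_num at h3
  omega

/-- With constant costs for exchanges and tie-breaks the critical term is `n * L * d`; it is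
absorbed by `L ≤ m`, and no second logarithm arises. -/
theorem idx_time_le (hm : 0 < m) (hn : 0 < n) (hl : 0 < l) (hd : d ≤ 2 * l) (h1 : L ≤ m)
    (h2 : L ≤ l) : 6 * n + 3 * m + 2 * n * (d * (10 * m + 23) + 9) + 11 +
      factorizeTime m n d 3 1 L ≤ 1000 * (m * n * l) := by
  have b1 : m * n ≤ m * n * l := Nat.le_mul_of_pos_right _ hl
  have b2 : m ≤ m * n := Nat.le_mul_of_pos_right _ hn
  have b3 : n ≤ m * n := Nat.le_mul_of_pos_left _ hm
  have b4 : m * n * d ≤ m * n * (2 * l) := Nat.mul_le_mul_left _ hd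
  have b5 : n * d ≤ m * n * d := Nat.mul_le_mul_right _ b3
  have b6 : L * n * d ≤ m * n * d := by gcongr
  have b7 : m * n * L ≤ m * n * l := Nat.mul_le_mul_left _ h2
  have b8 : n * L ≤ m * n * L := Nat.mul_le_mul_right _ b3
  have b9 : m * L ≤ m * n * L := Nat.mul_le_mul_right _ b2
  rw [factorizeTime]
  nlinarith

/-- Here exchanges and tie-breaks cost `O(m)`, and the critical term `m * n * L * d` is bounded by
`L ≤ l`, which produces the square of the logarithm. -/
theorem perm_time_le (hm : 0 < m) (hn : 0 < n) (hl : 0 < l) (hd : d ≤ 2 * l) (h1 : L ≤ m)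
    (h2 : L ≤ l) : factorizeTime m n d (m + 1) (5 * m + 5) L ≤ 3000 * (m * n * l ^ 2) := by
  have b0 : m * n * l ≤ m * n * l ^ 2 := Nat.mul_le_mul_left _ (Nat.le_self_pow two_ne_zero l)
  have b1 : m * n ≤ m * n * l := Nat.le_mul_of_pos_right _ hl
  have b2 : m ≤ m * n := Nat.le_mul_of_pos_right _ hn
  have b3 : n ≤ m * n := Nat.le_mul_of_pos_left _ hm
  have b4 : m * n * d ≤ m * n * (2 * l) := Nat.mul_le_mul_left _ hd
  have b5 : n * d ≤ m * n * d := Nat.mul_le_mul_right _ b3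
  have b6 : L * n * d ≤ m * n * d := by gcongr
  have b7 : m * n * L ≤ m * n * l := Nat.mul_le_mul_left _ h2
  have b8 : n * L ≤ m * n * L := Nat.mul_le_mul_right _ b3
  have b9 : m * L ≤ m * n * L := Nat.mul_le_mul_right _ b2
  have b10 : m * n * (L * d) ≤ m * n * (l * (2 * l)) := Nat.mul_le_mul_left _ (Nat.mul_le_mul h2 hd)
  rw [factorizeTime]
  nlinarith

end Bounds

/-- The tables of the classes of inseparable columns represent the members of a prime
factorization. -/
theorem factorizes_of_outputs {P : Stmt} {R : Reln A D} (hR : R.tuples.Nonempty)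
    {time cells maxWord : ℕ → ℕ → ℕ}
    (h : ∀ T : Table A D, 0 < T.arity → 0 < T.size → ∀ v,
      ∃ Ts, P.Outputs T (time T.arity T.size) (cells T.arity T.size) (maxWord T.arity T.size) Ts ∧
        ListsClasses T v Ts) :
    P.Factorizes R (time R.arity R.size) (cells R.arity R.size) (maxWord R.arity R.size) := by
  intro T hT
  have hm : 0 < R.arity := R.sch_nonempty.card_pos
  have hn : 0 < R.size := hR.card_pos
  rw [hT.arity_eq] at hm ⊢
  rw [hT.size_eq] at hn ⊢
  -- An entry of the table serves as the default value beyond the table.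
  obtain ⟨Ts, h1, rs, h2, h3⟩ := h T hm hn (T.rows ⟨0, hn⟩ ⟨0, hm⟩)
  obtain ⟨Fs, h4, h5, h6⟩ := hT.exists_factors hR h2 h3
  exact ⟨Ts, Fs, h1, h4, h5, h6⟩

theorem log_succ_pos (hn : 0 < n) : 0 < Nat.log 2 (n + 1) :=
  Nat.log_pos one_lt_two (by omega)

/-- This gives the depth `d = λ(n) + 1` of the heaps, which is at most `2 λ(n)` since `λ(n) ≥ 1`. -/
theorem le_two_pow_log (n : ℕ) : n ≤ 2 ^ (Nat.log 2 (n + 1) + 1) :=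
  (Nat.le_succ n).trans (Nat.lt_pow_succ_log_self one_lt_two (n + 1)).le

theorem idxProgram_factorizes {R : Reln A D} (hR : R.tuples.Nonempty) :
    idxProgram.Factorizes R (1000 * (R.arity * R.size * Nat.log 2 (R.size + 1)))
      (1000 * (R.size + R.arity * Nat.log 2 (R.size + 1))) ((R.arity + R.size) ^ 1000) := by
  refine factorizes_of_outputs (time := fun m n => 1000 * (m * n * Nat.log 2 (n + 1)))
    (cells := fun m n => 1000 * (n + m * Nat.log 2 (n + 1))) (maxWord := fun m n => (m + n) ^ 1000)
    hR fun T hm hn v => ?_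
  have hl := log_succ_pos hn
  have hml : T.arity ≤ T.arity * Nat.log 2 (T.size + 1) := Nat.le_mul_of_pos_right _ hl
  exact idxProgram_outputs T hm hn v (le_two_pow_log T.size) (le_word hm hn (by omega)) (by omega)
    (by omega) fun L h1 h2 => idx_time_le hm hn hl (by omega) h1 h2

theorem permProgram_factorizes {R : Reln A D} (hR : R.tuples.Nonempty) :
    permProgram.Factorizes R (3000 * (R.arity * R.size * Nat.log 2 (R.size + 1) ^ 2))
      (3000 * (R.arity * Nat.log 2 (R.size + 1))) ((R.arity + R.size) ^ 3000) := by
  refine factorizes_of_outputs (time := fun m n => 3000 * (m * n * Nat.log 2 (n + 1) ^ 2))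
    (cells := fun m n => 3000 * (m * Nat.log 2 (n + 1))) (maxWord := fun m n => (m + n) ^ 3000)
    hR fun T hm hn v => ?_
  have hl := log_succ_pos hn
  have hml : T.arity ≤ T.arity * Nat.log 2 (T.size + 1) := Nat.le_mul_of_pos_right _ hl
  exact permProgram_outputs T hm hn v (le_two_pow_log T.size) (le_word hm hn (by omega)) (by omega)
    fun L h1 h2 => perm_time_le hm hn hl (by omega) h1 h2

end PrimeFact

theorem mainTheorem3 :
    (∀ (A : Type u) (D : Type v) (R : PrimeFact.Reln A D), R.tuples.Nonempty →
      ∃! Fs : Set (PrimeFact.Reln A D), R.IsPrimeFactorization Fs) ∧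
    (∃ (P : PrimeFact.Stmt) (C : ℕ), P.ReadOnly ∧
      ∀ (A : Type u) (D : Type v) [LinearOrder D] (R : PrimeFact.Reln A D), R.tuples.Nonempty →
        P.Factorizes R
          (C * (R.arity * R.size * Nat.log 2 (R.size + 1)))
          (C * (R.size + R.arity * Nat.log 2 (R.size + 1)))
          ((R.arity + R.size) ^ C)) ∧
    (∃ (P : PrimeFact.Stmt) (C : ℕ),
      ∀ (A : Type u) (D : Type v) [LinearOrder D] (R : PrimeFact.Reln A D), R.tuples.Nonempty →
        P.Factorizes R
          (C * (R.arity * R.size * Nat.log 2 (R.size + 1) ^ 2))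
          (C * (R.arity * Nat.log 2 (R.size + 1)))
          ((R.arity + R.size) ^ C)) := by
  refine ⟨fun A D R hR => ?_, ⟨PrimeFact.idxProgram, 1000, PrimeFact.readOnly_idxProgram,
    fun A D _ R hR => PrimeFact.idxProgram_factorizes hR⟩, ⟨PrimeFact.permProgram, 3000,
    fun A D _ R hR => PrimeFact.permProgram_factorizes hR⟩⟩
  exact ⟨_, (PrimeFact.Reln.isPrimeFactorization_iff (PrimeFact.Reln.exists_has hR) _).2 rfl,
    fun Fs h => (PrimeFact.Reln.isPrimeFactorization_iff (PrimeFact.Reln.exists_has hR) Fs).1 h⟩
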